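/- For $x,\xi\in\mathbb{R}$ let $T_xh(t)=h(t-x)$ and $M_\xi h(t)=e^{2\pi i\xi t}h(t)$; for $h\in L^2(\mathbb{R})$ and $\alpha,\beta>0$ let $\mathcal{G}(h,\alpha,\beta)=\{M_{\beta n}T_{\alpha k}h\}_{k,n\in\mathbb{Z}}$, and let $\mathcal{F}$ be the Fourier transform. This system is a Gabor frame for $L^2(\mathbb{R})$ if there are $A,B>0$ with $A\|f\|_{L^2}^2\le\sum_{k,n}|\langle f,M_{\beta n}T_{\alpha k}h\rangle|^2\le B\|f\|_{L^2}^2$ for all $f\in L^2(\mathbb{R})$; its canonical dual frame is then $\mathcal{G}(\widetilde h,\alpha,\beta)$ with $\widetilde h=S^{-1}h$, where $Sf=\sum_{k,n}\langle f,M_{\beta n}T_{\alpha k}h\rangle M_{\beta n}T_{\alpha k}h$ is the frame operator. Fix a Schwartz function $\psi\neq0$ on $\mathbb{R}$. For a tempered distribution $f$ put $V_\psi f(x,w)=\langle f,M_wT_x\psi\rangle$ (the bracket being conjugate linear in the second entry) and, for $1\le p,q<\infty$, $$\|f\|_{M^{p,q}}=\Bigl(\int_{\mathbb{R}}\Bigl(\int_{\mathbb{R}}|V_\psi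 f(x,w)|^p\,dx\Bigr)^{q/p}dw\Bigr)^{1/q},\qquad M^{p,q}(\mathbb{R})=\{f\in\mathcal{S}'(\mathbb{R}):\|f\|_{M^{p,q}}<\infty\}.$$ Also let $\|(c_{kn})\|_{\ell^{p,q}}=\bigl(\sum_n(\sum_k|c_{kn}|^p)^{q/p}\bigr)^{1/q}$. For $f\in M^{p,q}(\mathbb{R})$ and a window $h$, $\langle f,h\rangle$ denotes the duality pairing $\|\psi\|_{L^2}^{-2}\iint V_\psi f(x,w)\,\overline{V_\psi h(x,w)}\,dx\,dw$, which extends the inner product of $L^2(\mathbb{R})$. Theorem. Let $a<b$, $\beta>0$ and $0<\alpha\le b-a\le\beta^{-1}$. Let $g\colon\mathbb{R}\to\mathbb{C}$ be differentiable on $[a,b]$ (one-sidedly at the endpoints) with derivative absolutely continuous on $[a,b]$, that is $g\in C^1_{AC}[a,b]$, and suppose that $|g|\ge\delta>0$ on $[a,b]$. Then: (a) $\mathcal{G}(g\chi_{[a,b]},\alpha,\beta)$ is a Gabor frame for $L^2(\mathbb{R})$. Let $\widetilde g\in L^2(\mathbb{R})$ be the atom of its canonical dual frame. Then for all $1<p<\infty$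 and $1\le q<\infty$: (b) for every $f\in M^{p,q}(\mathbb{R})$ the pairings below are absolutely convergent and $$f=\sum_{n,k\in\mathbb{Z}}\langle f,M_{\alpha n}T_{\beta k}\mathcal{F}(\widetilde g)\rangle\,M_{\alpha n}T_{\beta k}\mathcal{F}(g\chi_{[a,b]})=\sum_{n,k\in\mathbb{Z}}\langle f,M_{\alpha n}T_{\beta k}\mathcal{F}(g\chi_{[a,b]})\rangle\,M_{\alpha n}T_{\beta k}\mathcal{F}(\widetilde g)$$ with unconditional convergence of both series in $M^{p,q}(\mathbb{R})$; (c) there are constants $A,B>0$ such that for all $f\in M^{p,q}(\mathbb{R})$ $$A\,\|f\|_{M^{p,q}}\le\bigl\|\bigl(\langle f,M_{\alpha n}T_{\beta k}\mathcal{F}(g\chi_{[a,b]})\rangle\bigr)_{k,n\in\mathbb{Z}}\bigr\|_{\ell^{p,q}}\le B\,\|f\|_{M^{p,q}}.$$ -/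

import Mathlib

open MeasureTheory Filter Topology Set
open scoped SchwartzMap FourierTransform ENNReal ComplexConjugate

noncomputable section

namespace GaborMod

/-! ### The function class `C¹_AC[a,b]` -/

/-- `g` is differentiable on `[a,b]` (one-sidedly at the endpoints) and its derivative is
absolutely continuous on `[a,b]`. Nothing is required of `g` outside `[a,b]`. -/
structure IsC1AC (g : ℝ → ℂ) (a b : ℝ) : Prop where
  differentiableOn : DifferentiableOn ℝ g (Icc a b)
  absCont_deriv : AbsolutelyContinuousOnInterval (derivWithin g (Icc a b)) a b

/-- `g · χ_[a,b]` is square integrable for `g ∈ C¹_AC[a,b]`. -/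
theorem IsC1AC.memLp {g : ℝ → ℂ} {a b : ℝ} (h : IsC1AC g a b) :
    MemLp (indicator (Icc a b) g) 2 volume := by
  rw [memLp_indicator_iff_restrict measurableSet_Icc]
  obtain ⟨C, hC⟩ := isCompact_Icc.exists_bound_of_continuousOn h.differentiableOn.continuousOn
  refine MemLp.of_bound (h.differentiableOn.continuousOn.aestronglyMeasurable measurableSet_Icc) C ?_
  exact (ae_restrict_iff' measurableSet_Icc).2 (Eventually.of_forall hC)

/-! ### Time-frequency shifts -/

/-- The character `t ↦ e^{2πiξt}`. -/
def char (ξ t : ℝ) : ℂ := Complex.exp (2 * Real.pi * Complex.I * ξ * t)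

theorem continuous_char (ξ : ℝ) : Continuous (char ξ) := by
  unfold char; fun_prop

theorem norm_char (ξ t : ℝ) : ‖char ξ t‖ = 1 := by
  have h : (2 * Real.pi * Complex.I * ξ * t : ℂ) = ((2 * Real.pi * ξ * t : ℝ) : ℂ) * Complex.I := by
    push_cast; ring
  rw [char, h, Complex.norm_exp_ofReal_mul_I]

theorem iteratedDeriv_char (ξ : ℝ) (n : ℕ) :
    iteratedDeriv n (char ξ) = fun t ↦ (2 * Real.pi * Complex.I * ξ) ^ n * char ξ t := by
  induction n with
  | zero => simp
  | succ n ih =>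
    rw [iteratedDeriv_succ, ih]
    funext t
    have h : HasDerivAt (char ξ) (char ξ t * (2 * Real.pi * Complex.I * ξ * 1)) t :=
      ((Complex.ofRealCLM.hasDerivAt (x := t)).const_mul (2 * Real.pi * Complex.I * ξ : ℂ)).cexp
    rw [(h.const_mul _).deriv]
    ring

theorem hasTemperateGrowth_char (ξ : ℝ) : (char ξ).HasTemperateGrowth := by
  refine ⟨?_, fun n ↦ ⟨0, ‖(2 * Real.pi * Complex.I * ξ : ℂ)‖ ^ n, fun t ↦ ?_⟩⟩
  · exact (contDiff_const.mul Complex.ofRealCLM.contDiff).cexp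
  · rw [norm_iteratedFDeriv_eq_norm_iteratedDeriv, iteratedDeriv_char, norm_mul, norm_pow,
      norm_char]
    simp

/-- `M_ξ T_x ψ (t) = e^{2πiξt} ψ(t - x)` for a Schwartz function `ψ`. -/
def schwartzShift (x ξ : ℝ) (ψ : 𝓢(ℝ, ℂ)) : 𝓢(ℝ, ℂ) :=
  SchwartzMap.smulLeftCLM ℂ (char ξ) (SchwartzMap.compSubConstCLM ℂ x ψ)

theorem schwartzShift_apply (x ξ : ℝ) (ψ : 𝓢(ℝ, ℂ)) (t : ℝ) :
    schwartzShift x ξ ψ t = char ξ t * ψ (t - x) := by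
  simp [schwartzShift, SchwartzMap.smulLeftCLM_apply_apply (hasTemperateGrowth_char ξ)]

/-- The complex conjugate of a Schwartz function. -/
def schwartzConj (ψ : 𝓢(ℝ, ℂ)) : 𝓢(ℝ, ℂ) :=
  SchwartzMap.postcompCLM (𝕜 := ℝ) (Complex.conjCLE : ℂ →L[ℝ] ℂ) ψ

theorem schwartzConj_apply (ψ : 𝓢(ℝ, ℂ)) (t : ℝ) : schwartzConj ψ t = conj (ψ t) := rfl

/-- `L²(ℝ)`. -/
abbrev L2 : Type := Lp ℂ 2 (volume : Measure ℝ)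

theorem memLp_shift (x ξ : ℝ) (h : L2) :
    MemLp (fun t : ℝ ↦ char ξ t * h (t - x)) 2 volume := by
  have h1 : MemLp (fun t : ℝ ↦ h (t - x)) 2 volume :=
    (Lp.memLp h).comp_measurePreserving (measurePreserving_sub_right volume x)
  refine h1.of_le ((continuous_char ξ).aestronglyMeasurable.mul h1.1) (Eventually.of_forall ?_)
  intro t
  simp [norm_char]

/-- `M_ξ T_x h (t) = e^{2πiξt} h(t - x)` for `h ∈ L²(ℝ)`. -/
def shift (x ξ : ℝ) (h : L2) : L2 := (memLp_shift x ξ h).toLp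

/-- The element `g · χ_[a,b]` of `L²(ℝ)`, for `g ∈ C¹_AC[a,b]`. -/
def cutoff {g : ℝ → ℂ} {a b : ℝ} (hg : IsC1AC g a b) : L2 := hg.memLp.toLp

/-- The Gabor system `𝒢(h, α, β) = (M_{βn} T_{αk} h)_{k,n}`, indexed by the pairs `(k, n)`. -/
def gaborSystem (h : L2) (α β : ℝ) (i : ℤ × ℤ) : L2 := shift (α * i.1) (β * i.2) h

/-! ### Frames and canonical dual frames in a Hilbert space -/

section Frames

variable {H : Type*} [NormedAddCommGroup H] [InnerProductSpace ℂ H] {ι : Type*}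

/-- `(e i)` is a frame for `H`: there are `A, B > 0` with
`A ‖f‖² ≤ ∑ |⟨f, e i⟩|² ≤ B ‖f‖²` for all `f`. -/
def IsFrame (e : ι → H) : Prop :=
  ∃ A B : ℝ, 0 < A ∧ 0 < B ∧ ∀ f : H,
    Summable (fun i ↦ ‖inner ℂ (e i) f‖ ^ 2) ∧
    A * ‖f‖ ^ 2 ≤ ∑' i, ‖inner ℂ (e i) f‖ ^ 2 ∧
    ∑' i, ‖inner ℂ (e i) f‖ ^ 2 ≤ B * ‖f‖ ^ 2

/-- `(d i)` is the canonical dual frame of the frame `(e i)`, that is `d i = S⁻¹ (e i)` for the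
frame operator `S f = ∑ ⟨f, e j⟩ e j`. Since `S` is invertible, this says `S (d i) = e i`. -/
def IsCanonicalDual (e d : ι → H) : Prop :=
  IsFrame e ∧ ∀ i, HasSum (fun j ↦ (inner ℂ (e j) (d i) : ℂ) • e j) (e i)

end Frames

/-! ### Modulation spaces -/

/-- The short-time Fourier transform `V_ψ f (x, w) = ⟨f, M_w T_x ψ⟩` of a tempered distribution.
The bracket is conjugate linear in its second entry, while Mathlib's evaluation `f φ` is the
bilinear pairing (`∫ φ f` if `f` is a function); hence the conjugate. -/
def stft (ψ : 𝓢(ℝ, ℂ)) (f : 𝓢'(ℝ, ℂ)) (x w : ℝ) : ℂ :=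
  f (schwartzConj (schwartzShift x w ψ))

/-- `‖f‖_{M^{p,q}} = (∫ (∫ |V_ψ f (x,w)|^p dx)^{q/p} dw)^{1/q}`, with values in `[0, ∞]`. -/
def modNorm (ψ : 𝓢(ℝ, ℂ)) (p q : ℝ) (f : 𝓢'(ℝ, ℂ)) : ℝ≥0∞ :=
  (∫⁻ w : ℝ, (∫⁻ x : ℝ, ‖stft ψ f x w‖ₑ ^ p) ^ (q / p)) ^ (1 / q)

/-- The modulation space `M^{p,q}(ℝ)`. -/
def modSpace (ψ : 𝓢(ℝ, ℂ)) (p q : ℝ) : Set 𝓢'(ℝ, ℂ) := {f | modNorm ψ p q f < ∞}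

/-- `‖c‖_{ℓ^{p,q}} = (∑_n (∑_k |c_{kn}|^p)^{q/p})^{1/q}`, with values in `[0, ∞]`. -/
def seqNorm (p q : ℝ) (c : ℤ × ℤ → ℂ) : ℝ≥0∞ :=
  (∑' n : ℤ, (∑' k : ℤ, ‖c (k, n)‖ₑ ^ p) ^ (q / p)) ^ (1 / q)

/-- The integrand `V_ψ f · conj (V_ψ h)` of the duality pairing. -/
def pairingIntegrand (ψ : 𝓢(ℝ, ℂ)) (f h : 𝓢'(ℝ, ℂ)) (z : ℝ × ℝ) : ℂ :=
  stft ψ f z.1 z.2 * conj (stft ψ h z.1 z.2)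

/-- The duality pairing between `M^{p,q}` and `M^{p',q'}` that extends the inner product of
`L²(ℝ)`: `⟨f, h⟩ = ‖ψ‖₂⁻² ∬ V_ψ f(x,w) conj (V_ψ h(x,w)) dx dw`. -/
def pairing (ψ : 𝓢(ℝ, ℂ)) (f h : 𝓢'(ℝ, ℂ)) : ℂ :=
  (∫ z : ℝ × ℝ, pairingIntegrand ψ f h z) / ((∫ t : ℝ, ‖ψ t‖ ^ 2 : ℝ) : ℂ)

/-- The series `∑ u i` of elements of `M^{p,q}` converges unconditionally to `f` in the norm of
`M^{p,q}`: the net of all finite partial sums converges to `f`. (This is `HasSum`, written for the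
`M^{p,q}`-norm.) -/
def HasUncondSum (ψ : 𝓢(ℝ, ℂ)) (p q : ℝ) {ι : Type*} (u : ι → 𝓢'(ℝ, ℂ)) (f : 𝓢'(ℝ, ℂ)) : Prop :=
  (∀ i, u i ∈ modSpace ψ p q) ∧
    Tendsto (fun s : Finset ι ↦ modNorm ψ p q (f - ∑ i ∈ s, u i)) atTop (𝓝 0)

/-- The coefficients `⟨f, e i⟩`, with the members `e i ∈ L²` read as tempered distributions. -/
def coeffs (ψ : 𝓢(ℝ, ℂ)) {ι : Type*} (e : ι → L2) (f : 𝓢'(ℝ, ℂ)) (i : ι) : ℂ :=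
  pairing ψ f (e i : 𝓢'(ℝ, ℂ))

/-- The expansion `f = ∑ ⟨f, d i⟩ e i` holds with unconditional convergence in `M^{p,q}`; all the
coefficients are given by absolutely convergent pairings. -/
def HasExpansion (ψ : 𝓢(ℝ, ℂ)) (p q : ℝ) {ι : Type*} (d e : ι → L2) (f : 𝓢'(ℝ, ℂ)) : Prop :=
  (∀ i, Integrable (pairingIntegrand ψ f (d i : 𝓢'(ℝ, ℂ)))) ∧
    HasUncondSum ψ p q (fun i ↦ coeffs ψ d f i • (e i : 𝓢'(ℝ, ℂ))) f

end GaborMod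

end

/-! Write h = gχ_[a,b]. Since h lives on an interval of length at most 1/β, Parseval on such an
interval turns the frame operator of the original system into multiplication by G(t) = β⁻¹ Σ_k |h(t
- αk)|². The translates of [a,b] by αℤ cover the line, with bounded overlap, so G lies between two
positive constants. It is also α-periodic, so division by G commutes with the shifts and the dual
atom is h/G (`IsWindow.exists_dual`). G can fail to be C¹ only at the points a + αk and b + αk, so h
and h/G are both piecewise C¹ (`exists_isPiecewiseC1_dual`).

The difficulty is the jumps of these windows. Up to a phase, the short-time transform of F(h) is
K_w(x) = ∫ h(t) conj φ(t+w) e^{-2πixt} dt with φ = F⁻¹ψ, for which the bound obtained is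
(1+|x|)⁻¹(1+|w|)⁻². In w this is integrable and the Schur test works for every q ≥ 1. In x it is
not, and the bound for c ↦ Σ_k c_k K_w(x - βk) from ℓ^p to L^p rests on cancellation, whence 1 < p <
∞. Integration by parts writes K_w through the functions ∫_c^s e^{-2πixt} dt. Each of these is a
difference of two modulated Hilbert kernels x/(x²+1) plus a quadratically decaying term, and
modulating or averaging kernels keeps the bound (`IsPiecewiseC1.exists_synBound`).

For the Hilbert kernel, M. Riesz' argument is used when p ≤ 2. The Cauchy transform of positive
masses maps the upper half plane into the right half plane, its p-th power has vanishing principal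
integral along a horizontal line, and a pointwise inequality compares the powers of the imaginary
and real parts. The range p > 2 follows by duality, once the kernel is replaced by a lattice step
function whose matrix is antisymmetric (`exists_synBound_hilbertKernel`). Analysis is the transpose
of synthesis.

Reconstruction starts from the L² duality of the two systems, tested on pairs of Schwartz atoms.
Multiplying by V_ψ f, integrating, and using the inversion formula for tempered distributions gives
the pointwise series for V_ψ f (`hasSum_coeffs_mul_stft`). The exchange of sum and integral is
absolutely convergent because p > 1. The remainder of the series is then the synthesis of a tail in
ℓ^{p,q}, which tends to zero; the same series yields the lower bound in (c). -/

noncomputable section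

namespace GaborMod

/-! ### Integral inequalities for nonnegative functions -/

section Lpn

variable {X Y : Type*} [MeasurableSpace X] [MeasurableSpace Y]

/-- The `L^p` norm of a nonnegative extended real function. -/
def lpn (p : ℝ) (μ : Measure X) (F : X → ℝ≥0∞) : ℝ≥0∞ := (∫⁻ x, F x ^ p ∂μ) ^ (1 / p)

variable {μ : Measure X} {ν : Measure Y} {p q : ℝ}

theorem lpn_rpow (hp : 0 < p) (F : X → ℝ≥0∞) : lpn p μ F ^ p = ∫⁻ x, F x ^ p ∂μ := by
  rw [lpn, ← ENNReal.rpow_mul, one_div_mul_cancel hp.ne', ENNReal.rpow_one]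

theorem lpn_le_of_rpow_le (hp : 0 < p) {F : X → ℝ≥0∞} {C : ℝ≥0∞}
    (h : ∫⁻ x, F x ^ p ∂μ ≤ C ^ p) : lpn p μ F ≤ C := by
  rw [← lpn_rpow hp] at h
  exact (ENNReal.rpow_le_rpow_iff hp).1 h

theorem lpn_mono_ae (hp : 0 ≤ p) {F G : X → ℝ≥0∞} (h : ∀ᵐ x ∂μ, F x ≤ G x) :
    lpn p μ F ≤ lpn p μ G := by
  refine ENNReal.rpow_le_rpow (lintegral_mono_ae ?_) (by positivity)
  filter_upwards [h] with x hx
  exact ENNReal.rpow_le_rpow hx hp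

theorem lpn_mono (hp : 0 ≤ p) {F G : X → ℝ≥0∞} (h : ∀ x, F x ≤ G x) : lpn p μ F ≤ lpn p μ G :=
  lpn_mono_ae hp (Eventually.of_forall h)

theorem lpn_const_mul (hp : 0 < p) {c : ℝ≥0∞} (hc : c ≠ ∞) (F : X → ℝ≥0∞) :
    lpn p μ (fun x ↦ c * F x) = c * lpn p μ F := by
  simp only [lpn, ENNReal.mul_rpow_of_nonneg _ _ hp.le]
  rw [lintegral_const_mul' _ _ (ENNReal.rpow_ne_top_of_nonneg hp.le hc),
    ENNReal.mul_rpow_of_nonneg _ _ (by positivity), ← ENNReal.rpow_mul,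
    mul_one_div_cancel hp.ne', ENNReal.rpow_one]

theorem lpn_add_le (hp : 1 ≤ p) {F G : X → ℝ≥0∞} (hF : AEMeasurable F μ) (hG : AEMeasurable G μ) :
    lpn p μ (fun x ↦ F x + G x) ≤ lpn p μ F + lpn p μ G :=
  ENNReal.lintegral_Lp_add_le hF hG hp

/-- Jensen's inequality with a weight of arbitrary mass. -/
theorem lintegral_mul_rpow_le (hq : 1 ≤ q) {k u : X → ℝ≥0∞} (hk : AEMeasurable k μ)
    (hu : AEMeasurable u μ) :
    (∫⁻ x, k x * u x ∂μ) ^ q ≤ (∫⁻ x, k x ∂μ) ^ (q - 1) * ∫⁻ x, k x * u x ^ q ∂μ := by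
  rcases hq.eq_or_lt with rfl | hq
  · simp
  have hq0 : 0 < q := by linarith
  set q' := q.conjExponent with hq'
  have hc : q'.HolderConjugate q := (Real.HolderConjugate.conjExponent hq).symm
  -- Hölder for the splitting k u = k^{1/q'} · (k^{1/q} u), so that the weight enters each factor
  -- linearly.
  have key := ENNReal.lintegral_mul_le_Lp_mul_Lq μ hc (f := fun x ↦ k x ^ (1 / q'))
    (g := fun x ↦ k x ^ (1 / q) * u x) (hk.pow_const _) ((hk.pow_const _).mul hu)
  have h1 : ∀ x, ((fun x ↦ k x ^ (1 / q')) * fun x ↦ k x ^ (1 / q) * u x) x = k x * u x := by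
    intro x
    simp only [Pi.mul_apply]
    rw [← mul_assoc, ← ENNReal.rpow_add_of_nonneg _ _ hc.one_div_nonneg (by positivity)]
    have : 1 / q' + 1 / q = 1 := by simpa using hc.inv_add_inv_eq_one
    rw [this, ENNReal.rpow_one]
  have h2 : ∀ x, (k x ^ (1 / q')) ^ q' = k x := by
    intro x
    rw [← ENNReal.rpow_mul, one_div_mul_cancel hc.ne_zero, ENNReal.rpow_one]
  have h3 : ∀ x, (k x ^ (1 / q) * u x) ^ q = k x * u x ^ q := by
    intro x
    rw [ENNReal.mul_rpow_of_nonneg _ _ hq0.le, ← ENNReal.rpow_mul, one_div_mul_cancel hq0.ne',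
      ENNReal.rpow_one]
  simp only [h1, h2, h3] at key
  calc (∫⁻ x, k x * u x ∂μ) ^ q
      ≤ ((∫⁻ x, k x ∂μ) ^ (1 / q') * (∫⁻ x, k x * u x ^ q ∂μ) ^ (1 / q)) ^ q :=
        ENNReal.rpow_le_rpow key hq0.le
    _ = _ := by
        rw [ENNReal.mul_rpow_of_nonneg _ _ hq0.le, ← ENNReal.rpow_mul, ← ENNReal.rpow_mul,
          one_div_mul_cancel hq0.ne', ENNReal.rpow_one]
        congr 2
        rw [hq', Real.conjExponent]
        field_simp

/-- The Schur test. -/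
theorem lpn_lintegral_mul_le [SFinite μ] [SFinite ν] (hq : 1 ≤ q) {k : X → Y → ℝ≥0∞}
    {u : Y → ℝ≥0∞} (hk : Measurable (Function.uncurry k)) (hu : Measurable u) {C : ℝ≥0∞}
    (h1 : ∀ x, ∫⁻ y, k x y ∂ν ≤ C) (h2 : ∀ y, ∫⁻ x, k x y ∂μ ≤ C) :
    lpn q μ (fun x ↦ ∫⁻ y, k x y * u y ∂ν) ≤ C * lpn q ν u := by
  have hq0 : 0 < q := by linarith
  refine lpn_le_of_rpow_le hq0 ?_
  have hkx : ∀ x, Measurable (k x) := fun x ↦ hk.of_uncurry_left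
  have hky : ∀ y, Measurable (fun x ↦ k x y) := fun y ↦ hk.of_uncurry_right
  calc ∫⁻ x, (∫⁻ y, k x y * u y ∂ν) ^ q ∂μ
      ≤ ∫⁻ x, C ^ (q - 1) * ∫⁻ y, k x y * u y ^ q ∂ν ∂μ := by
        refine lintegral_mono fun x ↦ ?_
        refine (lintegral_mul_rpow_le hq (hkx x).aemeasurable hu.aemeasurable).trans ?_
        gcongr
        exact h1 x
    _ = C ^ (q - 1) * ∫⁻ x, ∫⁻ y, k x y * u y ^ q ∂ν ∂μ := by
        rw [lintegral_const_mul]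
        exact (hk.mul ((hu.pow_const q).comp measurable_snd)).lintegral_prod_right'
    _ = C ^ (q - 1) * ∫⁻ y, ∫⁻ x, k x y * u y ^ q ∂μ ∂ν := by
        rw [lintegral_lintegral_swap]
        exact (hk.mul ((hu.pow_const q).comp measurable_snd)).aemeasurable
    _ ≤ C ^ (q - 1) * ∫⁻ y, C * u y ^ q ∂ν := by
        gcongr with y
        rw [lintegral_mul_const _ (hky y)]
        gcongr
        exact h2 y
    _ = C ^ q * ∫⁻ y, u y ^ q ∂ν := by
        rw [lintegral_const_mul _ (hu.pow_const q), ← mul_assoc]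
        congr 1
        nth_rewrite 2 [← ENNReal.rpow_one C]
        rw [← ENNReal.rpow_add_of_nonneg _ _ (by linarith) zero_le_one]
        simp
    _ = (C * lpn q ν u) ^ q := by
        rw [ENNReal.mul_rpow_of_nonneg _ _ hq0.le, lpn_rpow hq0]

/-- Minkowski's integral inequality. -/
theorem lpn_lintegral_le [SFinite μ] [SFinite ν] (hp : 1 ≤ p) {A : X → Y → ℝ≥0∞}
    (hA : Measurable (Function.uncurry A)) :
    lpn p μ (fun x ↦ ∫⁻ y, A x y ∂ν) ≤ ∫⁻ y, lpn p μ (fun x ↦ A x y) ∂ν := by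
  have hp0 : 0 < p := by linarith
  set B : Y → ℝ≥0∞ := fun y ↦ lpn p μ (fun x ↦ A x y) with hB
  have hBm : Measurable B :=
    ((hA.pow_const p).lintegral_prod_left').pow_const _
  by_cases htop : ∫⁻ y, B y ∂ν = ∞
  · rw [htop]; exact le_top
  have hAx : ∀ x, Measurable (A x) := fun x ↦ hA.of_uncurry_left
  have hAy : ∀ y, Measurable (fun x ↦ A x y) := fun y ↦ hA.of_uncurry_right
  have hBfin : ∀ᵐ y ∂ν, B y < ∞ := ae_lt_top hBm htop
  -- Where the slice norm `B y` vanishes, so does `A x y` for almost every x. Dividing by `B`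
  -- therefore loses nothing.
  have hzero : ∀ᵐ x ∂μ, ∀ᵐ y ∂ν, B y = 0 → A x y = 0 := by
    rw [Measure.ae_ae_comm]
    · refine Eventually.of_forall fun y ↦ ?_
      by_cases hy : B y = 0
      · have h0 : ∫⁻ x, A x y ^ p ∂μ = 0 := by
          rw [← lpn_rpow hp0]
          change B y ^ p = 0
          rw [hy, ENNReal.zero_rpow_of_pos hp0]
        rw [lintegral_eq_zero_iff ((hAy y).pow_const p)] at h0
        filter_upwards [h0] with x hx _
        simpa [hp0, hp0.not_gt] using hx
      · exact Eventually.of_forall fun x h ↦ absurd h hy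
    · have : {x : X × Y | B x.2 = 0 → A x.1 x.2 = 0} =
          {x : X × Y | B x.2 = 0}ᶜ ∪ {x : X × Y | Function.uncurry A x = 0} := by
        ext z; simp [imp_iff_not_or, Function.uncurry]
      rw [this]
      exact ((hBm.comp measurable_snd) (measurableSet_singleton 0)).compl.union
        (hA (measurableSet_singleton 0))
  refine lpn_le_of_rpow_le hp0 ?_
  -- The inequality is Jensen's with weight `B` applied to `A / B`: after exchanging the integrals,
  -- each normalised slice has norm at most one.
  have hdiv : Measurable (Function.uncurry fun x y ↦ A x y / B y) :=
    hA.div (hBm.comp measurable_snd)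
  calc ∫⁻ x, (∫⁻ y, A x y ∂ν) ^ p ∂μ
      ≤ ∫⁻ x, (∫⁻ y, B y ∂ν) ^ (p - 1) * ∫⁻ y, B y * (A x y / B y) ^ p ∂ν ∂μ := by
        refine lintegral_mono_ae ?_
        filter_upwards [hzero] with x hx
        have : ∫⁻ y, A x y ∂ν = ∫⁻ y, B y * (A x y / B y) ∂ν := by
          refine lintegral_congr_ae ?_
          filter_upwards [hx, hBfin] with y hy hy'
          by_cases h0 : B y = 0
          · rw [hy h0, h0]; simp
          · rw [ENNReal.mul_div_cancel h0 hy'.ne]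
        rw [this]
        exact lintegral_mul_rpow_le hp hBm.aemeasurable ((hAx x).div hBm).aemeasurable
    _ = (∫⁻ y, B y ∂ν) ^ (p - 1) * ∫⁻ y, ∫⁻ x, B y * (A x y / B y) ^ p ∂μ ∂ν := by
        have hm : Measurable (Function.uncurry fun x y ↦ B y * (A x y / B y) ^ p) :=
          (hBm.comp measurable_snd).mul (hdiv.pow_const p)
        rw [lintegral_const_mul _ (by exact hm.lintegral_prod_right'),
          lintegral_lintegral_swap hm.aemeasurable]
    _ ≤ (∫⁻ y, B y ∂ν) ^ (p - 1) * ∫⁻ y, B y ∂ν := by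
        gcongr with y
        have h1 : ∀ x, B y * (A x y / B y) ^ p = (B y * ((B y)⁻¹) ^ p) * A x y ^ p := by
          intro x
          rw [div_eq_mul_inv, ENNReal.mul_rpow_of_nonneg _ _ hp0.le]
          ring
        simp only [h1]
        rw [lintegral_const_mul _ ((hAy y).pow_const p), ← lpn_rpow hp0]
        change B y * (B y)⁻¹ ^ p * B y ^ p ≤ B y
        rw [mul_assoc, ← ENNReal.mul_rpow_of_nonneg _ _ hp0.le]
        calc B y * ((B y)⁻¹ * B y) ^ p ≤ B y * 1 ^ p := by
              gcongr
              exact ENNReal.inv_mul_le_one (B y)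
          _ = B y := by simp
    _ = (∫⁻ y, B y ∂ν) ^ p := by
        nth_rewrite 2 [← ENNReal.rpow_one (∫⁻ y, B y ∂ν)]
        rw [← ENNReal.rpow_add_of_nonneg _ _ (by linarith) zero_le_one]
        simp

theorem lintegral_mul_le_lpn_mul_lpn (hpq : p.HolderConjugate q) {F G : X → ℝ≥0∞}
    (hF : AEMeasurable F μ) (hG : AEMeasurable G μ) :
    ∫⁻ x, F x * G x ∂μ ≤ lpn p μ F * lpn q μ G :=
  ENNReal.lintegral_mul_le_Lp_mul_Lq μ hpq hF hG

end Lpn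

/-! ### Polynomially decaying weights -/

/-- The weight `(1 + |x|)^{-r}`. -/
def rho (r x : ℝ) : ℝ := (1 + |x|) ^ (-r)

theorem rho_pos (r x : ℝ) : 0 < rho r x := Real.rpow_pos_of_pos (by positivity) _

theorem rho_neg (r x : ℝ) : rho r (-x) = rho r x := by simp [rho]

theorem continuous_rho (r : ℝ) : Continuous (rho r) := by
  unfold rho
  refine Continuous.rpow_const (by fun_prop) fun x ↦ Or.inl ?_
  positivity

theorem rho_le_one {r : ℝ} (hr : 0 ≤ r) (x : ℝ) : rho r x ≤ 1 :=
  Real.rpow_le_one_of_one_le_of_nonpos (by linarith [abs_nonneg x]) (by linarith)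

theorem rho_rpow (r s x : ℝ) : rho r x ^ s = rho (r * s) x := by
  rw [rho, ← Real.rpow_mul (by positivity), rho]
  congr 1; ring

theorem rho_mul (r s x : ℝ) : rho r x * rho s x = rho (r + s) x := by
  rw [rho, rho, rho, ← Real.rpow_add (by positivity)]
  congr 1; ring

theorem rho_one (x : ℝ) : rho 1 x = (1 + |x|)⁻¹ := by
  rw [rho, Real.rpow_neg_one]

theorem rho_two (x : ℝ) : rho 2 x = ((1 + |x|) ^ 2)⁻¹ := by
  rw [rho, Real.rpow_neg (by positivity)]
  norm_num

theorem integrable_rho {r : ℝ} (hr : 1 < r) : Integrable (rho r) := by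
  have := integrable_one_add_norm (E := ℝ) (μ := volume) (r := r) (by simpa using hr)
  exact this

theorem lintegral_rho_lt_top {r : ℝ} (hr : 1 < r) : ∫⁻ x, ENNReal.ofReal (rho r x) < ∞ := by
  have := (integrable_rho hr).lintegral_lt_top
  exact this

/-- `(1+|x+y|)^{-r} ≤ (1+|y|)^r (1+|x|)^{-r}`. -/
theorem rho_add_le {r : ℝ} (hr : 0 ≤ r) (x y : ℝ) :
    rho r (x + y) ≤ (1 + |y|) ^ r * rho r x := by
  unfold rho
  have h : 1 + |x| ≤ (1 + |y|) * (1 + |x + y|) := by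
    have h1 : |x| ≤ |x + y| + |y| := by
      have := abs_sub (x + y) y
      simpa using this
    nlinarith [abs_nonneg y, abs_nonneg (x + y)]
  rw [Real.rpow_neg (by positivity), Real.rpow_neg (by positivity), ← div_eq_mul_inv,
    inv_le_comm₀ (by positivity) (by positivity), inv_div, div_le_iff₀ (by positivity),
    mul_comm, ← Real.mul_rpow (by positivity) (by positivity)]
  exact Real.rpow_le_rpow (by positivity) h hr

theorem summable_rho_int {r : ℝ} (hr : 1 < r) : Summable (fun k : ℤ ↦ rho r k) := by
  refine Summable.of_norm_bounded_eventually (Real.summable_abs_int_rpow hr) ?_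
  have : ({0}ᶜ : Set ℤ) ∈ (cofinite : Filter ℤ) := (Set.finite_singleton 0).compl_mem_cofinite
  filter_upwards [this] with k hk
  have hk' : (k : ℝ) ≠ 0 := by simpa using hk
  rw [Real.norm_of_nonneg (rho_pos _ _).le]
  exact Real.rpow_le_rpow_of_nonpos (abs_pos.2 hk') (by linarith) (by linarith)

/-- The sum of a decaying weight over a shifted lattice is uniformly bounded. -/
theorem exists_tsum_rho_le {r β : ℝ} (hr : 1 < r) (hβ : 0 < β) :
    ∃ C : ℝ≥0∞, C ≠ ∞ ∧ ∀ x : ℝ, ∑' k : ℤ, ENNReal.ofReal (rho r (x - β * k)) ≤ C := by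
  -- With m the floor of x/β, the integer m - k differs from (x - βk)/β by at most one. Hence 1 + |m
  -- - k| ≤ D (1 + |x - βk|), and the shifted sum is compared with the sum over ℤ.
  set D : ℝ := 2 + β⁻¹
  have hβ' : 0 < β⁻¹ := by positivity
  refine ⟨ENNReal.ofReal (D ^ r) * ∑' k : ℤ, ENNReal.ofReal (rho r k), ?_, fun x ↦ ?_⟩
  · exact ENNReal.mul_ne_top ENNReal.ofReal_ne_top (summable_rho_int hr).tsum_ofReal_ne_top
  · set m : ℤ := ⌊x / β⌋
    have hb : ∀ k : ℤ, ENNReal.ofReal (rho r (x - β * k)) ≤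
        ENNReal.ofReal (D ^ r) * ENNReal.ofReal (rho r ((m - k : ℤ) : ℝ)) := by
      intro k
      rw [← ENNReal.ofReal_mul (by positivity)]
      refine ENNReal.ofReal_le_ofReal ?_
      unfold rho
      have h1 : 1 + |((m - k : ℤ) : ℝ)| ≤ D * (1 + |x - β * k|) := by
        have e1 : ((m - k : ℤ) : ℝ) = (m - x / β) + β⁻¹ * (x - β * k) := by
          push_cast; field_simp; ring
        have e2 : |(m : ℝ) - x / β| ≤ 1 := by
          rw [abs_le]
          constructor
          · linarith [Int.lt_floor_add_one (x / β)]
          · linarith [Int.floor_le (x / β)]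
        have e3 := abs_add_le ((m : ℝ) - x / β) (β⁻¹ * (x - β * k))
        rw [← e1, abs_mul, abs_of_pos hβ'] at e3
        have : D * (1 + |x - β * k|) = 2 + 2 * |x - β * k| + β⁻¹ + β⁻¹ * |x - β * k| := by
          simp only [D]; ring
        rw [this]
        linarith [abs_nonneg (x - β * k)]
      rw [Real.rpow_neg (by positivity), Real.rpow_neg (by positivity), ← div_eq_mul_inv,
        inv_le_comm₀ (by positivity) (by positivity), inv_div, div_le_iff₀ (by positivity),
        mul_comm, ← Real.mul_rpow (by positivity) (by positivity)]
      exact Real.rpow_le_rpow (by positivity) h1 (by linarith)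
    calc ∑' k : ℤ, ENNReal.ofReal (rho r (x - β * k))
        ≤ ∑' k : ℤ, ENNReal.ofReal (D ^ r) * ENNReal.ofReal (rho r ((m - k : ℤ) : ℝ)) :=
          ENNReal.tsum_le_tsum hb
      _ = ENNReal.ofReal (D ^ r) * ∑' k : ℤ, ENNReal.ofReal (rho r ((m - k : ℤ) : ℝ)) :=
          ENNReal.tsum_mul_left
      _ = _ := by
          congr 1
          exact (Equiv.subLeft m).tsum_eq (fun k : ℤ ↦ ENNReal.ofReal (rho r (k : ℝ)))

end GaborMod
end

noncomputable section

namespace GaborMod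

/-! ### The Hilbert kernel on mixed discrete and continuous `L^p` spaces -/

/-- The pointwise inequality in M. Riesz' proof of the boundedness of the conjugate function. -/
theorem exists_abs_im_rpow_le {p : ℝ} (hp : 1 < p) (hp2 : p ≤ 2) :
    ∃ A B : ℝ, 0 ≤ A ∧ 0 ≤ B ∧ ∀ z : ℂ, 0 ≤ z.re →
      |z.im| ^ p ≤ A * z.re ^ p - B * (z ^ (p : ℂ)).re := by
  have hpi := Real.pi_pos
  have hp0 : 0 < p := by linarith
  -- The angle t satisfies t < π/2 < pt < π: cos is positive on [0, t], while cos(p·) is negative on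
  -- [t, π/2]. There p|θ| stays below π because p ≤ 2.
  set t : ℝ := Real.pi * (1 + p) / (4 * p) with ht
  have hpt : p * t = Real.pi * (1 + p) / 4 := by rw [ht]; field_simp
  have ht0 : 0 < t := by positivity
  have ht2 : t < Real.pi / 2 := by
    rw [ht, div_lt_iff₀ (by positivity)]; nlinarith
  have hcos : 0 < Real.cos t := Real.cos_pos_of_mem_Ioo ⟨by linarith, ht2⟩
  have hneg : Real.cos (p * t) < 0 := by
    refine Real.cos_neg_of_pi_div_two_lt_of_lt ?_ ?_ <;> rw [hpt] <;> nlinarith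
  -- `B` makes -B cos(p|θ|) ≥ 1 for |θ| ≥ t. `A` makes A cos^p|θ| ≥ 1 + B for |θ| ≤ t, which pays
  -- for the possibly positive B cos(p|θ|).
  set B : ℝ := (-Real.cos (p * t))⁻¹ with hB
  have hBpos : 0 < B := inv_pos.2 (by linarith)
  set A : ℝ := (1 + B) / Real.cos t ^ p with hA
  have hApos : 0 < A := by positivity
  refine ⟨A, B, hApos.le, hBpos.le, fun z hz ↦ ?_⟩
  by_cases hz0 : z = 0
  · subst hz0
    have : (p : ℂ) ≠ 0 := by exact_mod_cast hp0.ne'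
    simp [Real.zero_rpow hp0.ne', Complex.zero_cpow this]
  have hn : 0 < ‖z‖ := norm_pos_iff.2 hz0
  set θ := Complex.arg z with hθ
  have hθ2 : |θ| ≤ Real.pi / 2 := Complex.abs_arg_le_pi_div_two_iff.2 hz
  have hre : z.re = ‖z‖ * Real.cos |θ| := by rw [Real.cos_abs, Complex.norm_mul_cos_arg]
  have him : |z.im| = ‖z‖ * |Real.sin θ| := by
    rw [← Complex.norm_mul_sin_arg z, abs_mul, abs_of_pos hn]
  have hcosθ : 0 ≤ Real.cos |θ| :=
    Real.cos_nonneg_of_mem_Icc ⟨by linarith [abs_nonneg θ], hθ2⟩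
  have hpow : (z ^ (p : ℂ)).re = ‖z‖ ^ p * Real.cos (p * |θ|) := by
    rw [Complex.cpow_ofReal_re, ← Real.cos_abs (_ * p), abs_mul, abs_of_pos hp0, mul_comm p]
  rw [hpow, him, hre, Real.mul_rpow hn.le (abs_nonneg _), Real.mul_rpow hn.le hcosθ]
  have hsin : |Real.sin θ| ^ p ≤ 1 :=
    Real.rpow_le_one (abs_nonneg _) (Real.abs_sin_le_one _) hp0.le
  have key : |Real.sin θ| ^ p ≤ A * Real.cos |θ| ^ p - B * Real.cos (p * |θ|) := by
    rcases le_total |θ| t with h | h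
    · have h1 : Real.cos t ≤ Real.cos |θ| :=
        Real.cos_le_cos_of_nonneg_of_le_pi (abs_nonneg _) (by linarith) h
      have h2 : 1 + B ≤ A * Real.cos |θ| ^ p := by
        calc 1 + B = A * Real.cos t ^ p := by rw [hA]; field_simp
          _ ≤ _ := by gcongr
      nlinarith [Real.cos_le_one (p * |θ|)]
    · have h1 : Real.cos (p * |θ|) ≤ Real.cos (p * t) := by
        refine Real.cos_le_cos_of_nonneg_of_le_pi (by positivity) ?_ (by gcongr)
        nlinarith [abs_nonneg θ]
      have h2 : B * Real.cos (p * t) = -1 := by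
        rw [hB, inv_neg, neg_mul, inv_mul_cancel₀ hneg.ne]
      have h3 : 0 ≤ A * Real.cos |θ| ^ p := by positivity
      nlinarith
  nlinarith [Real.rpow_pos_of_pos hn p]

/-- A function holomorphic in the upper half plane that is small on three sides of a large square
has a small integral over the fourth side. -/
theorem norm_integral_horizontal_le {Φ : ℂ → ℂ} (hΦ : DifferentiableOn ℂ Φ {z | 0 < z.im})
    {R ε : ℝ} (hR : 0 < R) (h : ∀ z : ℂ, 1 ≤ z.im → (R ≤ |z.re| ∨ R ≤ z.im) → ‖Φ z‖ ≤ ε) :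
    ‖∫ x in (-R)..R, Φ (x + Complex.I)‖ ≤ 4 * R * ε := by
  have H := Complex.integral_boundary_rect_eq_zero_of_differentiableOn Φ
    (⟨-R, 1⟩ : ℂ) (⟨R, 1 + R⟩ : ℂ) (hΦ.mono (by
      intro z hz
      have := hz.2
      simp only [mem_preimage] at this
      rw [uIcc_of_le (by linarith)] at this
      exact lt_of_lt_of_le one_pos this.1))
  simp only at H
  have e0 : ∀ x : ℝ, (x : ℂ) + ((1 : ℝ) : ℂ) * Complex.I = x + Complex.I := by intro x; simp
  simp only [e0] at H
  have top : ‖∫ x in (-R)..R, Φ (x + ((1 + R : ℝ) : ℂ) * Complex.I)‖ ≤ ε * |R - -R| := by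
    refine intervalIntegral.norm_integral_le_of_norm_le_const fun x _ ↦ h _ ?_ (Or.inr ?_)
    · simp; linarith
    · simp
  have right : ‖∫ y in (1 : ℝ)..(1 + R), Φ ((R : ℂ) + y * Complex.I)‖ ≤ ε * |1 + R - 1| := by
    refine intervalIntegral.norm_integral_le_of_norm_le_const fun y hy ↦ h _ ?_ (Or.inl ?_)
    · rw [uIoc_of_le (by linarith)] at hy
      simpa using hy.1.le
    · simpa using le_abs_self R
  have left : ‖∫ y in (1 : ℝ)..(1 + R), Φ (((-R : ℝ) : ℂ) + y * Complex.I)‖ ≤ ε * |1 + R - 1| := by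
    refine intervalIntegral.norm_integral_le_of_norm_le_const fun y hy ↦ h _ ?_ (Or.inl ?_)
    · rw [uIoc_of_le (by linarith)] at hy
      simpa using hy.1.le
    · simpa using le_abs_self R
  have a1 : |R - -R| = 2 * R := by rw [sub_neg_eq_add, abs_of_pos (by linarith)]; ring
  have a2 : |1 + R - 1| = R := by rw [add_sub_cancel_left, abs_of_pos hR]
  rw [a1] at top
  rw [a2] at right left
  set I0 := ∫ x in (-R)..R, Φ (x + Complex.I)
  set I1 := ∫ x in (-R)..R, Φ (x + ((1 + R : ℝ) : ℂ) * Complex.I)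
  set I2 := ∫ y in (1 : ℝ)..(1 + R), Φ ((R : ℂ) + y * Complex.I)
  set I3 := ∫ y in (1 : ℝ)..(1 + R), Φ (((-R : ℝ) : ℂ) + y * Complex.I)
  have hI : I0 = I1 - Complex.I • I2 + Complex.I • I3 := by linear_combination H
  rw [hI]
  calc _ ≤ ‖I1‖ + ‖Complex.I • I2‖ + ‖Complex.I • I3‖ :=
        (norm_add_le _ _).trans (by gcongr; exact norm_sub_le _ _)
    _ ≤ ε * (2 * R) + ε * R + ε * R := by
        simp only [norm_smul, Complex.norm_I, one_mul]
        gcongr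
    _ = _ := by ring

/-- The Cauchy transform of a finite combination of point masses on the lattice `βℤ`. -/
def cauchySum (β : ℝ) (s : Finset ℤ) (c : ℤ → ℝ) (z : ℂ) : ℂ :=
  ∑ k ∈ s, (c k : ℂ) * (Complex.I / (z - β * k))

theorem I_div_re_im (z : ℂ) (k : ℝ) :
    (Complex.I / (z - k)).re = z.im / ((z.re - k) ^ 2 + z.im ^ 2) ∧
    (Complex.I / (z - k)).im = (z.re - k) / ((z.re - k) ^ 2 + z.im ^ 2) := by
  constructor <;> simp [Complex.div_re, Complex.div_im, Complex.normSq_apply, pow_two]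

/-- The real part is a Poisson sum and the imaginary part its conjugate. On the line of height one
they are the syntheses with kernels 1/(x²+1) and x/(x²+1). -/
theorem cauchySum_re (β : ℝ) (s : Finset ℤ) (c : ℤ → ℝ) (z : ℂ) :
    (cauchySum β s c z).re = ∑ k ∈ s, c k * (z.im / ((z.re - β * k) ^ 2 + z.im ^ 2)) := by
  simp only [cauchySum, Complex.re_sum, Complex.re_ofReal_mul]
  refine Finset.sum_congr rfl fun k _ ↦ ?_
  have := (I_div_re_im z (β * k)).1
  push_cast at this
  rw [this]

theorem cauchySum_im (β : ℝ) (s : Finset ℤ) (c : ℤ → ℝ) (z : ℂ) :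
    (cauchySum β s c z).im = ∑ k ∈ s, c k * ((z.re - β * k) / ((z.re - β * k) ^ 2 + z.im ^ 2)) := by
  simp only [cauchySum, Complex.im_sum, Complex.im_ofReal_mul]
  refine Finset.sum_congr rfl fun k _ ↦ ?_
  have := (I_div_re_im z (β * k)).2
  push_cast at this
  rw [this]

theorem differentiableOn_cauchySum (β : ℝ) (s : Finset ℤ) (c : ℤ → ℝ) :
    DifferentiableOn ℂ (cauchySum β s c) {z | 0 < z.im} := by
  unfold cauchySum
  refine DifferentiableOn.fun_sum fun k _ ↦ ?_
  refine DifferentiableOn.const_mul ?_ _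
  refine DifferentiableOn.div (by fun_prop) (by fun_prop) fun z hz h ↦ ?_
  have : z.im = 0 := by
    have := congrArg Complex.im h
    simpa using this
  simp only [mem_ofPred_eq] at hz
  linarith

/-- Positive masses keep the Cauchy transform in the open right half plane, where the p-th power is
holomorphic. On the other three sides of a square of side comparable to R the transform is O(1/R),
so the contour theorem leaves O(R^{1-p}), and p > 1 makes this vanish. -/
theorem tendsto_integral_cauchySum_cpow {β p : ℝ} (hp : 1 < p) (s : Finset ℤ) {c : ℤ → ℝ}
    (hc : ∀ k ∈ s, 0 ≤ c k) (hne : ∃ k ∈ s, 0 < c k) :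
    Tendsto (fun R : ℝ ↦ ∫ x in (-R)..R, cauchySum β s c (x + Complex.I) ^ (p : ℂ)) atTop (𝓝 0) := by
  set S := ∑ k ∈ s, c k
  set L := ∑ k ∈ s, |β * k|
  have hS : 0 ≤ S := Finset.sum_nonneg hc
  have hL : 0 ≤ L := Finset.sum_nonneg fun _ _ ↦ abs_nonneg _
  have hre : ∀ z : ℂ, 0 < z.im → 0 < (cauchySum β s c z).re := by
    intro z hz
    rw [cauchySum_re]
    refine Finset.sum_pos' (fun k hk ↦ mul_nonneg (hc k hk) (by positivity)) ?_
    obtain ⟨k, hk, hk'⟩ := hne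
    exact ⟨k, hk, by positivity⟩
  have hd : DifferentiableOn ℂ (fun z ↦ cauchySum β s c z ^ (p : ℂ)) {z | 0 < z.im} := by
    refine (differentiableOn_cauchySum β s c).cpow_const fun z hz ↦ ?_
    exact Or.inl (hre z hz)
  -- Since every pole βk has modulus at most L ≤ R/2, points of the far sides stay at distance at
  -- least R/2 from it.
  have hbound : ∀ R : ℝ, 2 * L ≤ R → 0 < R → ∀ z : ℂ, 1 ≤ z.im → (R ≤ |z.re| ∨ R ≤ z.im) →
      ‖cauchySum β s c z ^ (p : ℂ)‖ ≤ (2 * S / R) ^ p := by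
    intro R hR hR0 z hz h
    have hF : ‖cauchySum β s c z‖ ≤ 2 * S / R := by
      unfold cauchySum
      calc _ ≤ ∑ k ∈ s, ‖(c k : ℂ) * (Complex.I / (z - β * k))‖ := norm_sum_le _ _
        _ ≤ ∑ k ∈ s, c k * (2 / R) := by
            refine Finset.sum_le_sum fun k hk ↦ ?_
            have hkL : |β * k| ≤ L :=
              Finset.single_le_sum (f := fun k : ℤ ↦ |β * (k : ℝ)|) (fun _ _ ↦ abs_nonneg _) hk
            have hz' : R / 2 ≤ ‖z - β * k‖ := by
              rcases h with h | h
              · refine le_trans ?_ (Complex.abs_re_le_norm _)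
                have e : (z - (β : ℂ) * k).re = z.re - β * k := by simp
                rw [e]
                have := abs_sub_abs_le_abs_sub z.re (β * k)
                linarith
              · refine le_trans ?_ (Complex.abs_im_le_norm _)
                have e : (z - (β : ℂ) * k).im = z.im := by simp
                rw [e]
                linarith [le_abs_self z.im]
            rw [norm_mul, norm_div, Complex.norm_I, Complex.norm_real,
              Real.norm_of_nonneg (hc k hk)]
            refine mul_le_mul_of_nonneg_left ?_ (hc k hk)
            calc 1 / ‖z - β * k‖ ≤ 1 / (R / 2) := by gcongr
              _ = 2 / R := by field_simp
        _ = 2 * S / R := by rw [← Finset.sum_mul]; ring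
    rw [Complex.norm_cpow_real]
    exact Real.rpow_le_rpow (norm_nonneg _) hF (by linarith)
  refine squeeze_zero_norm' (a := fun R : ℝ ↦ 4 * (2 * S) ^ p * R ^ (-(p - 1))) ?_ ?_
  · filter_upwards [eventually_ge_atTop (2 * L), eventually_gt_atTop 0] with R hR hR0
    refine (norm_integral_horizontal_le hd hR0 (hbound R hR hR0)).trans (le_of_eq ?_)
    rw [Real.div_rpow (by positivity) hR0.le, neg_sub, Real.rpow_sub hR0, Real.rpow_one]
    ring
  · have := (tendsto_rpow_neg_atTop (y := p - 1) (by linarith)).const_mul (4 * (2 * S) ^ p)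
    simpa using this

/-- Riesz' pointwise inequality is integrated over the line of height one. The term with Re F^p
disappears in the limit of symmetric intervals, leaving the conjugate function dominated by the
Poisson sum. -/
theorem lintegral_conj_cauchySum_le {β p A B : ℝ} (hp : 1 < p) (hA : 0 ≤ A) (hB : 0 ≤ B)
    (hAB : ∀ z : ℂ, 0 ≤ z.re → |z.im| ^ p ≤ A * z.re ^ p - B * (z ^ (p : ℂ)).re)
    (s : Finset ℤ) {c : ℤ → ℝ} (hc : ∀ k ∈ s, 0 ≤ c k) :
    ∫⁻ x : ℝ, ENNReal.ofReal |∑ k ∈ s, c k * ((x - β * k) / ((x - β * k) ^ 2 + 1))| ^ p ≤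
      ENNReal.ofReal A *
        ∫⁻ x : ℝ, ENNReal.ofReal (∑ k ∈ s, c k * (1 / ((x - β * k) ^ 2 + 1))) ^ p := by
  have hp0 : 0 < p := by linarith
  -- If all masses vanish the transform is identically zero, on the boundary of the right half
  -- plane, and the contour argument does not apply; the claim is then trivial.
  by_cases hne : ∃ k ∈ s, 0 < c k
  swap
  · have h0 : ∀ k ∈ s, c k = 0 := fun k hk ↦
      le_antisymm (not_lt.1 fun h ↦ hne ⟨k, hk, h⟩) (hc k hk)
    have : ∀ x : ℝ, ∑ k ∈ s, c k * ((x - β * k) / ((x - β * k) ^ 2 + 1)) = 0 := fun x ↦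
      Finset.sum_eq_zero fun k hk ↦ by rw [h0 k hk, zero_mul]
    simp [this, hp0]
  set F : ℝ → ℂ := fun x ↦ cauchySum β s c (x + Complex.I) with hF
  have hFre : ∀ x, (F x).re = ∑ k ∈ s, c k * (1 / ((x - β * k) ^ 2 + 1)) := by
    intro x; simp [hF, cauchySum_re]
  have hFim : ∀ x, (F x).im = ∑ k ∈ s, c k * ((x - β * k) / ((x - β * k) ^ 2 + 1)) := by
    intro x; simp [hF, cauchySum_im]
  have hpos : ∀ x, 0 < (F x).re := by
    intro x
    rw [hFre]
    refine Finset.sum_pos' (fun k hk ↦ mul_nonneg (hc k hk) (by positivity)) ?_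
    obtain ⟨k, hk, hk'⟩ := hne
    exact ⟨k, hk, by positivity⟩
  have hFc : Continuous F := by
    refine (differentiableOn_cauchySum β s c).continuousOn.comp_continuous (by fun_prop) ?_
    intro x; simp
  have hFp : Continuous fun x ↦ F x ^ (p : ℂ) :=
    hFc.cpow continuous_const fun x ↦ Or.inl (hpos x)
  have hrep : Continuous fun x ↦ (F x).re ^ p :=
    (Complex.continuous_re.comp hFc).rpow_const fun x ↦ Or.inr hp0.le
  have himp : Continuous fun x ↦ |(F x).im| ^ p :=
    (Complex.continuous_im.comp hFc).abs.rpow_const fun x ↦ Or.inr hp0.le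
  simp only [← hFre, ← hFim]
  have hlim := tendsto_integral_cauchySum_cpow (β := β) hp s hc hne
  have hfin : ∀ R : ℝ, 0 < R → ∫⁻ x in Ioc (-R) R, ENNReal.ofReal |(F x).im| ^ p ≤
      ENNReal.ofReal A * (∫⁻ x, ENNReal.ofReal (F x).re ^ p) +
        ENNReal.ofReal (B * ‖∫ x in (-R)..R, F x ^ (p : ℂ)‖) := by
    intro R hR
    have e1 : ∫⁻ x in Ioc (-R) R, ENNReal.ofReal |(F x).im| ^ p =
        ENNReal.ofReal (∫ x in (-R)..R, |(F x).im| ^ p) := by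
      rw [intervalIntegral.integral_of_le (by linarith),
        ofReal_integral_eq_lintegral_ofReal
          (himp.intervalIntegrable (-R) R).1 (Eventually.of_forall fun x ↦ by positivity)]
      simp_rw [ENNReal.ofReal_rpow_of_nonneg (abs_nonneg _) hp0.le]
    have e2 : ENNReal.ofReal (∫ x in (-R)..R, (F x).re ^ p) ≤
        ∫⁻ x, ENNReal.ofReal (F x).re ^ p := by
      rw [intervalIntegral.integral_of_le (by linarith),
        ofReal_integral_eq_lintegral_ofReal (hrep.intervalIntegrable (-R) R).1
          (Eventually.of_forall fun x ↦ Real.rpow_nonneg (hpos x).le _)]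
      simp_rw [← ENNReal.ofReal_rpow_of_nonneg (hpos _).le hp0.le]
      exact setLIntegral_le_lintegral _ _
    have e3 : ∫ x in (-R)..R, |(F x).im| ^ p ≤
        A * (∫ x in (-R)..R, (F x).re ^ p) + B * ‖∫ x in (-R)..R, F x ^ (p : ℂ)‖ := by
      have hre : Continuous fun x ↦ (F x ^ (p : ℂ)).re := Complex.continuous_re.comp hFp
      calc ∫ x in (-R)..R, |(F x).im| ^ p
          ≤ ∫ x in (-R)..R, (A * (F x).re ^ p - B * (F x ^ (p : ℂ)).re) := by
            refine intervalIntegral.integral_mono_on (by linarith)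
              (himp.intervalIntegrable _ _) ?_ fun x _ ↦ hAB _ (hpos x).le
            exact ((continuous_const.mul hrep).sub (continuous_const.mul hre)).intervalIntegrable _ _
        _ = A * (∫ x in (-R)..R, (F x).re ^ p) - B * ∫ x in (-R)..R, (F x ^ (p : ℂ)).re := by
            rw [intervalIntegral.integral_sub ((hrep.intervalIntegrable _ _).const_mul A)
              ((hre.intervalIntegrable _ _).const_mul B),
              intervalIntegral.integral_const_mul, intervalIntegral.integral_const_mul]
        _ ≤ _ := by
            have h1 : ∫ x in (-R)..R, (F x ^ (p : ℂ)).re =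
                (∫ x in (-R)..R, F x ^ (p : ℂ)).re :=
              Complex.reCLM.intervalIntegral_comp_comm (hFp.intervalIntegrable _ _)
            rw [h1]
            have h2 := neg_le_of_abs_le
              (Complex.abs_re_le_norm (∫ x in (-R)..R, F x ^ (p : ℂ)))
            nlinarith
    rw [e1]
    refine (ENNReal.ofReal_le_ofReal e3).trans ?_
    refine ENNReal.ofReal_add_le.trans ?_
    rw [ENNReal.ofReal_mul hA]
    gcongr
  have hcover : AECover volume atTop (fun R : ℝ ↦ Ioc (-R) R) :=
    aecover_Ioc tendsto_neg_atTop_atBot tendsto_id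
  have hl := hcover.lintegral_tendsto_of_countably_generated
    (f := fun x ↦ ENNReal.ofReal |(F x).im| ^ p)
    ((Complex.continuous_im.comp hFc).abs.measurable.ennreal_ofReal.pow_const p).aemeasurable
  have hr : Tendsto (fun R : ℝ ↦ ENNReal.ofReal A * (∫⁻ x, ENNReal.ofReal (F x).re ^ p) +
        ENNReal.ofReal (B * ‖∫ x in (-R)..R, F x ^ (p : ℂ)‖)) atTop
      (𝓝 (ENNReal.ofReal A * (∫⁻ x, ENNReal.ofReal (F x).re ^ p) + 0)) := by
    refine tendsto_const_nhds.add ?_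
    have := ENNReal.tendsto_ofReal (hlim.norm.const_mul B)
    simpa using this
  rw [add_zero] at hr
  refine le_of_tendsto_of_tendsto hl hr ?_
  filter_upwards [eventually_gt_atTop 0] with R hR using hfin R hR

end GaborMod
end

/-! ### Synthesis operators on a lattice and their transposes. -/

noncomputable section

namespace GaborMod

/-- The synthesis operator `c ↦ ∑ c k K(x - βk)` is bounded by `M` from `ℓ^p` to `L^p`. -/
def SynBound (β p : ℝ) (K : ℝ → ℂ) (M : ℝ≥0∞) : Prop :=
  ∀ (s : Finset ℤ) (c : ℤ → ℂ),
    lpn p volume (fun x ↦ ‖∑ k ∈ s, c k * K (x - β * k)‖ₑ) ≤ M * (∑ k ∈ s, ‖c k‖ₑ ^ p) ^ (1 / p)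

variable {β p : ℝ}

theorem measurable_synthesis {K : ℝ → ℂ} (hK : Measurable K) (s : Finset ℤ) (c : ℤ → ℂ) :
    Measurable (fun x ↦ ∑ k ∈ s, c k * K (x - β * k)) :=
  Finset.measurable_fun_sum _ fun k _ ↦
    (hK.comp (measurable_id.sub_const (β * k))).const_mul (c k)

theorem SynBound.mono {K : ℝ → ℂ} {M N : ℝ≥0∞} (h : SynBound β p K M) (hMN : M ≤ N) :
    SynBound β p K N := fun s c ↦ (h s c).trans (by gcongr)

theorem SynBound.add (hp : 1 ≤ p) {K K' : ℝ → ℂ} {M M' : ℝ≥0∞} (hK : Measurable K)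
    (hK' : Measurable K') (h : SynBound β p K M) (h' : SynBound β p K' M') :
    SynBound β p (fun x ↦ K x + K' x) (M + M') := by
  intro s c
  calc lpn p volume (fun x ↦ ‖∑ k ∈ s, c k * (K (x - β * k) + K' (x - β * k))‖ₑ)
      ≤ lpn p volume (fun x ↦ ‖∑ k ∈ s, c k * K (x - β * k)‖ₑ +
          ‖∑ k ∈ s, c k * K' (x - β * k)‖ₑ) := by
        refine lpn_mono (by linarith) fun x ↦ ?_
        simp only [mul_add, Finset.sum_add_distrib]
        exact enorm_add_le _ _
    _ ≤ _ := lpn_add_le hp (measurable_synthesis hK s c).enorm.aemeasurable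
        (measurable_synthesis hK' s c).enorm.aemeasurable
    _ ≤ _ := by rw [add_mul]; exact add_le_add (h s c) (h' s c)

theorem SynBound.const_mul (hp : 0 < p) {K : ℝ → ℂ} {M : ℝ≥0∞} (h : SynBound β p K M) (a : ℂ) :
    SynBound β p (fun x ↦ a * K x) (‖a‖ₑ * M) := by
  intro s c
  have : ∀ x, ‖∑ k ∈ s, c k * (a * K (x - β * k))‖ₑ = ‖a‖ₑ * ‖∑ k ∈ s, c k * K (x - β * k)‖ₑ := by
    intro x
    rw [← enorm_mul, Finset.mul_sum]
    congr 1
    exact Finset.sum_congr rfl fun k _ ↦ by ring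
  simp only [this]
  rw [lpn_const_mul hp enorm_ne_top, mul_assoc]
  gcongr
  exact h s c

theorem char_add (ξ s t : ℝ) : char ξ (s + t) = char ξ s * char ξ t := by
  unfold char
  rw [← Complex.exp_add]
  push_cast
  ring_nf

theorem enorm_char (ξ t : ℝ) : ‖char ξ t‖ₑ = 1 := by
  rw [← ofReal_norm, norm_char, ENNReal.ofReal_one]

/-- The character splits as a factor in x, which has modulus one and leaves the sum, and a factor in
k, which is absorbed by the coefficients. The bound is thus uniform in the frequency. -/
theorem SynBound.char_mul {K : ℝ → ℂ} {M : ℝ≥0∞} (h : SynBound β p K M) (ξ : ℝ) :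
    SynBound β p (fun x ↦ char ξ x * K x) M := by
  intro s c
  have h1 : ∀ x, ‖∑ k ∈ s, c k * (char ξ (x - β * k) * K (x - β * k))‖ₑ =
      ‖∑ k ∈ s, (c k * char ξ (-(β * k))) * K (x - β * k)‖ₑ := by
    intro x
    rw [← one_mul ‖∑ k ∈ s, (c k * char ξ (-(β * k))) * K (x - β * k)‖ₑ, ← enorm_char ξ x,
      ← enorm_mul, Finset.mul_sum]
    congr 1
    refine Finset.sum_congr rfl fun k _ ↦ ?_
    rw [sub_eq_add_neg, char_add]
    ring
  simp only [h1]
  refine (h s _).trans_eq ?_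
  simp [enorm_mul, enorm_char]

/-- Treating ℓ^p as `lpn` for the counting measure lets one Schur test and one Minkowski inequality
serve sums and integrals alike. -/
theorem lpn_count {ι : Type*} [MeasurableSpace ι] [MeasurableSingletonClass ι] (p : ℝ)
    (u : ι → ℝ≥0∞) : lpn p Measure.count u = (∑' i, u i ^ p) ^ (1 / p) := by
  rw [lpn, lintegral_count]

theorem lpn_count_indicator (hp : 0 < p) (s : Finset ℤ) (u : ℤ → ℝ≥0∞) :
    lpn p Measure.count (indicator (s : Set ℤ) u) = (∑ k ∈ s, u k ^ p) ^ (1 / p) := by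
  rw [lpn_count, tsum_eq_sum (s := s)]
  · congr 1
    refine Finset.sum_congr rfl fun k hk ↦ ?_
    rw [indicator_of_mem (by simpa using hk)]
  · intro k hk
    rw [indicator_of_notMem (by simpa using hk), ENNReal.zero_rpow_of_pos hp]

theorem measurable_lattice_rho (β r : ℝ) :
    Measurable (Function.uncurry fun (x : ℝ) (k : ℤ) ↦ ENNReal.ofReal (rho r (x - β * k))) := by
  refine Measurable.ennreal_ofReal ((continuous_rho r).measurable.comp ?_)
  exact measurable_fst.sub
    (((measurable_of_countable (fun k : ℤ ↦ (k : ℝ))).comp measurable_snd).const_mul β)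

/-- Kernels of quadratic decay are bounded. -/
theorem exists_synBound_of_decay (hβ : 0 < β) :
    ∃ C : ℝ≥0∞, C ≠ ∞ ∧ ∀ p : ℝ, 1 ≤ p → ∀ (K : ℝ → ℂ) (L : ℝ), (∀ x, ‖K x‖ ≤ L * rho 2 x) →
      SynBound β p K (ENNReal.ofReal L * C) := by
  obtain ⟨C, hC, hCb⟩ := exists_tsum_rho_le (r := 2) (by norm_num) hβ
  set D := ∫⁻ x, ENNReal.ofReal (rho 2 x)
  have hD : D ≠ ∞ := (lintegral_rho_lt_top (by norm_num)).ne
  refine ⟨max C D, max_ne_top hC hD, fun p hp K L hK s c ↦ ?_⟩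
  have hp0 : 0 < p := by linarith
  set u : ℤ → ℝ≥0∞ := indicator (s : Set ℤ) fun k ↦ ‖c k‖ₑ
  have h1 : ∀ x, ‖∑ k ∈ s, c k * K (x - β * k)‖ₑ ≤
      ENNReal.ofReal L * ∫⁻ k : ℤ, ENNReal.ofReal (rho 2 (x - β * k)) * u k ∂Measure.count := by
    intro x
    rw [lintegral_count, tsum_eq_sum (s := s), Finset.mul_sum]
    · refine (enorm_sum_le _ _).trans (Finset.sum_le_sum fun k hk ↦ ?_)
      have huk : u k = ‖c k‖ₑ := indicator_of_mem (Finset.mem_coe.2 hk) _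
      rw [enorm_mul, huk, ← mul_assoc, mul_comm]
      gcongr
      have hL : 0 ≤ L := by
        have := (norm_nonneg _).trans (hK 0)
        exact nonneg_of_mul_nonneg_left this (rho_pos 2 0)
      rw [← ENNReal.ofReal_mul hL, ← ofReal_norm]
      exact ENNReal.ofReal_le_ofReal (hK _)
    · intro k hk
      simp [u, indicator_of_notMem (show k ∉ (s : Set ℤ) by simpa using hk)]
  refine (lpn_mono hp0.le h1).trans ?_
  rw [lpn_const_mul hp0 ENNReal.ofReal_ne_top, mul_assoc]
  gcongr
  rw [← lpn_count_indicator hp0]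
  refine lpn_lintegral_mul_le hp (measurable_lattice_rho β 2) (measurable_of_countable _) ?_ ?_
  · intro x
    rw [lintegral_count]
    exact (hCb x).trans (le_max_left _ _)
  · intro k
    rw [lintegral_sub_right_eq_self (fun x ↦ ENNReal.ofReal (rho 2 x)) (β * k)]
    exact le_max_right _ _

/-- The Hilbert kernel, smoothed at the origin. -/
def hilbertKernel (x : ℝ) : ℂ := ((x / (x ^ 2 + 1) : ℝ) : ℂ)

theorem continuous_hilbertKernel : Continuous hilbertKernel := by
  unfold hilbertKernel
  refine Complex.continuous_ofReal.comp (Continuous.div (by fun_prop) (by fun_prop) fun x ↦ ?_)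
  positivity

theorem inv_sq_add_one_le (x : ℝ) : 1 / (x ^ 2 + 1) ≤ 2 * rho 2 x := by
  rw [rho_two, ← div_eq_mul_inv, div_le_div_iff₀ (by positivity) (by positivity)]
  nlinarith [sq_nonneg (|x| - 1), sq_abs x]

/-- Riesz' inequality reduces the Hilbert kernel to the Poisson kernel 1/(x²+1), which decays
quadratically and needs no cancellation. -/
theorem exists_synthesis_nonneg_le (hβ : 0 < β) (hp : 1 < p) (hp2 : p ≤ 2) :
    ∃ M : ℝ≥0∞, M ≠ ∞ ∧ ∀ (s : Finset ℤ) (c : ℤ → ℝ), (∀ k, 0 ≤ c k) →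
      lpn p volume (fun x ↦ ‖∑ k ∈ s, (c k : ℂ) * hilbertKernel (x - β * k)‖ₑ) ≤
        M * (∑ k ∈ s, ‖c k‖ₑ ^ p) ^ (1 / p) := by
  obtain ⟨A, B, hA, hB, hAB⟩ := exists_abs_im_rpow_le hp hp2
  obtain ⟨C, hC, hCb⟩ := exists_synBound_of_decay hβ
  have hp0 : 0 < p := by linarith
  have hP := hCb p hp.le (fun x ↦ ((1 / (x ^ 2 + 1) : ℝ) : ℂ)) 2 (fun x ↦ by
    rw [Complex.norm_real, Real.norm_of_nonneg (by positivity)]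
    exact inv_sq_add_one_le x)
  refine ⟨ENNReal.ofReal A ^ (1 / p) * (ENNReal.ofReal 2 * C), ENNReal.mul_ne_top
    (ENNReal.rpow_ne_top_of_nonneg (by positivity) ENNReal.ofReal_ne_top)
    (ENNReal.mul_ne_top ENNReal.ofReal_ne_top hC), fun s c hc ↦ ?_⟩
  have hPs := hP s (fun k ↦ (c k : ℂ))
  have key := lintegral_conj_cauchySum_le (β := β) hp hA hB hAB s (fun k _ ↦ hc k)
  have e1 : ∀ x : ℝ, ‖∑ k ∈ s, (c k : ℂ) * hilbertKernel (x - β * k)‖ₑ =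
      ENNReal.ofReal |∑ k ∈ s, c k * ((x - β * k) / ((x - β * k) ^ 2 + 1))| := by
    intro x
    simp only [hilbertKernel]
    rw [← Real.norm_eq_abs, ← Complex.norm_real, ofReal_norm]
    push_cast
    rfl
  have e2 : ∀ x : ℝ, ‖∑ k ∈ s, (c k : ℂ) * ((1 / ((x - β * k) ^ 2 + 1) : ℝ) : ℂ)‖ₑ =
      ENNReal.ofReal (∑ k ∈ s, c k * (1 / ((x - β * k) ^ 2 + 1))) := by
    intro x
    have h0 : 0 ≤ ∑ k ∈ s, c k * (1 / ((x - β * k) ^ 2 + 1)) :=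
      Finset.sum_nonneg fun k _ ↦ mul_nonneg (hc k) (by positivity)
    rw [← Real.norm_of_nonneg h0, ← Complex.norm_real, ofReal_norm]
    push_cast
    rfl
  simp only [e2] at hPs
  simp only [e1]
  have e3 : ∀ k, ‖(c k : ℂ)‖ₑ = ‖c k‖ₑ := fun k ↦ by
    rw [← ofReal_norm, ← ofReal_norm, Complex.norm_real]
  simp only [e3] at hPs
  rw [mul_assoc]
  refine le_trans ?_ (mul_le_mul_right hPs _)
  unfold lpn
  rw [← ENNReal.mul_rpow_of_nonneg _ _ (by positivity)]
  exact ENNReal.rpow_le_rpow key (by positivity)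

/-- Complex coefficients are split into the positive and negative parts of their real and imaginary
parts. The four pieces are dominated by |c_k|, which explains the factor 4. -/
theorem exists_synBound_hilbertKernel_le_two (hβ : 0 < β) (hp : 1 < p) (hp2 : p ≤ 2) :
    ∃ M : ℝ≥0∞, M ≠ ∞ ∧ SynBound β p hilbertKernel M := by
  obtain ⟨M, hM, hMb⟩ := exists_synthesis_nonneg_le hβ hp hp2
  have hp0 : 0 < p := by linarith
  refine ⟨4 * M, ENNReal.mul_ne_top (by norm_num) hM, fun s c ↦ ?_⟩
  have key : ∀ a : ℤ → ℝ, (∀ k, 0 ≤ a k) → (∀ k, a k ≤ ‖c k‖) →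
      lpn p volume (fun x ↦ ‖∑ k ∈ s, (a k : ℂ) * hilbertKernel (x - β * k)‖ₑ) ≤
        M * (∑ k ∈ s, ‖c k‖ₑ ^ p) ^ (1 / p) := by
    intro a ha hac
    refine (hMb s a ha).trans ?_
    gcongr with k hk
    rw [← ofReal_norm, ← ofReal_norm, Real.norm_of_nonneg (ha k)]
    exact ENNReal.ofReal_le_ofReal (hac k)
  set a₁ : ℤ → ℝ := fun k ↦ max (c k).re 0
  set a₂ : ℤ → ℝ := fun k ↦ max (-(c k).re) 0
  set a₃ : ℤ → ℝ := fun k ↦ max (c k).im 0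
  set a₄ : ℤ → ℝ := fun k ↦ max (-(c k).im) 0
  have hre := fun k ↦ Complex.abs_re_le_norm (c k)
  have him := fun k ↦ Complex.abs_im_le_norm (c k)
  have k₁ := key a₁ (fun k ↦ le_max_right _ _) fun k ↦
    max_le ((le_abs_self _).trans (hre k)) (norm_nonneg _)
  have k₂ := key a₂ (fun k ↦ le_max_right _ _) fun k ↦
    max_le ((neg_le_abs _).trans (hre k)) (norm_nonneg _)
  have k₃ := key a₃ (fun k ↦ le_max_right _ _) fun k ↦
    max_le ((le_abs_self _).trans (him k)) (norm_nonneg _)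
  have k₄ := key a₄ (fun k ↦ le_max_right _ _) fun k ↦
    max_le ((neg_le_abs _).trans (him k)) (norm_nonneg _)
  have hc : ∀ k, c k = a₁ k - a₂ k + Complex.I * (a₃ k - a₄ k) := by
    intro k
    have h1 : ∀ r : ℝ, max r 0 - max (-r) 0 = r := fun r ↦ by
      rcases le_total r 0 with h | h
      · rw [max_eq_right h, max_eq_left (by linarith)]; ring
      · rw [max_eq_left h, max_eq_right (by linarith)]; ring
    have e1 : (a₁ k : ℂ) - a₂ k = ((c k).re : ℂ) := by
      rw [← h1 (c k).re]; push_cast; rfl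
    have e2 : (a₃ k : ℂ) - a₄ k = ((c k).im : ℂ) := by
      rw [← h1 (c k).im]; push_cast; rfl
    rw [e1, e2, mul_comm]
    exact (Complex.re_add_im _).symm
  set T : (ℤ → ℝ) → ℝ → ℝ≥0∞ := fun a x ↦ ‖∑ k ∈ s, (a k : ℂ) * hilbertKernel (x - β * k)‖ₑ
  have hT : ∀ a, AEMeasurable (T a) := fun a ↦
    (measurable_synthesis continuous_hilbertKernel.measurable s _).enorm.aemeasurable
  have hsum : ∀ x, ‖∑ k ∈ s, c k * hilbertKernel (x - β * k)‖ₑ ≤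
      (T a₁ x + T a₂ x) + (T a₃ x + T a₄ x) := by
    intro x
    have e : ∑ k ∈ s, c k * hilbertKernel (x - β * k) =
        (∑ k ∈ s, (a₁ k : ℂ) * hilbertKernel (x - β * k) -
          ∑ k ∈ s, (a₂ k : ℂ) * hilbertKernel (x - β * k)) +
        Complex.I * (∑ k ∈ s, (a₃ k : ℂ) * hilbertKernel (x - β * k) -
          ∑ k ∈ s, (a₄ k : ℂ) * hilbertKernel (x - β * k)) := by
      rw [← Finset.sum_sub_distrib, ← Finset.sum_sub_distrib, Finset.mul_sum,
        ← Finset.sum_add_distrib]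
      refine Finset.sum_congr rfl fun k _ ↦ ?_
      rw [hc k]; ring
    rw [e]
    refine (enorm_add_le _ _).trans (add_le_add enorm_sub_le ?_)
    rw [enorm_mul]
    have : ‖Complex.I‖ₑ = 1 := by rw [← ofReal_norm]; simp
    rw [this, one_mul]
    exact enorm_sub_le
  refine (lpn_mono hp0.le hsum).trans ?_
  refine (lpn_add_le hp.le ((hT _).add (hT _)) ((hT _).add (hT _))).trans ?_
  refine (add_le_add (lpn_add_le hp.le (hT _) (hT _)) (lpn_add_le hp.le (hT _) (hT _))).trans ?_
  refine (add_le_add (add_le_add k₁ k₂) (add_le_add k₃ k₄)).trans (le_of_eq ?_)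
  ring

/-- The converse of Hölder's inequality for finite sums. -/
theorem sum_rpow_le_of_forall_sum_mul_le {ι : Type*} {p q : ℝ} (hpq : p.HolderConjugate q)
    (t : Finset ι) (a : ι → ℂ) {B : ℝ≥0∞}
    (h : ∀ g : ι → ℂ, ‖∑ m ∈ t, g m * a m‖ₑ ≤ B * (∑ m ∈ t, ‖g m‖ₑ ^ p) ^ (1 / p)) :
    (∑ m ∈ t, ‖a m‖ₑ ^ q) ^ (1 / q) ≤ B := by
  have hq0 : 0 < q := hpq.symm.pos
  have hq1 : 1 < q := hpq.symm.lt
  set T := ∑ m ∈ t, ‖a m‖ₑ ^ q with hT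
  have hTtop : T ≠ ∞ := (ENNReal.sum_lt_top.2 fun m _ ↦
    ENNReal.rpow_lt_top_of_nonneg hq0.le enorm_ne_top).ne
  by_cases hT0 : T = 0
  · rw [hT0, ENNReal.zero_rpow_of_pos (by positivity)]; exact zero_le
  -- The extremal sequence in Hölder's inequality: g a = |a|^q and |g|^p = |a|^q. Testing with it
  -- gives T ≤ B T^{1/p}, and T is neither 0 nor ∞.
  set g : ι → ℂ := fun m ↦ conj (a m) * ((‖a m‖ ^ (q - 2) : ℝ) : ℂ) with hg
  have h1 : ∀ m, g m * a m = ((‖a m‖ ^ q : ℝ) : ℂ) := by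
    intro m
    by_cases ha : a m = 0
    · simp [ha, Real.zero_rpow hq0.ne']
    · have hn : 0 < ‖a m‖ := norm_pos_iff.2 ha
      have : conj (a m) * a m = ((‖a m‖ ^ 2 : ℝ) : ℂ) := by
        rw [mul_comm, Complex.mul_conj, Complex.normSq_eq_norm_sq]
      rw [hg]
      calc conj (a m) * ((‖a m‖ ^ (q - 2) : ℝ) : ℂ) * a m
          = (conj (a m) * a m) * ((‖a m‖ ^ (q - 2) : ℝ) : ℂ) := by ring
        _ = _ := by
          rw [this, ← Complex.ofReal_mul, ← Real.rpow_natCast, ← Real.rpow_add hn]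
          norm_num
  have h2 : ∀ m, ‖g m‖ₑ ^ p = ‖a m‖ₑ ^ q := by
    intro m
    have hgm : ‖g m‖ = ‖a m‖ ^ (q - 1) := by
      by_cases ha : a m = 0
      · simp [hg, ha, Real.zero_rpow (show q - 1 ≠ 0 by linarith)]
      · have hn : 0 < ‖a m‖ := norm_pos_iff.2 ha
        simp only [hg]
        rw [norm_mul, RCLike.norm_conj, Complex.norm_real, Real.norm_of_nonneg (by positivity)]
        nth_rewrite 1 [← Real.rpow_one ‖a m‖]
        rw [← Real.rpow_add hn]
        congr 1; ring
    rw [← ofReal_norm, hgm, ← ENNReal.ofReal_rpow_of_nonneg (norm_nonneg _) (by linarith),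
      ← ENNReal.rpow_mul, ofReal_norm]
    congr 1
    have := hpq.symm.sub_one_mul_conj
    linarith
  have h3 := h g
  simp only [h1, h2] at h3
  have h4 : ‖∑ m ∈ t, ((‖a m‖ ^ q : ℝ) : ℂ)‖ₑ = T := by
    rw [← Complex.ofReal_sum, ← ofReal_norm, Complex.norm_real,
      Real.norm_of_nonneg (Finset.sum_nonneg fun m _ ↦ by positivity),
      ENNReal.ofReal_sum_of_nonneg (fun m _ ↦ by positivity), hT]
    refine Finset.sum_congr rfl fun m _ ↦ ?_
    rw [← ENNReal.ofReal_rpow_of_nonneg (norm_nonneg _) hq0.le, ofReal_norm]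
  rw [h4] at h3
  have h5 : T = T ^ (1 / q) * T ^ (1 / p) := by
    rw [← ENNReal.rpow_add_of_nonneg _ _ (by positivity) hpq.one_div_nonneg]
    have : 1 / q + 1 / p = 1 := by simpa using hpq.symm.inv_add_inv_eq_one
    rw [this, ENNReal.rpow_one]
  have h6 : T ^ (1 / p) ≠ 0 := by
    simp [ENNReal.rpow_eq_zero_iff, hT0, hTtop]
  have h7 : T ^ (1 / p) ≠ ∞ := ENNReal.rpow_ne_top_of_nonneg hpq.one_div_nonneg hTtop
  have h8 : T ^ (1 / q) * T ^ (1 / p) ≤ B * T ^ (1 / p) := by rw [← h5]; exact h3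
  exact (ENNReal.mul_le_mul_iff_left h6 h7).1 h8

/-- The analysis operator `F ↦ (∫ F(x) K(x - βk) dx)_k` is the transpose of synthesis. -/
theorem SynBound.analysis {p q : ℝ} (hpq : p.HolderConjugate q) {K : ℝ → ℂ} {M : ℝ≥0∞}
    (hM : M ≠ ∞) (hK : Measurable K) (h : SynBound β p K M) {F : ℝ → ℂ} (hF : Measurable F)
    (hFfin : lpn q volume (fun x ↦ ‖F x‖ₑ) ≠ ∞) :
    lpn q Measure.count (fun k : ℤ ↦ ‖∫ x, F x * K (x - β * k)‖ₑ) ≤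
      M * lpn q volume (fun x ↦ ‖F x‖ₑ) := by
  have hq0 : 0 < q := hpq.symm.pos
  have hint : ∀ k : ℤ, Integrable (fun x ↦ F x * K (x - β * k)) := by
    intro k
    have hKk : Measurable fun x ↦ K (x - β * k) := hK.comp (measurable_id.sub_const _)
    refine ⟨(hF.mul hKk).aestronglyMeasurable, ?_⟩
    rw [hasFiniteIntegral_iff_enorm]
    simp only [enorm_mul]
    refine (lintegral_mul_le_lpn_mul_lpn hpq.symm hF.enorm.aemeasurable
      hKk.enorm.aemeasurable).trans_lt (ENNReal.mul_lt_top hFfin.lt_top ?_)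
    -- Synthesis of a single unit coefficient shows that the translate of `K` lies in L^p, so its
    -- product with `F` is integrable.
    have := h {k} 1
    simp only [Finset.sum_singleton, Pi.one_apply, one_mul] at this
    refine this.trans_lt (ENNReal.mul_lt_top hM.lt_top ?_)
    simp
  rw [lpn_count, ENNReal.tsum_eq_iSup_sum]
  have hfin : ∀ t : Finset ℤ, (∑ k ∈ t, ‖∫ x, F x * K (x - β * k)‖ₑ ^ q) ^ (1 / q) ≤
      M * lpn q volume (fun x ↦ ‖F x‖ₑ) := by
    intro t
    refine sum_rpow_le_of_forall_sum_mul_le hpq t _ fun g ↦ ?_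
    have e : ∑ k ∈ t, g k * ∫ x, F x * K (x - β * k) =
        ∫ x, F x * ∑ k ∈ t, g k * K (x - β * k) := by
      simp_rw [Finset.mul_sum, mul_left_comm (F _)]
      rw [integral_finsetSum _ fun k _ ↦ (hint k).const_mul (g k)]
      simp_rw [integral_const_mul]
    rw [e]
    refine (enorm_integral_le_lintegral_enorm _).trans ?_
    simp only [enorm_mul]
    refine (lintegral_mul_le_lpn_mul_lpn hpq.symm hF.enorm.aemeasurable
      (measurable_synthesis hK t g).enorm.aemeasurable).trans ?_
    rw [mul_comm M, mul_assoc]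
    gcongr
    exact h t g
  have h2 : ⨆ t : Finset ℤ, ∑ k ∈ t, ‖∫ x, F x * K (x - β * k)‖ₑ ^ q ≤
      (M * lpn q volume (fun x ↦ ‖F x‖ₑ)) ^ q := by
    refine iSup_le fun t ↦ ?_
    have := ENNReal.rpow_le_rpow (hfin t) hq0.le
    rwa [← ENNReal.rpow_mul, one_div_mul_cancel hq0.ne', ENNReal.rpow_one] at this
  have := ENNReal.rpow_le_rpow h2 (show 0 ≤ 1 / q by positivity)
  rwa [← ENNReal.rpow_mul, mul_one_div_cancel hq0.ne', ENNReal.rpow_one] at this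

end GaborMod
end

/-! ### Discretisation and duality for the Hilbert kernel. -/

noncomputable section

namespace GaborMod

variable {β p : ℝ}

/-- The Hilbert kernel made constant on the cells of the lattice `βℤ`. -/
def stepKernel (β x : ℝ) : ℂ := hilbertKernel (β * ⌊x / β⌋)

theorem measurable_stepKernel (β : ℝ) : Measurable (stepKernel β) := by
  refine continuous_hilbertKernel.measurable.comp ?_
  refine Measurable.const_mul ?_ β
  exact (measurable_of_countable (fun k : ℤ ↦ (k : ℝ))).comp
    (Int.measurable_floor.comp (measurable_id.div_const β))

theorem stepKernel_sub (hβ : 0 < β) (x : ℝ) (k : ℤ) :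
    stepKernel β (x - β * k) = hilbertKernel (β * ((⌊x / β⌋ - k : ℤ) : ℝ)) := by
  have : (x - β * k) / β = x / β - k := by field_simp
  rw [stepKernel, this, Int.floor_sub_intCast]

/-- The derivative of x/(x²+1) decays quadratically, so moving the argument a bounded distance
changes the kernel by a quadratically decaying amount. The difference factors exactly as (u - v)(1 -
uv)/((u²+1)(v²+1)). -/
theorem norm_hilbertKernel_sub_le (u v : ℝ) :
    ‖hilbertKernel u - hilbertKernel v‖ ≤ 2 * |u - v| * (1 + |u - v|) * rho 2 u := by
  have hu : 0 < 1 + u ^ 2 := by positivity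
  have hv : 0 < 1 + v ^ 2 := by positivity
  rw [hilbertKernel, hilbertKernel, ← Complex.ofReal_sub, Complex.norm_real, Real.norm_eq_abs]
  have e : u / (u ^ 2 + 1) - v / (v ^ 2 + 1) =
      (u - v) * ((1 - u * v) / ((u ^ 2 + 1) * (v ^ 2 + 1))) := by
    field_simp; ring
  have h1 : |1 - u * v| * ((1 + |u|) * (1 + |v|)) ≤ 2 * ((u ^ 2 + 1) * (v ^ 2 + 1)) := by
    have a : |1 - u * v| ≤ 1 + |u| * |v| := by
      have := abs_sub (1 : ℝ) (u * v); simpa [abs_mul] using this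
    have hu' := sq_abs u
    have hv' := sq_abs v
    rw [← hu', ← hv']
    have pu := abs_nonneg u
    have pv := abs_nonneg v
    calc |1 - u * v| * ((1 + |u|) * (1 + |v|)) ≤ (1 + |u| * |v|) * ((1 + |u|) * (1 + |v|)) := by
          gcongr
      _ ≤ _ := by
          nlinarith [sq_nonneg (|u| - |v|), sq_nonneg (|u| * |v| - 1), sq_nonneg (|u| - 1),
            sq_nonneg (|v| - 1), mul_nonneg pu pv, sq_nonneg (|u| * |v| - |u|),
            sq_nonneg (|u| * |v| - |v|)]
  have h2 : 1 + |u| ≤ (1 + |u - v|) * (1 + |v|) := by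
    have : |u| ≤ |u - v| + |v| := by
      have := abs_add_le (u - v) v; simpa using this
    nlinarith [mul_nonneg (abs_nonneg (u - v)) (abs_nonneg v)]
  rw [e, abs_mul, abs_div, abs_of_pos (show 0 < (u ^ 2 + 1) * (v ^ 2 + 1) by positivity), rho_two,
    mul_comm 2, mul_assoc, mul_assoc]
  refine mul_le_mul_of_nonneg_left ?_ (abs_nonneg _)
  rw [div_le_iff₀ (by positivity)]
  have h3 : |1 - u * v| * (1 + |u|) ^ 2 ≤
      (1 + |u - v|) * (2 * ((u ^ 2 + 1) * (v ^ 2 + 1))) := by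
    calc |1 - u * v| * (1 + |u|) ^ 2 = |1 - u * v| * ((1 + |u|) * (1 + |u|)) := by ring
      _ ≤ |1 - u * v| * ((1 + |u|) * ((1 + |u - v|) * (1 + |v|))) := by gcongr
      _ = (1 + |u - v|) * (|1 - u * v| * ((1 + |u|) * (1 + |v|))) := by ring
      _ ≤ _ := by gcongr
  calc |1 - u * v| = |1 - u * v| * (1 + |u|) ^ 2 * ((1 + |u|) ^ 2)⁻¹ := by
        field_simp
    _ ≤ (1 + |u - v|) * (2 * ((u ^ 2 + 1) * (v ^ 2 + 1))) * ((1 + |u|) ^ 2)⁻¹ := by gcongr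
    _ = _ := by ring

theorem norm_hilbertKernel_sub_stepKernel_le (hβ : 0 < β) (x : ℝ) :
    ‖hilbertKernel x - stepKernel β x‖ ≤ 2 * β * (1 + β) * rho 2 x := by
  refine (norm_hilbertKernel_sub_le x _).trans ?_
  have h1 : |x - β * ⌊x / β⌋| ≤ β := by
    have e : x - β * ⌊x / β⌋ = β * Int.fract (x / β) := by
      rw [Int.fract]; field_simp
    rw [e, abs_mul, abs_of_pos hβ, abs_of_nonneg (Int.fract_nonneg _)]
    nlinarith [(Int.fract_lt_one (x / β)).le]
  have := (rho_pos 2 x).le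
  gcongr

theorem lintegral_comp_floor (hβ : 0 < β) (G : ℤ → ℝ≥0∞) :
    ∫⁻ x : ℝ, G ⌊x / β⌋ = ENNReal.ofReal β * ∑' m, G m := by
  have h1 : ∀ x : ℝ, G ⌊x / β⌋ =
      ∑' m : ℤ, (Ico (β * m) (β * m + β)).indicator (fun _ ↦ G m) x := by
    intro x
    have hx : ∀ m : ℤ, x ∈ Ico (β * m) (β * m + β) ↔ ⌊x / β⌋ = m := by
      intro m
      rw [Int.floor_eq_iff, le_div_iff₀ hβ, div_lt_iff₀ hβ, mem_Ico, mul_comm β, add_mul, one_mul]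
    rw [tsum_eq_single ⌊x / β⌋]
    · rw [indicator_of_mem ((hx _).2 rfl)]
    · intro m hm
      exact indicator_of_notMem (fun h ↦ hm ((hx m).1 h).symm) _
  simp_rw [h1]
  rw [lintegral_tsum fun m ↦ (measurable_const.indicator measurableSet_Ico).aemeasurable,
    ← ENNReal.tsum_mul_left]
  refine tsum_congr fun m ↦ ?_
  rw [lintegral_indicator measurableSet_Ico, setLIntegral_const, Real.volume_Ico,
    add_sub_cancel_left, mul_comm]

/-- On a cell of length β the synthesised function is constant, so synthesis with the step kernel is
a discrete convolution on ℤ. -/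
theorem lpn_synthesis_stepKernel (hβ : 0 < β) (hp : 0 < p) (s : Finset ℤ) (c : ℤ → ℂ) :
    lpn p volume (fun x ↦ ‖∑ k ∈ s, c k * stepKernel β (x - β * k)‖ₑ) =
      ENNReal.ofReal β ^ (1 / p) *
        lpn p Measure.count
          (fun m : ℤ ↦ ‖∑ k ∈ s, c k * hilbertKernel (β * ((m - k : ℤ) : ℝ))‖ₑ) := by
  simp only [stepKernel_sub hβ]
  rw [lpn, lpn_count, ← ENNReal.mul_rpow_of_nonneg _ _ (by positivity),
    ← lintegral_comp_floor hβ
      (fun m : ℤ ↦ ‖∑ k ∈ s, c k * hilbertKernel (β * ((m - k : ℤ) : ℝ))‖ₑ ^ p)]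

theorem hilbertKernel_neg (x : ℝ) : hilbertKernel (-x) = -hilbertKernel x := by
  simp [hilbertKernel, neg_div]

/-- The discrete convolution has matrix entries `hilbertKernel` at β(m - k), and the kernel is odd,
so the transpose is minus the operator. Boundedness on ℓ^p therefore gives boundedness on the dual
ℓ^q. The smooth kernel maps sequences to functions and is not its own transpose, whence the detour.
-/
theorem SynBound.stepKernel_conj {q : ℝ} (hβ : 0 < β) (hpq : p.HolderConjugate q) {M : ℝ≥0∞}
    (hM : M ≠ ∞) (h : SynBound β p (stepKernel β) M) :
    ∃ N : ℝ≥0∞, N ≠ ∞ ∧ SynBound β q (stepKernel β) N := by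
  have hq0 : 0 < q := hpq.symm.pos
  have hp0 : 0 < p := hpq.pos
  have hβ0 : ENNReal.ofReal β ≠ 0 := by simpa using hβ
  have hβp : ENNReal.ofReal β ^ (1 / p) ≠ 0 := by
    simp [ENNReal.rpow_eq_zero_iff, hβ]
  have hβp' : ENNReal.ofReal β ^ (1 / p) ≠ ∞ :=
    ENNReal.rpow_ne_top_of_nonneg (by positivity) ENNReal.ofReal_ne_top
  set M' := (ENNReal.ofReal β ^ (1 / p))⁻¹ * M with hM'
  have hdisc : ∀ (s : Finset ℤ) (c : ℤ → ℂ), lpn p Measure.count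
      (fun m : ℤ ↦ ‖∑ k ∈ s, c k * hilbertKernel (β * ((m - k : ℤ) : ℝ))‖ₑ) ≤
        M' * (∑ k ∈ s, ‖c k‖ₑ ^ p) ^ (1 / p) := by
    intro s c
    have := h s c
    rw [lpn_synthesis_stepKernel hβ hp0] at this
    rw [hM', mul_assoc, mul_comm (ENNReal.ofReal β ^ (1 / p))⁻¹, ← div_eq_mul_inv,
      ENNReal.le_div_iff_mul_le (Or.inl hβp) (Or.inl hβp'), mul_comm]
    exact this
  have hM't : M' ≠ ∞ := ENNReal.mul_ne_top (ENNReal.inv_ne_top.2 hβp) hM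
  refine ⟨ENNReal.ofReal β ^ (1 / q) * M', ENNReal.mul_ne_top
    (ENNReal.rpow_ne_top_of_nonneg (by positivity) ENNReal.ofReal_ne_top) hM't, fun s c ↦ ?_⟩
  rw [lpn_synthesis_stepKernel hβ hq0, mul_assoc]
  gcongr
  refine lpn_le_of_rpow_le hq0 ?_
  rw [lintegral_count, ENNReal.tsum_eq_iSup_sum]
  refine iSup_le fun t ↦ ?_
  rw [← ENNReal.rpow_le_rpow_iff (z := 1 / q) (by positivity), ← ENNReal.rpow_mul,
    mul_one_div_cancel hq0.ne', ENNReal.rpow_one]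
  refine sum_rpow_le_of_forall_sum_mul_le hpq t _ fun g ↦ ?_
  have e : ∑ m ∈ t, g m * ∑ k ∈ s, c k * hilbertKernel (β * ((m - k : ℤ) : ℝ)) =
      -∑ k ∈ s, (∑ m ∈ t, g m * hilbertKernel (β * ((k - m : ℤ) : ℝ))) * c k := by
    simp_rw [Finset.mul_sum, Finset.sum_mul]
    rw [Finset.sum_comm, ← Finset.sum_neg_distrib]
    refine Finset.sum_congr rfl fun k _ ↦ ?_
    rw [← Finset.sum_neg_distrib]
    refine Finset.sum_congr rfl fun m _ ↦ ?_
    have : β * ((m - k : ℤ) : ℝ) = -(β * ((k - m : ℤ) : ℝ)) := by push_cast; ring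
    rw [this, hilbertKernel_neg]
    ring
  rw [e, enorm_neg]
  calc ‖∑ k ∈ s, (∑ m ∈ t, g m * hilbertKernel (β * ((k - m : ℤ) : ℝ))) * c k‖ₑ
      ≤ ∑ k ∈ s, ‖∑ m ∈ t, g m * hilbertKernel (β * ((k - m : ℤ) : ℝ))‖ₑ * ‖c k‖ₑ := by
        refine (enorm_sum_le _ _).trans_eq ?_
        simp only [enorm_mul]
    _ ≤ (∑ k ∈ s, ‖∑ m ∈ t, g m * hilbertKernel (β * ((k - m : ℤ) : ℝ))‖ₑ ^ p) ^ (1 / p) *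
          (∑ k ∈ s, ‖c k‖ₑ ^ q) ^ (1 / q) := ENNReal.inner_le_Lp_mul_Lq _ _ _ hpq
    _ ≤ (M' * (∑ m ∈ t, ‖g m‖ₑ ^ p) ^ (1 / p)) * (∑ k ∈ s, ‖c k‖ₑ ^ q) ^ (1 / q) := by
        gcongr
        refine le_trans ?_ (hdisc t g)
        rw [lpn_count]
        gcongr
        exact ENNReal.sum_le_tsum s
    _ = _ := by ring

/-- The boundedness of the Hilbert kernel for all `1 < p < ∞`. -/
theorem exists_synBound_hilbertKernel (hβ : 0 < β) (hp : 1 < p) :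
    ∃ M : ℝ≥0∞, M ≠ ∞ ∧ SynBound β p hilbertKernel M := by
  rcases le_total p 2 with hp2 | hp2
  · exact exists_synBound_hilbertKernel_le_two hβ hp hp2
  obtain ⟨C, hC, hCb⟩ := exists_synBound_of_decay hβ
  have hpq : p.HolderConjugate p.conjExponent := Real.HolderConjugate.conjExponent hp
  set q := p.conjExponent with hq
  have hq1 : 1 < q := hpq.symm.lt
  have hq2 : q ≤ 2 := by
    rw [hq, Real.conjExponent, div_le_iff₀ (by linarith)]; linarith
  obtain ⟨M, hM, hMb⟩ := exists_synBound_hilbertKernel_le_two hβ hq1 hq2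
  have hdiff : ∀ r : ℝ, 1 ≤ r → SynBound β r (fun x ↦ hilbertKernel x - stepKernel β x)
      (ENNReal.ofReal (2 * β * (1 + β)) * C) := fun r hr ↦
    hCb r hr _ _ (norm_hilbertKernel_sub_stepKernel_le hβ)
  have hmd : Measurable (fun x ↦ hilbertKernel x - stepKernel β x) :=
    continuous_hilbertKernel.measurable.sub (measurable_stepKernel β)
  have hD : ENNReal.ofReal (2 * β * (1 + β)) * C ≠ ∞ := ENNReal.mul_ne_top ENNReal.ofReal_ne_top hC
  -- The smooth and step kernels differ by quadratic decay. This allows passing to the step kernel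
  -- at the conjugate exponent q ≤ 2, dualising, and returning to the smooth kernel at p.
  have hstep : SynBound β q (stepKernel β) (M + ‖(-1 : ℂ)‖ₑ *
      (ENNReal.ofReal (2 * β * (1 + β)) * C)) := by
    have := hMb.add hq1.le continuous_hilbertKernel.measurable (hmd.const_mul (-1))
      ((hdiff q hq1.le).const_mul (by linarith) (-1))
    refine cast ?_ this
    congr 1
    funext x
    ring
  obtain ⟨N, hN, hNb⟩ := hstep.stepKernel_conj hβ hpq.symm
    (ENNReal.add_ne_top.2 ⟨hM, ENNReal.mul_ne_top enorm_ne_top hD⟩)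
  refine ⟨N + ENNReal.ofReal (2 * β * (1 + β)) * C, ENNReal.add_ne_top.2 ⟨hN, hD⟩, ?_⟩
  have := hNb.add hp.le (measurable_stepKernel β) hmd (hdiff p hp.le)
  refine cast ?_ this
  congr 1
  funext x
  ring

/-- Averages of bounded kernels are bounded. -/
theorem SynBound.integral (hp : 1 ≤ p) {S : Type*} [MeasurableSpace S] {ν : Measure S} [SFinite ν]
    {K : S → ℝ → ℂ} {m : S → ℂ} {M : ℝ≥0∞} (hK : Measurable (Function.uncurry K))
    (hm : Measurable m) (h : ∀ᵐ s ∂ν, SynBound β p (K s) M)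
    (hint : ∀ x, Integrable (fun s ↦ m s * K s x) ν) :
    SynBound β p (fun x ↦ ∫ s, m s * K s x ∂ν) (M * ∫⁻ s, ‖m s‖ₑ ∂ν) := by
  intro t c
  have hp0 : 0 < p := by linarith
  have e : ∀ x, ∑ k ∈ t, c k * ∫ s, m s * K s (x - β * k) ∂ν =
      ∫ s, m s * ∑ k ∈ t, c k * K s (x - β * k) ∂ν := by
    intro x
    simp_rw [Finset.mul_sum, mul_left_comm (m _)]
    rw [integral_finsetSum _ fun k _ ↦ (hint _).const_mul (c k)]
    simp_rw [integral_const_mul]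
  simp only [e]
  have hmeas : Measurable (Function.uncurry fun (x : ℝ) (s : S) ↦
      ‖m s * ∑ k ∈ t, c k * K s (x - β * k)‖ₑ) := by
    refine Measurable.enorm ((hm.comp measurable_snd).mul ?_)
    refine Finset.measurable_fun_sum _ fun k _ ↦ Measurable.const_mul ?_ (c k)
    exact hK.comp (measurable_snd.prodMk (measurable_fst.sub_const (β * k)))
  calc lpn p volume (fun x ↦ ‖∫ s, m s * ∑ k ∈ t, c k * K s (x - β * k) ∂ν‖ₑ)
      ≤ lpn p volume (fun x ↦ ∫⁻ s, ‖m s * ∑ k ∈ t, c k * K s (x - β * k)‖ₑ ∂ν) :=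
        lpn_mono hp0.le fun x ↦ enorm_integral_le_lintegral_enorm _
    _ ≤ ∫⁻ s, lpn p volume (fun x ↦ ‖m s * ∑ k ∈ t, c k * K s (x - β * k)‖ₑ) ∂ν :=
        lpn_lintegral_le hp hmeas
    _ ≤ ∫⁻ s, ‖m s‖ₑ * (M * (∑ k ∈ t, ‖c k‖ₑ ^ p) ^ (1 / p)) ∂ν := by
        refine lintegral_mono_ae ?_
        filter_upwards [h] with s hs
        simp only [enorm_mul]
        rw [lpn_const_mul hp0 enorm_ne_top]
        gcongr
        exact hs t c
    _ = _ := by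
        rw [lintegral_mul_const _ hm.enorm]
        ring

end GaborMod
end

noncomputable section

namespace GaborMod

/-! ### Piecewise `C¹` windows -/

/-- Finite sums of functions that are `C¹` on a compact interval and cut off outside of it. -/
inductive IsPiecewiseC1 : (ℝ → ℂ) → Prop
  | zero : IsPiecewiseC1 0
  | add {h h' : ℝ → ℂ} : IsPiecewiseC1 h → IsPiecewiseC1 h' → IsPiecewiseC1 (h + h')
  | piece {c d : ℝ} {g : ℝ → ℂ} : c < d → ContDiffOn ℝ 1 g (Icc c d) →
      IsPiecewiseC1 (indicator (Ioc c d) g)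

theorem IsPiecewiseC1.integrable {h : ℝ → ℂ} (hh : IsPiecewiseC1 h) : Integrable h := by
  induction hh with
  | zero => exact integrable_zero _ _ _
  | add _ _ h1 h2 => exact h1.add h2
  | piece hcd hg =>
    rw [integrable_indicator_iff measurableSet_Ioc]
    exact (hg.continuousOn.integrableOn_compact isCompact_Icc).mono_set Ioc_subset_Icc_self

theorem continuous_char_uncurry : Continuous fun z : ℝ × ℝ ↦ char z.1 z.2 := by
  unfold char; fun_prop

theorem char_comm (ξ t : ℝ) : char ξ t = char t ξ := by
  unfold char; ring_nf

theorem hasDerivAt_char (ξ t : ℝ) :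
    HasDerivAt (char ξ) (2 * Real.pi * Complex.I * ξ * char ξ t) t := by
  have h : HasDerivAt (char ξ) (char ξ t * (2 * Real.pi * Complex.I * ξ * 1)) t :=
    ((Complex.ofRealCLM.hasDerivAt (x := t)).const_mul (2 * Real.pi * Complex.I * ξ : ℂ)).cexp
  convert h using 1
  ring

/-- The Fourier transform of the window `h`, localised by a translate of `φ`. -/
def windowKernel (φ : 𝓢(ℝ, ℂ)) (h : ℝ → ℂ) (x w : ℝ) : ℂ :=
  ∫ t, h t * (conj (φ (t + w)) * char (-x) t)

theorem integrable_windowKernel (φ : 𝓢(ℝ, ℂ)) {h : ℝ → ℂ} (hh : Integrable h) (x w : ℝ) :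
    Integrable (fun t ↦ h t * (conj (φ (t + w)) * char (-x) t)) := by
  refine hh.mul_bdd (c := SchwartzMap.seminorm ℝ 0 0 φ) ?_ (Eventually.of_forall fun t ↦ ?_)
  · have := continuous_char (-x)
    have := φ.continuous
    exact Continuous.aestronglyMeasurable (by fun_prop)
  · rw [norm_mul, norm_char, mul_one, RCLike.norm_conj]
    exact φ.norm_le_seminorm ℝ _

theorem continuous_windowKernel (φ : 𝓢(ℝ, ℂ)) {h : ℝ → ℂ} (hh : Integrable h) :
    Continuous fun z : ℝ × ℝ ↦ windowKernel φ h z.1 z.2 := by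
  have hφ := φ.continuous
  unfold windowKernel
  refine continuous_of_dominated (bound := fun t ↦ ‖h t‖ * SchwartzMap.seminorm ℝ 0 0 φ) ?_ ?_ ?_ ?_
  · exact fun z ↦ (integrable_windowKernel φ hh z.1 z.2).aestronglyMeasurable
  · refine fun z ↦ Eventually.of_forall fun t ↦ ?_
    rw [norm_mul, norm_mul, norm_char, mul_one, RCLike.norm_conj]
    gcongr
    exact φ.norm_le_seminorm ℝ _
  · exact hh.norm.mul_const _
  · refine Eventually.of_forall fun t ↦ ?_
    refine continuous_const.mul (Continuous.mul (by fun_prop) ?_)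
    exact continuous_char_uncurry.comp (by fun_prop : Continuous fun z : ℝ × ℝ ↦ (-z.1, t))

theorem continuous_windowKernel_left (φ : 𝓢(ℝ, ℂ)) {h : ℝ → ℂ} (hh : Integrable h) (w : ℝ) :
    Continuous fun x : ℝ ↦ windowKernel φ h x w :=
  (continuous_windowKernel φ hh).comp (Continuous.prodMk_left w)

theorem windowKernel_add (φ : 𝓢(ℝ, ℂ)) {h h' : ℝ → ℂ} (hh : Integrable h) (hh' : Integrable h')
    (x w : ℝ) :
    windowKernel φ (h + h') x w = windowKernel φ h x w + windowKernel φ h' x w := by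
  unfold windowKernel
  simp only [Pi.add_apply, add_mul]
  exact integral_add (integrable_windowKernel φ hh x w) (integrable_windowKernel φ hh' x w)

theorem exists_norm_schwartz_le (φ : 𝓢(ℝ, ℂ)) : ∃ C : ℝ, 0 ≤ C ∧ ∀ t, ‖φ t‖ ≤ C * rho 2 t := by
  refine ⟨2 ^ 2 * ((Finset.Iic ((2, 0) : ℕ × ℕ)).sup fun m ↦ SchwartzMap.seminorm ℝ m.1 m.2) φ,
    by positivity, fun t ↦ ?_⟩
  have := SchwartzMap.one_add_le_sup_seminorm_apply (𝕜 := ℝ) (m := (2, 0)) (k := 2) (n := 0)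
    le_rfl le_rfl φ t
  simp only [norm_iteratedFDeriv_zero, Real.norm_eq_abs] at this
  rw [rho_two, ← div_eq_mul_inv, le_div_iff₀ (by positivity), mul_comm]
  exact this

theorem exists_norm_schwartz_shift_le (φ : 𝓢(ℝ, ℂ)) (c d : ℝ) :
    ∃ C : ℝ, 0 ≤ C ∧ ∀ t ∈ Icc c d, ∀ w, ‖φ (t + w)‖ ≤ C * rho 2 w := by
  obtain ⟨C, hC, hCb⟩ := exists_norm_schwartz_le φ
  refine ⟨C * (1 + (|c| + |d|)) ^ (2 : ℝ), by positivity, fun t ht w ↦ ?_⟩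
  refine (hCb _).trans ?_
  rw [mul_assoc, add_comm t w]
  gcongr
  refine (rho_add_le (by norm_num) w t).trans ?_
  have := (rho_pos 2 w).le
  gcongr
  rcases abs_cases t with h | h <;> rcases abs_cases c with h' | h' <;>
    rcases abs_cases d with h'' | h'' <;> linarith [ht.1, ht.2]

/-! ### Fourier transforms of indicator functions of intervals. -/

section Exponential

/-- The Fourier transform of the indicator function of `[c, s]`. -/
def expIntegral (c s x : ℝ) : ℂ := ∫ t in c..s, char (-x) t

theorem continuous_expIntegral (c : ℝ) : Continuous fun z : ℝ × ℝ ↦ expIntegral c z.1 z.2 := by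
  unfold expIntegral
  refine intervalIntegral.continuous_parametric_intervalIntegral_of_continuous ?_ (by fun_prop)
  exact continuous_char_uncurry.comp
    (by fun_prop : Continuous fun z : (ℝ × ℝ) × ℝ ↦ (-z.1.2, z.2))

theorem hasDerivAt_expIntegral (c s x : ℝ) :
    HasDerivAt (fun s ↦ expIntegral c s x) (char (-x) s) s :=
  intervalIntegral.integral_hasDerivAt_right ((continuous_char _).intervalIntegrable _ _)
    (continuous_char _).aestronglyMeasurable.stronglyMeasurableAtFilter
    (continuous_char _).continuousAt

theorem norm_expIntegral_le {c s : ℝ} (h : c ≤ s) (x : ℝ) : ‖expIntegral c s x‖ ≤ s - c := by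
  have := intervalIntegral.norm_integral_le_of_norm_le_const (a := c) (b := s) (C := 1)
    (f := char (-x)) fun t _ ↦ (norm_char _ _).le
  rwa [one_mul, abs_of_nonneg (by linarith)] at this

/-- The two endpoints contribute two characters in x, so up to a factor the transform is a
difference of modulated kernels 1/x. The product form avoids division at x = 0. -/
theorem mul_expIntegral (c s x : ℝ) :
    (x : ℂ) * expIntegral c s x =
      (2 * Real.pi * Complex.I)⁻¹ * (char (-c) x - char (-s) x) := by
  have h2 : (2 * Real.pi * Complex.I : ℂ) ≠ 0 := Complex.two_pi_I_ne_zero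
  have h : ∫ t in c..s, 2 * Real.pi * Complex.I * ((-x : ℝ) : ℂ) * char (-x) t =
      char (-x) s - char (-x) c :=
    intervalIntegral.integral_eq_sub_of_hasDerivAt (fun t _ ↦ hasDerivAt_char (-x) t)
      ((continuous_const.mul (continuous_char _)).intervalIntegrable _ _)
  rw [intervalIntegral.integral_const_mul] at h
  have hs : ∀ s : ℝ, char (-x) s = char (-s) x := fun s ↦ by unfold char; push_cast; ring_nf
  rw [← hs c, ← hs s, eq_inv_mul_iff_mul_eq₀ h2]
  unfold expIntegral
  push_cast at h
  linear_combination -h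

theorem norm_expIntegral_le_rho {c s : ℝ} (h : c ≤ s) (x : ℝ) :
    ‖expIntegral c s x‖ ≤ (s - c + 1) * rho 1 x := by
  rw [rho_one, ← div_eq_mul_inv, le_div_iff₀ (by positivity), mul_add, mul_one]
  have h1 := norm_expIntegral_le h x
  have h2 : ‖expIntegral c s x‖ * |x| ≤ 1 := by
    have := congrArg norm (mul_expIntegral c s x)
    rw [norm_mul, norm_mul, Complex.norm_real, Real.norm_eq_abs] at this
    rw [mul_comm, this]
    have hn : ‖(2 * Real.pi * Complex.I : ℂ)⁻¹‖ = (2 * Real.pi)⁻¹ := by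
      simp [abs_of_pos Real.pi_pos]
    rw [hn]
    have h3 : ‖char (-c) x - char (-s) x‖ ≤ 2 := by
      refine (norm_sub_le _ _).trans ?_
      rw [norm_char, norm_char]; norm_num
    rw [inv_mul_le_iff₀ (by positivity)]
    linarith [Real.pi_gt_three]
  linarith

variable {β p : ℝ}

/-- For E = `expIntegral c s`, E = (x/(x²+1)) · (xE) + E/(x²+1). The first term is a difference of
two modulated Hilbert kernels, with a bound independent of s; the second decays quadratically
because |E| ≤ d - c. -/
theorem exists_synBound_expIntegral (hβ : 0 < β) (hp : 1 < p) (c d : ℝ) :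
    ∃ M : ℝ≥0∞, M ≠ ∞ ∧ ∀ s ∈ Icc c d, SynBound β p (expIntegral c s) M := by
  obtain ⟨C, hC, hCb⟩ := exists_synBound_of_decay hβ
  obtain ⟨N, hN, hNb⟩ := exists_synBound_hilbertKernel hβ hp
  set a : ℂ := (2 * Real.pi * Complex.I)⁻¹
  refine ⟨‖a‖ₑ * N + ‖-a‖ₑ * N + ENNReal.ofReal ((d - c) * 2) * C, ?_, fun s hs ↦ ?_⟩
  · refine ENNReal.add_ne_top.2 ⟨ENNReal.add_ne_top.2 ⟨?_, ?_⟩, ?_⟩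
    · exact ENNReal.mul_ne_top enorm_ne_top hN
    · exact ENNReal.mul_ne_top enorm_ne_top hN
    · exact ENNReal.mul_ne_top ENNReal.ofReal_ne_top hC
  · have hm : ∀ ξ, Measurable fun x ↦ char ξ x * hilbertKernel x := fun ξ ↦
      ((continuous_char ξ).mul continuous_hilbertKernel).measurable
    have hEc : Continuous fun x ↦ expIntegral c s x :=
      (continuous_expIntegral c).comp (by fun_prop : Continuous fun x : ℝ ↦ (s, x))
    have hE : Continuous fun x ↦ expIntegral c s x * ((1 / (x ^ 2 + 1) : ℝ) : ℂ) := by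
      refine hEc.mul (Complex.continuous_ofReal.comp
        (Continuous.div (by fun_prop) (by fun_prop) fun x ↦ ?_))
      positivity
    have h3 : SynBound β p (fun x ↦ expIntegral c s x * ((1 / (x ^ 2 + 1) : ℝ) : ℂ))
        (ENNReal.ofReal ((d - c) * 2) * C) := by
      refine hCb p hp.le _ _ fun x ↦ ?_
      rw [norm_mul, Complex.norm_real, Real.norm_of_nonneg (by positivity), mul_assoc]
      have h1 := norm_expIntegral_le hs.1 x
      have h2 := inv_sq_add_one_le x
      have h4 : 0 ≤ d - c := by linarith [hs.1, hs.2]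
      refine mul_le_mul (by linarith [hs.2]) h2 (by positivity) h4
    have h := SynBound.add hp.le (((hm (-c)).const_mul a).add ((hm (-s)).const_mul (-a)))
      hE.measurable (SynBound.add hp.le ((hm (-c)).const_mul a) ((hm (-s)).const_mul (-a))
        ((hNb.char_mul (-c)).const_mul (by linarith) a)
        ((hNb.char_mul (-s)).const_mul (by linarith) (-a))) h3
    refine cast ?_ h
    congr 1
    funext x
    have hx : (x : ℂ) ^ 2 + 1 ≠ 0 := by
      have : (x ^ 2 + 1 : ℝ) ≠ 0 := by positivity
      exact_mod_cast this
    have key : (x : ℂ) * expIntegral c s x = a * (char (-c) x - char (-s) x) :=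
      mul_expIntegral c s x
    clear_value a
    simp only [Pi.add_apply, hilbertKernel]
    push_cast
    field_simp
    linear_combination (-(x : ℂ)) * key

end Exponential

/-! ### Integration by parts for one C¹ piece. -/

section Piece

variable {β p c d : ℝ} {g : ℝ → ℂ}

/-- Bounds for the product of a `C¹` function on `[c, d]` with translates of a Schwartz function. -/
theorem exists_bound_mul_schwartz_shift (φ : 𝓢(ℝ, ℂ)) (hcd : c < d)
    (hg : ContDiffOn ℝ 1 g (Icc c d)) :
    ∃ B : ℝ, 0 ≤ B ∧ ∀ w,
      ‖g d * conj (φ (d + w))‖ ≤ B * rho 2 w ∧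
      ContinuousOn (fun t ↦ g t * conj (φ (t + w))) (Icc c d) ∧
      ∀ t ∈ Ioo c d, DifferentiableAt ℝ (fun t ↦ g t * conj (φ (t + w))) t ∧
        ‖deriv (fun t ↦ g t * conj (φ (t + w))) t‖ ≤ B * rho 2 w := by
  obtain ⟨C₀, hC₀, hφ⟩ := exists_norm_schwartz_shift_le φ c d
  obtain ⟨C₁, hC₁, hφ'⟩ := exists_norm_schwartz_shift_le (SchwartzMap.derivCLM ℝ ℂ φ) c d
  obtain ⟨G₀, hG₀⟩ := isCompact_Icc.exists_bound_of_continuousOn hg.continuousOn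
  obtain ⟨G₁, hG₁⟩ := isCompact_Icc.exists_bound_of_continuousOn
    (hg.continuousOn_derivWithin (uniqueDiffOn_Icc hcd) le_rfl)
  have hdm : d ∈ Icc c d := right_mem_Icc.2 hcd.le
  have hG₀' : 0 ≤ G₀ := (norm_nonneg _).trans (hG₀ d hdm)
  have hG₁' : 0 ≤ G₁ := (norm_nonneg _).trans (hG₁ d hdm)
  refine ⟨G₀ * C₀ + (G₁ * C₀ + G₀ * C₁), by positivity, fun w ↦ ⟨?_, ?_, fun t ht ↦ ?_⟩⟩
  · have hr := (rho_pos 2 w).le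
    rw [norm_mul, RCLike.norm_conj]
    calc ‖g d‖ * ‖φ (d + w)‖ ≤ G₀ * (C₀ * rho 2 w) :=
          mul_le_mul (hG₀ d hdm) (hφ d hdm w) (norm_nonneg _) hG₀'
      _ ≤ _ := by
          have : 0 ≤ (G₁ * C₀ + G₀ * C₁) * rho 2 w := by positivity
          linarith
  · have := φ.continuous
    exact hg.continuousOn.mul (Continuous.continuousOn (by fun_prop))
  · have hr := (rho_pos 2 w).le
    have htI : t ∈ Icc c d := Ioo_subset_Icc_self ht
    have hnhds : Icc c d ∈ 𝓝 t := Icc_mem_nhds ht.1 ht.2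
    have hgd : DifferentiableAt ℝ g t :=
      (hg.differentiableOn one_ne_zero t htI).differentiableAt hnhds
    have hφd : HasDerivAt (fun t ↦ conj (φ (t + w)))
        (conj (SchwartzMap.derivCLM ℝ ℂ φ (t + w))) t := by
      have h1 : HasDerivAt (fun t ↦ φ (t + w)) (deriv φ (t + w)) t :=
        HasDerivAt.comp_add_const t w (φ.hasDerivAt (t + w))
      exact (Complex.conjCLE : ℂ →L[ℝ] ℂ).hasFDerivAt.comp_hasDerivAt t h1
    have hm := hgd.hasDerivAt.mul hφd
    refine ⟨hm.differentiableAt, ?_⟩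
    have e : deriv (fun t ↦ g t * conj (φ (t + w))) t = _ := hm.deriv
    rw [e]
    have hdg : ‖deriv g t‖ ≤ G₁ := by
      rw [← derivWithin_of_mem_nhds hnhds]
      exact hG₁ t htI
    calc _ ≤ ‖deriv g t * conj (φ (t + w))‖ +
          ‖g t * conj (SchwartzMap.derivCLM ℝ ℂ φ (t + w))‖ := norm_add_le _ _
      _ ≤ G₁ * (C₀ * rho 2 w) + G₀ * (C₁ * rho 2 w) := by
          rw [norm_mul, norm_mul, RCLike.norm_conj, RCLike.norm_conj]
          exact add_le_add (mul_le_mul hdg (hφ t htI w) (norm_nonneg _) hG₁')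
            (mul_le_mul (hG₀ t htI) (hφ' t htI w) (norm_nonneg _) hG₀')
      _ ≤ _ := by
          have : 0 ≤ G₀ * C₀ * rho 2 w := by positivity
          linarith

theorem ae_restrict_Ioc_mem_Ioo (c d : ℝ) : ∀ᵐ s ∂(volume.restrict (Ioc c d)), s ∈ Ioo c d := by
  rw [← Measure.restrict_congr_set (Ioo_ae_eq_Ioc (a := c) (b := d))]
  exact ae_restrict_mem measurableSet_Ioo

theorem integrable_deriv_mul_expIntegral {m : ℝ → ℂ} {B : ℝ} (hB : 0 ≤ B)
    (hm : ∀ t ∈ Ioo c d, ‖deriv m t‖ ≤ B) (x : ℝ) :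
    Integrable (fun s ↦ deriv m s * expIntegral c s x) (volume.restrict (Ioc c d)) := by
  have hE : Continuous fun s ↦ expIntegral c s x :=
    (continuous_expIntegral c).comp (by fun_prop : Continuous fun s : ℝ ↦ (s, x))
  refine Integrable.of_bound ((measurable_deriv m).mul hE.measurable).aestronglyMeasurable
    (B * (d - c)) ?_
  filter_upwards [ae_restrict_Ioc_mem_Ioo c d] with s hs
  rw [norm_mul]
  exact mul_le_mul (hm s hs) ((norm_expIntegral_le hs.1.le x).trans (by linarith [hs.2]))
    (norm_nonneg _) hB

/-- Integration by parts against the antiderivative of the character that vanishes at c, so only the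
endpoint d contributes. The transform of a C¹ piece becomes a boundary term and an average of
interval transforms, to which kernel bounds pass. -/
theorem integral_mul_char_eq {m : ℝ → ℂ} {B : ℝ} (hcd : c < d) (hm : ContinuousOn m (Icc c d))
    (hd : ∀ t ∈ Ioo c d, DifferentiableAt ℝ m t ∧ ‖deriv m t‖ ≤ B) (x : ℝ) :
    ∫ t in c..d, m t * char (-x) t =
      m d * expIntegral c d x + (-1) * ∫ s in Ioc c d, deriv m s * expIntegral c s x := by
  have hE : Continuous fun s ↦ expIntegral c s x :=
    (continuous_expIntegral c).comp (by fun_prop : Continuous fun s : ℝ ↦ (s, x))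
  have hint : IntervalIntegrable (deriv m) volume c d := by
    rw [intervalIntegrable_iff_integrableOn_Ioc_of_le hcd.le]
    refine Integrable.of_bound (measurable_deriv m).aestronglyMeasurable B ?_
    filter_upwards [ae_restrict_Ioc_mem_Ioo c d] with s hs using (hd s hs).2
  have h := intervalIntegral.integral_mul_deriv_eq_deriv_mul_of_hasDerivAt (a := c) (b := d)
    (u := m) (v := fun s ↦ expIntegral c s x) (u' := deriv m) (v' := char (-x))
    (by rwa [uIcc_of_le hcd.le]) hE.continuousOn
    (fun t ht ↦ by
      rw [min_eq_left hcd.le, max_eq_right hcd.le] at ht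
      exact (hd t ht).1.hasDerivAt)
    (fun t _ ↦ hasDerivAt_expIntegral c t x) hint ((continuous_char _).intervalIntegrable _ _)
  rw [h, intervalIntegral.integral_of_le hcd.le]
  have : expIntegral c c x = 0 := by simp [expIntegral]
  rw [this]
  ring

theorem windowKernel_piece (φ : 𝓢(ℝ, ℂ)) (hcd : c < d) (g : ℝ → ℂ) (x w : ℝ) :
    windowKernel φ (indicator (Ioc c d) g) x w =
      ∫ t in c..d, g t * conj (φ (t + w)) * char (-x) t := by
  rw [windowKernel, intervalIntegral.integral_of_le hcd.le, ← integral_indicator measurableSet_Ioc]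
  congr 1
  funext t
  by_cases ht : t ∈ Ioc c d
  · simp [ht, mul_assoc]
  · simp [ht]

end Piece

/-- Each interval transform is O((1+|x|)⁻¹), and the Schwartz factor supplies the decay in w. Jumps
may prevent faster decay in x. This size bound is used for absolute convergence, not for boundedness
of the operators. -/
theorem IsPiecewiseC1.exists_norm_windowKernel_le {h : ℝ → ℂ} (hh : IsPiecewiseC1 h)
    (φ : 𝓢(ℝ, ℂ)) :
    ∃ C : ℝ, 0 ≤ C ∧ ∀ x w, ‖windowKernel φ h x w‖ ≤ C * (rho 1 x * rho 2 w) := by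
  induction hh with
  | zero => exact ⟨0, le_rfl, fun x w ↦ by simp [windowKernel]⟩
  | add h1 h2 ih1 ih2 =>
    obtain ⟨C, hC, hCb⟩ := ih1
    obtain ⟨D, hD, hDb⟩ := ih2
    refine ⟨C + D, by positivity, fun x w ↦ ?_⟩
    rw [windowKernel_add φ h1.integrable h2.integrable, add_mul]
    exact (norm_add_le _ _).trans (add_le_add (hCb x w) (hDb x w))
  | @piece c d g hcd hg =>
    obtain ⟨B, hB, hBb⟩ := exists_bound_mul_schwartz_shift φ hcd hg
    refine ⟨B * (d - c + 1) + B * (d - c + 1) * (d - c), ?_, fun x w ↦ ?_⟩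
    · have : 0 ≤ d - c := by linarith
      positivity
    · obtain ⟨hd, hcont, hder⟩ := hBb w
      rw [windowKernel_piece φ hcd, integral_mul_char_eq hcd hcont hder]
      have hdc : 0 ≤ d - c := by linarith
      have hr1 := (rho_pos 1 x).le
      have hr2 := (rho_pos 2 w).le
      have hint : ‖∫ s in Ioc c d, deriv (fun t ↦ g t * conj (φ (t + w))) s * expIntegral c s x‖ ≤
          (B * rho 2 w) * ((d - c + 1) * rho 1 x) * (d - c) := by
        have := norm_setIntegral_le_of_norm_le_const_ae (μ := volume) (s := Ioc c d)
          (C := (B * rho 2 w) * ((d - c + 1) * rho 1 x))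
          (f := fun s ↦ deriv (fun t ↦ g t * conj (φ (t + w))) s * expIntegral c s x)
          (by simp) ?_
        · simpa [Real.volume_real_Ioc_of_le hcd.le] using this
        · filter_upwards [ae_restrict_Ioc_mem_Ioo c d] with s hs
          rw [norm_mul]
          refine mul_le_mul (hder s hs).2 ((norm_expIntegral_le_rho hs.1.le x).trans ?_)
            (norm_nonneg _) (by positivity)
          gcongr
          exact hs.2.le
      refine (norm_add_le _ _).trans ?_
      rw [norm_mul, norm_mul (-1 : ℂ), norm_neg, norm_one, one_mul]
      calc _ ≤ (B * rho 2 w) * ((d - c + 1) * rho 1 x) +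
            (B * rho 2 w) * ((d - c + 1) * rho 1 x) * (d - c) :=
            add_le_add (mul_le_mul hd (norm_expIntegral_le_rho hcd.le x) (norm_nonneg _)
              (by positivity)) hint
        _ = _ := by ring

/-- The pointwise bound in x is not integrable, so the operator bound must come from the Hilbert
kernel through the interval transforms. The weight in w comes from the boundary value and from the
derivative of g(t) conj φ(t+w). -/
theorem IsPiecewiseC1.exists_synBound {h : ℝ → ℂ} (hh : IsPiecewiseC1 h) (φ : 𝓢(ℝ, ℂ))
    {β p : ℝ} (hβ : 0 < β) (hp : 1 < p) :
    ∃ M : ℝ≥0∞, M ≠ ∞ ∧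
      ∀ w, SynBound β p (fun x ↦ windowKernel φ h x w) (M * ENNReal.ofReal (rho 2 w)) := by
  have hp0 : 0 < p := by linarith
  induction hh with
  | zero =>
    refine ⟨0, ENNReal.zero_ne_top, fun w s c ↦ ?_⟩
    simp [windowKernel, lpn, hp0]
  | add h1 h2 ih1 ih2 =>
    obtain ⟨C, hC, hCb⟩ := ih1
    obtain ⟨D, hD, hDb⟩ := ih2
    refine ⟨C + D, ENNReal.add_ne_top.2 ⟨hC, hD⟩, fun w ↦ ?_⟩
    simp only [windowKernel_add φ h1.integrable h2.integrable, add_mul]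
    exact (hCb w).add hp.le (continuous_windowKernel_left φ h1.integrable w).measurable
      (continuous_windowKernel_left φ h2.integrable w).measurable (hDb w)
  | @piece c d g hcd hg =>
    obtain ⟨B, hB, hBb⟩ := exists_bound_mul_schwartz_shift φ hcd hg
    obtain ⟨M, hM, hMb⟩ := exists_synBound_expIntegral hβ hp c d
    refine ⟨ENNReal.ofReal B * M + M * (ENNReal.ofReal B * ENNReal.ofReal (d - c)), ?_,
      fun w ↦ ?_⟩
    · exact ENNReal.add_ne_top.2 ⟨ENNReal.mul_ne_top ENNReal.ofReal_ne_top hM,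
        ENNReal.mul_ne_top hM (ENNReal.mul_ne_top ENNReal.ofReal_ne_top ENNReal.ofReal_ne_top)⟩
    · obtain ⟨hd, hcont, hder⟩ := hBb w
      have hr2 := (rho_pos 2 w).le
      set m : ℝ → ℂ := fun t ↦ g t * conj (φ (t + w)) with hmdef
      have hfun : (fun x ↦ windowKernel φ (indicator (Ioc c d) g) x w) = fun x ↦
          m d * expIntegral c d x +
            (-1) * ∫ s in Ioc c d, deriv m s * expIntegral c s x := by
        funext x
        rw [windowKernel_piece φ hcd]
        exact integral_mul_char_eq hcd hcont hder x
      have hEm : Measurable fun x ↦ expIntegral c d x :=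
        ((continuous_expIntegral c).comp
          (by fun_prop : Continuous fun x : ℝ ↦ (d, x))).measurable
      have hI : SynBound β p (fun x ↦ ∫ s in Ioc c d, deriv m s * expIntegral c s x)
          (M * ∫⁻ s in Ioc c d, ‖deriv m s‖ₑ) := by
        refine SynBound.integral hp.le (K := fun s x ↦ expIntegral c s x)
          (continuous_expIntegral c).measurable (measurable_deriv m) ?_
          (integrable_deriv_mul_expIntegral (by positivity) fun t ht ↦ (hder t ht).2)
        filter_upwards [ae_restrict_Ioc_mem_Ioo c d] with s hs
        exact hMb s (Ioo_subset_Icc_self hs)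
      have hIm : Measurable fun x ↦ ∫ s in Ioc c d, deriv m s * expIntegral c s x := by
        have h1 : StronglyMeasurable (Function.uncurry fun (x : ℝ) (s : ℝ) ↦
            deriv m s * expIntegral c s x) := by
          refine Measurable.stronglyMeasurable (((measurable_deriv m).comp measurable_snd).mul ?_)
          exact (continuous_expIntegral c).measurable.comp (measurable_snd.prodMk measurable_fst)
        exact h1.integral_prod_right.measurable
      rw [hfun]
      refine (SynBound.add hp.le (hEm.const_mul _) (hIm.const_mul _)
        ((hMb d (right_mem_Icc.2 hcd.le)).const_mul hp0 (m d)) (hI.const_mul hp0 (-1))).mono ?_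
      have e1 : ‖(-1 : ℂ)‖ₑ = 1 := by rw [enorm_neg]; simp
      have e2 : ‖m d‖ₑ ≤ ENNReal.ofReal B * ENNReal.ofReal (rho 2 w) := by
        rw [← ENNReal.ofReal_mul hB, ← ofReal_norm]
        exact ENNReal.ofReal_le_ofReal hd
      have e3 : ∫⁻ s in Ioc c d, ‖deriv m s‖ₑ ≤
          ENNReal.ofReal B * ENNReal.ofReal (rho 2 w) * ENNReal.ofReal (d - c) := by
        calc ∫⁻ s in Ioc c d, ‖deriv m s‖ₑ
            ≤ ∫⁻ s in Ioc c d, ENNReal.ofReal B * ENNReal.ofReal (rho 2 w) := by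
              refine lintegral_mono_ae ?_
              filter_upwards [ae_restrict_Ioc_mem_Ioo c d] with s hs
              rw [← ENNReal.ofReal_mul hB, ← ofReal_norm]
              exact ENNReal.ofReal_le_ofReal (hder s hs).2
          _ = _ := by rw [setLIntegral_const, Real.volume_Ioc]
      rw [e1, one_mul]
      calc ‖m d‖ₑ * M + M * ∫⁻ s in Ioc c d, ‖deriv m s‖ₑ
          ≤ (ENNReal.ofReal B * ENNReal.ofReal (rho 2 w)) * M + M *
            (ENNReal.ofReal B * ENNReal.ofReal (rho 2 w) * ENNReal.ofReal (d - c)) := by gcongr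
        _ = _ := by ring

end GaborMod
end

noncomputable section

namespace GaborMod

/-! ### Time-frequency shifts of Schwartz functions -/

theorem derivCLM_schwartzShift (x w : ℝ) (φ : 𝓢(ℝ, ℂ)) :
    SchwartzMap.derivCLM ℂ ℂ (schwartzShift x w φ) =
      schwartzShift x w (SchwartzMap.derivCLM ℂ ℂ φ) +
        (2 * Real.pi * Complex.I * w : ℂ) • schwartzShift x w φ := by
  ext t
  have h1 : HasDerivAt (fun t ↦ φ (t - x)) (deriv φ (t - x)) t :=
    HasDerivAt.comp_sub_const t x (φ.hasDerivAt (t - x))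
  have h2 := ((hasDerivAt_char w t).mul h1).congr_of_eventuallyEq
    (f₁ := schwartzShift x w φ) (Eventually.of_forall fun s ↦ schwartzShift_apply x w φ s)
  rw [SchwartzMap.derivCLM_apply, h2.deriv]
  simp only [add_apply, smul_apply, schwartzShift_apply,
    SchwartzMap.derivCLM_apply, smul_eq_mul]
  ring

theorem schwartzConj_schwartzShift (x w : ℝ) (ψ : 𝓢(ℝ, ℂ)) :
    schwartzConj (schwartzShift x w ψ) = schwartzShift x (-w) (schwartzConj ψ) := by
  ext t
  rw [schwartzConj_apply, schwartzShift_apply, schwartzShift_apply, schwartzConj_apply, map_mul]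
  congr 1
  unfold char
  rw [← Complex.exp_conj]
  simp [Complex.conj_ofNat]

theorem seminorm_succ (k l : ℕ) (φ : 𝓢(ℝ, ℂ)) :
    SchwartzMap.seminorm ℂ k (l + 1) φ =
      SchwartzMap.seminorm ℂ k l (SchwartzMap.derivCLM ℂ ℂ φ) := by
  have h : ∀ t, ‖iteratedFDeriv ℝ (l + 1) φ t‖ =
      ‖iteratedFDeriv ℝ l (SchwartzMap.derivCLM ℂ ℂ φ) t‖ := by
    intro t
    rw [norm_iteratedFDeriv_eq_norm_iteratedDeriv, norm_iteratedFDeriv_eq_norm_iteratedDeriv,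
      iteratedDeriv_succ']
    rfl
  rw [SchwartzMap.seminorm_apply, SchwartzMap.seminorm_apply]
  simp only [h]

theorem exists_pow_mul_norm_le (k : ℕ) (φ : 𝓢(ℝ, ℂ)) :
    ∃ C : ℝ, 0 ≤ C ∧ ∀ t, (1 + |t|) ^ k * ‖φ t‖ ≤ C := by
  refine ⟨2 ^ k * ((Finset.Iic ((k, 0) : ℕ × ℕ)).sup fun m ↦ SchwartzMap.seminorm ℝ m.1 m.2) φ,
    by positivity, fun t ↦ ?_⟩
  have := SchwartzMap.one_add_le_sup_seminorm_apply (𝕜 := ℝ) (m := (k, 0)) (k := k) (n := 0)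
    le_rfl le_rfl φ t
  simpa only [norm_iteratedFDeriv_zero, Real.norm_eq_abs] using this

theorem one_add_abs_le_mul (t x : ℝ) : 1 + |t| ≤ (1 + |x|) * (1 + |t - x|) := by
  have : |t| ≤ |t - x| + |x| := by
    have := abs_add_le (t - x) x; simpa using this
  nlinarith [mul_nonneg (abs_nonneg x) (abs_nonneg (t - x))]

theorem exists_pow_mul_norm_sub_le (k : ℕ) (φ : 𝓢(ℝ, ℂ)) :
    ∃ C : ℝ, 0 ≤ C ∧ ∀ t x, |t| ^ k * ‖φ (t - x)‖ ≤ C * (1 + |x|) ^ k := by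
  obtain ⟨C, hC, hCb⟩ := exists_pow_mul_norm_le k φ
  refine ⟨C, hC, fun t x ↦ ?_⟩
  calc |t| ^ k * ‖φ (t - x)‖ ≤ ((1 + |x|) * (1 + |t - x|)) ^ k * ‖φ (t - x)‖ := by
        gcongr
        linarith [one_add_abs_le_mul t x]
    _ = ((1 + |t - x|) ^ k * ‖φ (t - x)‖) * (1 + |x|) ^ k := by rw [mul_pow]; ring
    _ ≤ _ := by gcongr; exact hCb _

theorem norm_two_pi_I_mul (w : ℝ) : ‖(2 * Real.pi * Complex.I * w : ℂ)‖ = 2 * Real.pi * |w| := by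
  simp [abs_of_pos Real.pi_pos]

/-- Translation costs powers of x and each derivative of the modulation one power of w. This
polynomial growth is beaten later by the rapid decay of the inversion coefficients. -/
theorem exists_seminorm_schwartzShift_le (k l : ℕ) (φ : 𝓢(ℝ, ℂ)) :
    ∃ C : ℝ, 0 ≤ C ∧ ∀ x w, SchwartzMap.seminorm ℂ k l (schwartzShift x w φ) ≤
      C * ((1 + |x|) ^ k * (1 + |w|) ^ l) := by
  induction l generalizing φ with
  | zero =>
    obtain ⟨C, hC, hCb⟩ := exists_pow_mul_norm_sub_le k φ
    refine ⟨C, hC, fun x w ↦ SchwartzMap.seminorm_le_bound ℂ k 0 _ (by positivity) fun t ↦ ?_⟩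
    rw [norm_iteratedFDeriv_zero, schwartzShift_apply, norm_mul, norm_char, one_mul, pow_zero,
      mul_one, Real.norm_eq_abs]
    exact hCb t x
  | succ l ih =>
    obtain ⟨C, hC, hCb⟩ := ih φ
    obtain ⟨D, hD, hDb⟩ := ih (SchwartzMap.derivCLM ℂ ℂ φ)
    refine ⟨D + 2 * Real.pi * C, by positivity, fun x w ↦ ?_⟩
    rw [seminorm_succ, derivCLM_schwartzShift]
    refine (map_add_le_add _ _ _).trans ?_
    rw [map_smul_eq_mul, norm_two_pi_I_mul, add_mul]
    have hw : 1 ≤ 1 + |w| := by linarith [abs_nonneg w]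
    refine add_le_add ((hDb x w).trans ?_) ?_
    · gcongr
      · exact Nat.le_succ l
    · calc 2 * Real.pi * |w| * SchwartzMap.seminorm ℂ k l (schwartzShift x w φ)
          ≤ 2 * Real.pi * (1 + |w|) * (C * ((1 + |x|) ^ k * (1 + |w|) ^ l)) := by
            gcongr
            · linarith
            · exact hCb x w
        _ = _ := by ring

theorem norm_char_sub_le (w w' t : ℝ) : ‖char w t - char w' t‖ ≤ 2 * Real.pi * |t| * |w - w'| := by
  rw [char_comm w, char_comm w']
  have := Convex.norm_image_sub_le_of_norm_hasDerivWithin_le (f := char t)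
    (f' := fun w ↦ 2 * Real.pi * Complex.I * t * char t w) (s := univ) (C := 2 * Real.pi * |t|)
    (fun y _ ↦ (hasDerivAt_char t y).hasDerivWithinAt) (fun y _ ↦ by
      rw [norm_mul, norm_char, mul_one, norm_two_pi_I_mul]) convex_univ (mem_univ w') (mem_univ w)
  simpa [Real.norm_eq_abs] using this

/-- Mean value estimates in the frequency and in the translation give the case without derivatives.
Differentiating a shift gives shifts of the derivative and of the function itself, which drives the
induction. Continuity, hence measurability, of `stft` depends on this. -/
theorem tendsto_seminorm_schwartzShift_sub (k l : ℕ) (φ : 𝓢(ℝ, ℂ)) (z₀ : ℝ × ℝ) :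
    Tendsto (fun z : ℝ × ℝ ↦ SchwartzMap.seminorm ℂ k l
      (schwartzShift z.1 z.2 φ - schwartzShift z₀.1 z₀.2 φ)) (𝓝 z₀) (𝓝 0) := by
  induction l generalizing φ with
  | zero =>
    obtain ⟨C, hC, hCb⟩ := exists_pow_mul_norm_sub_le (k + 1) φ
    obtain ⟨D, hD, hDb⟩ := exists_pow_mul_norm_sub_le k (SchwartzMap.derivCLM ℂ ℂ φ)
    obtain ⟨x₀, w₀⟩ := z₀
    have hbound : ∀ z : ℝ × ℝ, |z.1 - x₀| ≤ 1 → SchwartzMap.seminorm ℂ k 0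
        (schwartzShift z.1 z.2 φ - schwartzShift x₀ w₀ φ) ≤
          2 * Real.pi * |z.2 - w₀| * (C * (2 + |x₀|) ^ (k + 1)) +
            D * (2 + |x₀|) ^ k * |z.1 - x₀| := by
      rintro ⟨x, w⟩ hx
      simp only at hx ⊢
      have hball : ∀ ξ, |ξ - x₀| ≤ 1 → 1 + |ξ| ≤ 2 + |x₀| := by
        intro ξ hξ
        have := abs_add_le (ξ - x₀) x₀
        rw [sub_add_cancel] at this
        linarith
      refine SchwartzMap.seminorm_le_bound ℂ k 0 _ (by positivity) fun t ↦ ?_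
      rw [norm_iteratedFDeriv_zero, sub_apply, schwartzShift_apply,
        schwartzShift_apply, Real.norm_eq_abs]
      have e : char w t * φ (t - x) - char w₀ t * φ (t - x₀) =
          (char w t - char w₀ t) * φ (t - x) + char w₀ t * (φ (t - x) - φ (t - x₀)) := by ring
      rw [e]
      have h1 : |t| ^ k * ‖(char w t - char w₀ t) * φ (t - x)‖ ≤
          2 * Real.pi * |w - w₀| * (C * (2 + |x₀|) ^ (k + 1)) := by
        rw [norm_mul]
        calc |t| ^ k * (‖char w t - char w₀ t‖ * ‖φ (t - x)‖)
            ≤ |t| ^ k * ((2 * Real.pi * |t| * |w - w₀|) * ‖φ (t - x)‖) := by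
              gcongr; exact norm_char_sub_le _ _ _
          _ = 2 * Real.pi * |w - w₀| * (|t| ^ (k + 1) * ‖φ (t - x)‖) := by ring
          _ ≤ 2 * Real.pi * |w - w₀| * (C * (1 + |x|) ^ (k + 1)) :=
              mul_le_mul_of_nonneg_left (hCb t x) (by positivity)
          _ ≤ _ := by
              have := hball x hx
              gcongr
      have h2 : |t| ^ k * ‖char w₀ t * (φ (t - x) - φ (t - x₀))‖ ≤
          D * (2 + |x₀|) ^ k * |x - x₀| := by
        rw [norm_mul, norm_char, one_mul]
        have hmv := Convex.norm_image_sub_le_of_norm_hasDerivWithin_le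
          (f := fun ξ ↦ ((|t| ^ k : ℝ) : ℂ) * φ (t - ξ))
          (f' := fun ξ ↦ ((|t| ^ k : ℝ) : ℂ) * -(SchwartzMap.derivCLM ℂ ℂ φ (t - ξ)))
          (s := Icc (x₀ - 1) (x₀ + 1)) (C := D * (2 + |x₀|) ^ k) (x := x₀) (y := x)
          (fun ξ _ ↦ by
            have : HasDerivAt (fun ξ ↦ φ (t - ξ)) (-(deriv φ (t - ξ))) ξ :=
              HasDerivAt.comp_const_sub t ξ (φ.hasDerivAt (t - ξ))
            exact (this.const_mul _).hasDerivWithinAt)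
          (fun ξ hξ ↦ by
            rw [norm_mul, norm_neg, Complex.norm_real, Real.norm_of_nonneg (by positivity)]
            refine (hDb t ξ).trans ?_
            have h1 : |ξ - x₀| ≤ 1 := abs_le.2 ⟨by linarith [hξ.1], by linarith [hξ.2]⟩
            have := hball ξ h1
            gcongr)
          (convex_Icc _ _) ⟨by linarith, by linarith⟩
          ⟨by linarith [(abs_le.1 hx).1], by linarith [(abs_le.1 hx).2]⟩
        rw [← mul_sub, norm_mul, Complex.norm_real, Real.norm_of_nonneg (by positivity)] at hmv
        exact hmv
      calc |t| ^ k * ‖(char w t - char w₀ t) * φ (t - x) + char w₀ t * (φ (t - x) - φ (t - x₀))‖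
          ≤ |t| ^ k * (‖(char w t - char w₀ t) * φ (t - x)‖ +
              ‖char w₀ t * (φ (t - x) - φ (t - x₀))‖) := by gcongr; exact norm_add_le _ _
        _ ≤ _ := by rw [mul_add]; exact add_le_add h1 h2
    refine squeeze_zero' (g := fun z : ℝ × ℝ ↦
      2 * Real.pi * |z.2 - w₀| * (C * (2 + |x₀|) ^ (k + 1)) + D * (2 + |x₀|) ^ k * |z.1 - x₀|)
      (Eventually.of_forall fun z ↦ apply_nonneg _ _) ?_ ?_
    · have : ∀ᶠ z : ℝ × ℝ in 𝓝 (x₀, w₀), |z.1 - x₀| < 1 := by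
        have hc : Continuous fun z : ℝ × ℝ ↦ |z.1 - x₀| := by fun_prop
        have := hc.tendsto (x₀, w₀)
        exact this.eventually_lt_const (by simp)
      filter_upwards [this] with z hz using hbound z hz.le
    · have hc : Continuous fun z : ℝ × ℝ ↦
        2 * Real.pi * |z.2 - w₀| * (C * (2 + |x₀|) ^ (k + 1)) +
          D * (2 + |x₀|) ^ k * |z.1 - x₀| := by fun_prop
      have := hc.tendsto (x₀, w₀)
      simpa using this
  | succ l ih =>
    have h1 := ih (SchwartzMap.derivCLM ℂ ℂ φ)
    have h2 := ih φ
    refine squeeze_zero (fun z ↦ apply_nonneg _ _) (g := fun z : ℝ × ℝ ↦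
      SchwartzMap.seminorm ℂ k l (schwartzShift z.1 z.2 (SchwartzMap.derivCLM ℂ ℂ φ) -
          schwartzShift z₀.1 z₀.2 (SchwartzMap.derivCLM ℂ ℂ φ)) +
        (2 * Real.pi * |z.2| * SchwartzMap.seminorm ℂ k l
          (schwartzShift z.1 z.2 φ - schwartzShift z₀.1 z₀.2 φ) +
        2 * Real.pi * |z.2 - z₀.2| * SchwartzMap.seminorm ℂ k l (schwartzShift z₀.1 z₀.2 φ)))
      (fun z ↦ ?_) ?_
    · rw [seminorm_succ, map_sub, derivCLM_schwartzShift, derivCLM_schwartzShift]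
      have e : schwartzShift z.1 z.2 (SchwartzMap.derivCLM ℂ ℂ φ) +
            (2 * Real.pi * Complex.I * z.2 : ℂ) • schwartzShift z.1 z.2 φ -
          (schwartzShift z₀.1 z₀.2 (SchwartzMap.derivCLM ℂ ℂ φ) +
            (2 * Real.pi * Complex.I * z₀.2 : ℂ) • schwartzShift z₀.1 z₀.2 φ) =
          (schwartzShift z.1 z.2 (SchwartzMap.derivCLM ℂ ℂ φ) -
            schwartzShift z₀.1 z₀.2 (SchwartzMap.derivCLM ℂ ℂ φ)) +
          ((2 * Real.pi * Complex.I * z.2 : ℂ) •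
            (schwartzShift z.1 z.2 φ - schwartzShift z₀.1 z₀.2 φ) +
          (2 * Real.pi * Complex.I * (z.2 - z₀.2 : ℝ) : ℂ) • schwartzShift z₀.1 z₀.2 φ) := by
        push_cast
        module
      rw [e]
      refine (map_add_le_add _ _ _).trans ?_
      gcongr
      refine (map_add_le_add _ _ _).trans ?_
      rw [map_smul_eq_mul, map_smul_eq_mul, norm_two_pi_I_mul, norm_two_pi_I_mul]
    · have hc1 : Tendsto (fun z : ℝ × ℝ ↦ 2 * Real.pi * |z.2|) (𝓝 z₀) (𝓝 (2 * Real.pi * |z₀.2|)) :=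
        (by fun_prop : Continuous fun z : ℝ × ℝ ↦ 2 * Real.pi * |z.2|).tendsto z₀
      have hc2 : Tendsto (fun z : ℝ × ℝ ↦ 2 * Real.pi * |z.2 - z₀.2| *
          SchwartzMap.seminorm ℂ k l (schwartzShift z₀.1 z₀.2 φ)) (𝓝 z₀) (𝓝 0) := by
        have := (by fun_prop : Continuous fun z : ℝ × ℝ ↦ 2 * Real.pi * |z.2 - z₀.2| *
          SchwartzMap.seminorm ℂ k l (schwartzShift z₀.1 z₀.2 φ)).tendsto z₀
        simpa using this
      simpa using h1.add ((hc1.mul h2).add hc2)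

/-- Time-frequency shifts act strongly continuously on Schwartz functions. -/
theorem continuous_schwartzShift (φ : 𝓢(ℝ, ℂ)) :
    Continuous fun z : ℝ × ℝ ↦ schwartzShift z.1 z.2 φ := by
  rw [continuous_iff_continuousAt]
  intro z₀
  rw [ContinuousAt, (schwartz_withSeminorms ℂ ℝ ℂ).tendsto_nhds]
  rintro ⟨k, l⟩ ε hε
  exact (tendsto_seminorm_schwartzShift_sub k l φ z₀).eventually_lt_const hε

theorem stft_eq (ψ : 𝓢(ℝ, ℂ)) (f : 𝓢'(ℝ, ℂ)) (x w : ℝ) :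
    stft ψ f x w = f (schwartzShift x (-w) (schwartzConj ψ)) := by
  rw [stft, schwartzConj_schwartzShift]

theorem continuous_stft (ψ : 𝓢(ℝ, ℂ)) (f : 𝓢'(ℝ, ℂ)) :
    Continuous fun z : ℝ × ℝ ↦ stft ψ f z.1 z.2 := by
  simp only [stft_eq]
  exact f.continuous.comp ((continuous_schwartzShift (schwartzConj ψ)).comp
    (by fun_prop : Continuous fun z : ℝ × ℝ ↦ (z.1, -z.2)))

/-! ### The short-time Fourier transform of Schwartz functions -/

/-- The bilinear pairing of `φ` with a time-frequency shift of `η`. -/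
def crossShift (φ η : 𝓢(ℝ, ℂ)) (x w : ℝ) : ℂ := ∫ t, φ t * schwartzShift x w η t

theorem integrable_schwartz_mul (φ η : 𝓢(ℝ, ℂ)) : Integrable fun t ↦ φ t * η t := by
  refine φ.integrable.mul_bdd (c := SchwartzMap.seminorm ℝ 0 0 η)
    η.continuous.aestronglyMeasurable (Eventually.of_forall fun t ↦ η.norm_le_seminorm ℝ t)

/-- Integration by parts trades a factor w for a derivative on one of the two functions. Iteration
gives arbitrary decay in w. -/
theorem mul_crossShift (φ η : 𝓢(ℝ, ℂ)) (x w : ℝ) :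
    (2 * Real.pi * Complex.I * w : ℂ) * crossShift φ η x w =
      -(crossShift (SchwartzMap.derivCLM ℂ ℂ φ) η x w +
        crossShift φ (SchwartzMap.derivCLM ℂ ℂ η) x w) := by
  have h := SchwartzMap.integral_mul_deriv_eq_neg_deriv_mul φ (schwartzShift x w η)
  have e : ∀ t, φ t * deriv (schwartzShift x w η) t =
      φ t * schwartzShift x w (SchwartzMap.derivCLM ℂ ℂ η) t +
        (2 * Real.pi * Complex.I * w : ℂ) * (φ t * schwartzShift x w η t) := by
    intro t
    rw [← SchwartzMap.derivCLM_apply ℂ, derivCLM_schwartzShift]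
    simp only [add_apply, smul_apply, smul_eq_mul]
    ring
  simp only [e] at h
  rw [integral_add (integrable_schwartz_mul _ _) ((integrable_schwartz_mul _ _).const_mul _),
    integral_const_mul] at h
  unfold crossShift
  simp only [SchwartzMap.derivCLM_apply]
  linear_combination h

theorem exists_pow_mul_crossShift_le (M N : ℕ) (φ η : 𝓢(ℝ, ℂ)) :
    ∃ C : ℝ, 0 ≤ C ∧ ∀ x w, (1 + |x|) ^ M * |w| ^ N * ‖crossShift φ η x w‖ ≤ C := by
  induction N generalizing φ η with
  | zero =>
    obtain ⟨C, hC, hCb⟩ := exists_pow_mul_norm_le (M + 2) φ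
    obtain ⟨D, hD, hDb⟩ := exists_pow_mul_norm_le M η
    have hI := (integrable_rho (r := 2) (by norm_num)).const_mul (C * D)
    refine ⟨∫ t, C * D * rho 2 t, integral_nonneg fun t ↦ ?_, fun x w ↦ ?_⟩
    · have := (rho_pos 2 t).le; simp only [Pi.zero_apply]; positivity
    · rw [pow_zero, mul_one, ← Real.norm_of_nonneg (by positivity : (0 : ℝ) ≤ (1 + |x|) ^ M),
        ← norm_smul, crossShift, ← integral_smul]
      refine norm_integral_le_of_norm_le hI (Eventually.of_forall fun t ↦ ?_)
      rw [norm_smul, norm_mul, schwartzShift_apply, norm_mul, norm_char, one_mul,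
        Real.norm_of_nonneg (by positivity)]
      have h1 : 1 + |x| ≤ (1 + |t|) * (1 + |t - x|) := by
        have := one_add_abs_le_mul x t
        rwa [abs_sub_comm] at this
      have h2 : ‖φ t‖ * (1 + |t|) ^ M ≤ C * rho 2 t := by
        rw [rho_two, ← div_eq_mul_inv, le_div_iff₀ (by positivity)]
        have := hCb t
        rw [pow_add] at this
        linarith
      calc (1 + |x|) ^ M * (‖φ t‖ * ‖η (t - x)‖)
          ≤ ((1 + |t|) * (1 + |t - x|)) ^ M * (‖φ t‖ * ‖η (t - x)‖) := by gcongr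
        _ = (‖φ t‖ * (1 + |t|) ^ M) * ((1 + |t - x|) ^ M * ‖η (t - x)‖) := by
            rw [mul_pow]; ring
        _ ≤ (C * rho 2 t) * D := by
            have := (rho_pos 2 t).le
            gcongr
            exact hDb _
        _ = _ := by ring
  | succ N ih =>
    obtain ⟨C, hC, hCb⟩ := ih (SchwartzMap.derivCLM ℂ ℂ φ) η
    obtain ⟨D, hD, hDb⟩ := ih φ (SchwartzMap.derivCLM ℂ ℂ η)
    refine ⟨C + D, by positivity, fun x w ↦ ?_⟩
    have h := congrArg norm (mul_crossShift φ η x w)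
    rw [norm_mul, norm_two_pi_I_mul, norm_neg] at h
    have h1 : |w| * ‖crossShift φ η x w‖ ≤
        ‖crossShift (SchwartzMap.derivCLM ℂ ℂ φ) η x w‖ +
          ‖crossShift φ (SchwartzMap.derivCLM ℂ ℂ η) x w‖ := by
      refine le_trans ?_ (h.trans_le (norm_add_le _ _))
      rw [mul_assoc]
      have hp := Real.pi_gt_three
      nlinarith [mul_nonneg (abs_nonneg w) (norm_nonneg (crossShift φ η x w))]
    calc (1 + |x|) ^ M * |w| ^ (N + 1) * ‖crossShift φ η x w‖
        = (1 + |x|) ^ M * |w| ^ N * (|w| * ‖crossShift φ η x w‖) := by ring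
      _ ≤ (1 + |x|) ^ M * |w| ^ N * (‖crossShift (SchwartzMap.derivCLM ℂ ℂ φ) η x w‖ +
          ‖crossShift φ (SchwartzMap.derivCLM ℂ ℂ η) x w‖) := by gcongr
      _ ≤ _ := by rw [mul_add]; exact add_le_add (hCb x w) (hDb x w)

theorem exists_norm_crossShift_le (N : ℕ) (φ η : 𝓢(ℝ, ℂ)) :
    ∃ C : ℝ, 0 ≤ C ∧ ∀ x w, (1 + |x|) ^ N * (1 + |w|) ^ N * ‖crossShift φ η x w‖ ≤ C := by
  obtain ⟨C, hC, hCb⟩ := exists_pow_mul_crossShift_le N 0 φ η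
  obtain ⟨D, hD, hDb⟩ := exists_pow_mul_crossShift_le N N φ η
  refine ⟨2 ^ (N - 1) * (C + D), by positivity, fun x w ↦ ?_⟩
  have h := add_pow_le zero_le_one (abs_nonneg w) N
  rw [one_pow] at h
  have h1 := hCb x w
  have h2 := hDb x w
  rw [pow_zero, mul_one] at h1
  calc (1 + |x|) ^ N * (1 + |w|) ^ N * ‖crossShift φ η x w‖
      ≤ (1 + |x|) ^ N * (2 ^ (N - 1) * (1 + |w| ^ N)) * ‖crossShift φ η x w‖ := by gcongr
    _ = 2 ^ (N - 1) * ((1 + |x|) ^ N * ‖crossShift φ η x w‖ +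
          (1 + |x|) ^ N * |w| ^ N * ‖crossShift φ η x w‖) := by ring
    _ ≤ _ := by gcongr

end GaborMod
end

noncomputable section

namespace GaborMod

/-! ### Inversion of the short-time Fourier transform of tempered distributions -/

/-- The bounded function `t ↦ t^k φ^{(l)}(t)`. -/
def jetComponent (k l : ℕ) : 𝓢(ℝ, ℂ) →L[ℂ] (BoundedContinuousFunction ℝ ℂ) :=
  SchwartzMap.toBoundedContinuousFunctionCLM ℂ ℝ ℂ ∘L
    SchwartzMap.smulLeftCLM ℂ (fun t : ℝ ↦ (t : ℂ) ^ k) ∘L (SchwartzMap.derivCLM ℂ ℂ) ^ l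

theorem hasTemperateGrowth_ofReal_pow (k : ℕ) :
    (fun t : ℝ ↦ (t : ℂ) ^ k).HasTemperateGrowth := by
  have h : (fun t : ℝ ↦ (t : ℂ)).HasTemperateGrowth :=
    Complex.ofRealCLM.hasTemperateGrowth
  induction k with
  | zero => simp
  | succ k ih =>
    simp only [pow_succ]
    exact ih.mul h

theorem jetComponent_apply (k l : ℕ) (φ : 𝓢(ℝ, ℂ)) (t : ℝ) :
    jetComponent k l φ t = (t : ℂ) ^ k * ((SchwartzMap.derivCLM ℂ ℂ) ^ l) φ t := by
  change (SchwartzMap.smulLeftCLM ℂ (fun t : ℝ ↦ (t : ℂ) ^ k))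
    (((SchwartzMap.derivCLM ℂ ℂ) ^ l) φ) t = _
  rw [SchwartzMap.smulLeftCLM_apply_apply (hasTemperateGrowth_ofReal_pow k), smul_eq_mul]

theorem iteratedDeriv_eq_derivCLM_pow (l : ℕ) (φ : 𝓢(ℝ, ℂ)) :
    iteratedDeriv l φ = ((SchwartzMap.derivCLM ℂ ℂ) ^ l) φ := by
  induction l generalizing φ with
  | zero => simp
  | succ l ih =>
    rw [iteratedDeriv_succ', pow_succ]
    exact ih (SchwartzMap.derivCLM ℂ ℂ φ)

theorem norm_jetComponent_apply (k l : ℕ) (φ : 𝓢(ℝ, ℂ)) (t : ℝ) :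
    ‖jetComponent k l φ t‖ = ‖t‖ ^ k * ‖iteratedFDeriv ℝ l φ t‖ := by
  rw [jetComponent_apply, norm_iteratedFDeriv_eq_norm_iteratedDeriv,
    iteratedDeriv_eq_derivCLM_pow, norm_mul, norm_pow, Complex.norm_real]

/-- The Schwartz seminorms become norms in a Banach space of bounded functions, where vector-valued
integrals are available. -/
theorem norm_jetComponent (k l : ℕ) (φ : 𝓢(ℝ, ℂ)) :
    ‖jetComponent k l φ‖ = SchwartzMap.seminorm ℂ k l φ := by
  refine le_antisymm ?_ ?_
  · refine (BoundedContinuousFunction.norm_le (apply_nonneg _ _)).2 fun t ↦ ?_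
    rw [norm_jetComponent_apply]
    exact SchwartzMap.le_seminorm ℂ k l φ t
  · refine SchwartzMap.seminorm_le_bound ℂ k l φ (norm_nonneg _) fun t ↦ ?_
    rw [← norm_jetComponent_apply]
    exact BoundedContinuousFunction.norm_coe_le_norm _ t

/-- A finite family of weighted derivatives of a Schwartz function. -/
def jet (s : Finset (ℕ × ℕ)) : 𝓢(ℝ, ℂ) →L[ℂ] (s → BoundedContinuousFunction ℝ ℂ) :=
  ContinuousLinearMap.pi fun i ↦ jetComponent i.1.1 i.1.2

/-- A tempered distribution is a bounded functional of finitely many weighted derivatives. -/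
theorem exists_eq_comp_jet (f : 𝓢'(ℝ, ℂ)) :
    ∃ (s : Finset (ℕ × ℕ)) (Λ : (s → BoundedContinuousFunction ℝ ℂ) →L[ℂ] ℂ),
      ∀ φ, f φ = Λ (jet s φ) := by
  set fL : 𝓢(ℝ, ℂ) →ₗ[ℂ] ℂ := { toFun := f, map_add' := map_add f, map_smul' := map_smul f }
  obtain ⟨s, C, -, hC⟩ := Seminorm.bound_of_continuous (schwartz_withSeminorms ℂ ℝ ℂ)
    ((normSeminorm ℂ ℂ).comp fL) (continuous_norm.comp f.continuous)
  have hb : ∀ φ, ‖f φ‖ ≤ C * ‖jet s φ‖ := by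
    intro φ
    refine (hC φ).trans ?_
    change (C : ℝ) * (s.sup (schwartzSeminormFamily ℂ ℝ ℂ)) φ ≤ _
    gcongr
    refine Seminorm.finset_sup_apply_le (norm_nonneg _) fun i hi ↦ ?_
    rw [schwartzSeminormFamily, ← norm_jetComponent]
    exact norm_le_pi_norm (jet s φ) ⟨i, hi⟩
  -- The seminorm bound makes `f` vanish on the kernel of `jet s`. It therefore descends to a
  -- bounded functional on the range, which Hahn–Banach extends.
  have hker : fL ∈ ((jet s).toLinearMap.ker).dualAnnihilator := by
    rw [Submodule.mem_dualAnnihilator]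
    intro φ hφ
    have h0 : jet s φ = 0 := hφ
    have := hb φ
    rw [h0, norm_zero, mul_zero] at this
    exact norm_le_zero_iff.1 this
  rw [← LinearMap.range_dualMap_eq_dualAnnihilator_ker] at hker
  obtain ⟨G, hG⟩ := hker
  have hG' : ∀ φ, G (jet s φ) = f φ := fun φ ↦ LinearMap.congr_fun hG φ
  set R := (jet s).toLinearMap.range
  set G₀ : R →L[ℂ] ℂ := LinearMap.mkContinuous (G.domRestrict R) C (by
    rintro ⟨_, φ, rfl⟩
    change ‖G (jet s φ)‖ ≤ C * ‖jet s φ‖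
    rw [hG']
    exact hb φ)
  obtain ⟨Λ, hΛ, -⟩ := exists_extension_norm_eq R G₀
  refine ⟨s, Λ, fun φ ↦ ?_⟩
  rw [← hG' φ]
  exact (hΛ ⟨jet s φ, φ, rfl⟩).symm

theorem crossShift_eq (φ η : 𝓢(ℝ, ℂ)) (x w : ℝ) :
    crossShift φ η x w = (φ : 𝓢'(ℝ, ℂ)) (schwartzShift x w η) := by
  rw [SchwartzMap.coe_apply]
  simp only [crossShift, smul_eq_mul, mul_comm]

/-- The coefficient function in the inversion formula. -/
def invCoeff (φ η : 𝓢(ℝ, ℂ)) (z : ℝ × ℝ) : ℂ := conj (crossShift φ η z.1 (-z.2))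

theorem continuous_schwartzShift_neg (η : 𝓢(ℝ, ℂ)) :
    Continuous fun z : ℝ × ℝ ↦ schwartzShift z.1 (-z.2) η := by
  have h : Continuous fun z : ℝ × ℝ ↦ (z.1, -z.2) := by fun_prop
  exact (continuous_schwartzShift η).comp h

theorem continuous_invCoeff (φ η : 𝓢(ℝ, ℂ)) : Continuous (invCoeff φ η) := by
  have h : Continuous fun z : ℝ × ℝ ↦ crossShift φ η z.1 (-z.2) := by
    simp only [crossShift_eq]
    exact (φ : 𝓢'(ℝ, ℂ)).continuous.comp (continuous_schwartzShift_neg η)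
  exact Complex.continuous_conj.comp h

theorem integrable_rho_prod : Integrable fun z : ℝ × ℝ ↦ rho 2 z.1 * rho 2 z.2 :=
  (integrable_rho (r := 2) (by norm_num)).mul_prod (integrable_rho (r := 2) (by norm_num))

theorem integrable_invCoeff_smul_jetComponent (φ η : 𝓢(ℝ, ℂ)) (k l : ℕ) :
    Integrable fun z : ℝ × ℝ ↦
      invCoeff φ η z • jetComponent k l (schwartzShift z.1 (-z.2) η) := by
  obtain ⟨C, hC, hCb⟩ := exists_seminorm_schwartzShift_le k l η
  -- Decay of order k + l + 2 in both variables absorbs the growth (1+|x|)^k (1+|w|)^l and leaves an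
  -- integrable weight of order two.
  obtain ⟨D, hD, hDb⟩ := exists_norm_crossShift_le (k + l + 2) φ η
  refine Integrable.mono' (integrable_rho_prod.const_mul (C * D)) ?_
    (Eventually.of_forall fun z ↦ ?_)
  · have h1 := continuous_schwartzShift_neg η
    have h2 : Continuous (jetComponent k l) := (jetComponent k l).continuous
    exact ((continuous_invCoeff φ η).smul (h2.comp h1)).aestronglyMeasurable
  · obtain ⟨x, w⟩ := z
    rw [norm_smul, norm_jetComponent, invCoeff, RCLike.norm_conj]
    have h1 := hCb x (-w)
    have h2 := hDb x (-w)
    rw [abs_neg] at h1 h2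
    simp only
    rw [rho_two, rho_two]
    have hx : 1 ≤ 1 + |x| := by linarith [abs_nonneg x]
    have hw : 1 ≤ 1 + |w| := by linarith [abs_nonneg w]
    have h3 : (1 + |x|) ^ k * (1 + |w|) ^ l * ((1 + |x|) ^ 2 * (1 + |w|) ^ 2) ≤
        (1 + |x|) ^ (k + l + 2) * (1 + |w|) ^ (k + l + 2) := by
      calc _ = (1 + |x|) ^ (k + 2) * (1 + |w|) ^ (l + 2) := by ring
        _ ≤ _ := by
          gcongr <;> lia
    set N := ‖crossShift φ η x (-w)‖
    rw [← mul_inv, ← div_eq_mul_inv, le_div_iff₀ (by positivity)]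
    calc N * SchwartzMap.seminorm ℂ k l (schwartzShift x (-w) η) *
          ((1 + |x|) ^ 2 * (1 + |w|) ^ 2)
        ≤ N * (C * ((1 + |x|) ^ k * (1 + |w|) ^ l)) * ((1 + |x|) ^ 2 * (1 + |w|) ^ 2) := by
          gcongr
      _ = C * (((1 + |x|) ^ k * (1 + |w|) ^ l * ((1 + |x|) ^ 2 * (1 + |w|) ^ 2)) * N) := by ring
      _ ≤ C * (((1 + |x|) ^ (k + l + 2) * (1 + |w|) ^ (k + l + 2)) * N) := by gcongr
      _ ≤ C * D := by gcongr

theorem integrable_invCoeff_mul_deriv (φ η : 𝓢(ℝ, ℂ)) (l : ℕ) (t : ℝ) :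
    Integrable fun z : ℝ × ℝ ↦
      invCoeff φ η z * ((SchwartzMap.derivCLM ℂ ℂ) ^ l) (schwartzShift z.1 (-z.2) η) t := by
  have h := (BoundedContinuousFunction.evalCLM ℂ t).integrable_comp
    (integrable_invCoeff_smul_jetComponent φ η 0 l)
  refine h.congr (Eventually.of_forall fun z ↦ ?_)
  simp [jetComponent_apply]

theorem conj_char (ξ t : ℝ) : conj (char ξ t) = char (-ξ) t := by
  unfold char
  rw [← Complex.exp_conj]
  simp [Complex.conj_ofNat]

theorem integral_fourier_mul_char (u : 𝓢(ℝ, ℂ)) (t : ℝ) :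
    ∫ w, (∫ s, u s * char (-w) s) * char w t = u t := by
  have h := congrArg (fun v : 𝓢(ℝ, ℂ) ↦ v t) (FourierTransform.fourierInv_fourier_eq (F := 𝓢(ℝ, ℂ)) u)
  rw [SchwartzMap.fourierInv_coe, Real.fourierInv_eq'] at h
  rw [← h]
  congr 1
  funext w
  rw [SchwartzMap.fourier_coe, Real.fourier_eq', smul_eq_mul, mul_comm]
  congr 1
  · rw [char]; congr 1; simp; ring
  · congr 1
    funext s
    rw [smul_eq_mul, mul_comm, char]
    congr 2
    simp; ring

/-- For fixed x the integral over w is the conjugate of Fourier inversion for φ · η(· - x) at t,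
times η(t - x). Integrating |η(t - x)|² over x then produces ‖η‖². -/
theorem integral_invCoeff_mul (φ η : 𝓢(ℝ, ℂ)) (t : ℝ) :
    ∫ z : ℝ × ℝ, invCoeff φ η z * schwartzShift z.1 (-z.2) η t =
      ((∫ s, ‖η s‖ ^ 2 : ℝ) : ℂ) * schwartzConj φ t := by
  have hint : Integrable fun z : ℝ × ℝ ↦ invCoeff φ η z * schwartzShift z.1 (-z.2) η t := by
    simpa using integrable_invCoeff_mul_deriv φ η 0 t
  rw [Measure.volume_eq_prod] at hint ⊢
  rw [integral_prod _ hint]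
  have h1 : ∀ x, ∫ w, invCoeff φ η (x, w) * schwartzShift x (-w) η t =
      schwartzConj φ t * ((‖η (t - x)‖ ^ 2 : ℝ) : ℂ) := by
    intro x
    set u : 𝓢(ℝ, ℂ) := SchwartzMap.smulLeftCLM ℂ φ (SchwartzMap.compSubConstCLM ℂ x η)
    have hu : ∀ s, u s = φ s * η (s - x) := by
      intro s
      simp [u, SchwartzMap.smulLeftCLM_apply_apply φ.hasTemperateGrowth]
    have h2 := congrArg conj (integral_fourier_mul_char u t)
    rw [← integral_conj] at h2
    have h3 : ∀ w, invCoeff φ η (x, w) * schwartzShift x (-w) η t =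
        conj ((∫ s, u s * char (-w) s) * char w t) * η (t - x) := by
      intro w
      rw [invCoeff, crossShift, schwartzShift_apply, map_mul, conj_char]
      have : ∀ s, φ s * schwartzShift x (-w) η s = u s * char (-w) s := by
        intro s; rw [hu, schwartzShift_apply]; ring
      simp only [this]
      ring
    simp only [h3]
    rw [integral_mul_const, h2, hu, map_mul, schwartzConj_apply]
    rw [mul_assoc, mul_comm (conj (η (t - x))), Complex.mul_conj, Complex.normSq_eq_norm_sq]
  simp only [h1]
  rw [integral_const_mul, integral_complex_ofReal, integral_sub_left_eq_self (fun s ↦ ‖η s‖ ^ 2)]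
  ring

/-- Differentiation in t under the integral sign, dominated by the sup norms of the next jets.
Uniqueness of derivatives carries the identity from order l to l + 1. -/
theorem integral_invCoeff_mul_deriv (φ η : 𝓢(ℝ, ℂ)) (l : ℕ) (t : ℝ) :
    ∫ z : ℝ × ℝ, invCoeff φ η z *
        ((SchwartzMap.derivCLM ℂ ℂ) ^ l) (schwartzShift z.1 (-z.2) η) t =
      ((∫ s, ‖η s‖ ^ 2 : ℝ) : ℂ) * ((SchwartzMap.derivCLM ℂ ℂ) ^ l) (schwartzConj φ) t := by
  induction l generalizing t with
  | zero => simpa using integral_invCoeff_mul φ η t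
  | succ l ih =>
    have hd : ∀ (χ : 𝓢(ℝ, ℂ)) (t : ℝ), HasDerivAt (((SchwartzMap.derivCLM ℂ ℂ) ^ l) χ)
        (((SchwartzMap.derivCLM ℂ ℂ) ^ (l + 1)) χ t) t := by
      intro χ t
      rw [pow_succ']
      exact (((SchwartzMap.derivCLM ℂ ℂ) ^ l) χ).hasDerivAt t
    have h := hasDerivAt_integral_of_dominated_loc_of_deriv_le (μ := (volume : Measure (ℝ × ℝ)))
      (F := fun t z ↦ invCoeff φ η z *
        ((SchwartzMap.derivCLM ℂ ℂ) ^ l) (schwartzShift z.1 (-z.2) η) t)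
      (F' := fun t z ↦ invCoeff φ η z *
        ((SchwartzMap.derivCLM ℂ ℂ) ^ (l + 1)) (schwartzShift z.1 (-z.2) η) t)
      (x₀ := t) (s := univ)
      (bound := fun z ↦ ‖invCoeff φ η z • jetComponent 0 (l + 1) (schwartzShift z.1 (-z.2) η)‖)
      univ_mem
      (Eventually.of_forall fun t ↦ (integrable_invCoeff_mul_deriv φ η l t).aestronglyMeasurable)
      (integrable_invCoeff_mul_deriv φ η l t)
      (integrable_invCoeff_mul_deriv φ η (l + 1) t).aestronglyMeasurable
      (Eventually.of_forall fun z t _ ↦ by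
        rw [norm_mul, norm_smul]
        gcongr
        have := BoundedContinuousFunction.norm_coe_le_norm
          (jetComponent 0 (l + 1) (schwartzShift z.1 (-z.2) η)) t
        rwa [jetComponent_apply, pow_zero, one_mul] at this)
      (integrable_invCoeff_smul_jetComponent φ η 0 (l + 1)).norm
      (Eventually.of_forall fun z t _ ↦ (hd _ t).const_mul _)
    have h2 := (hd (schwartzConj φ) t).const_mul ((∫ s, ‖η s‖ ^ 2 : ℝ) : ℂ)
    have h3 := h.2
    simp only [ih] at h3
    exact h3.unique h2

theorem integral_boundedContinuousFunction_apply {X : Type*} [MeasurableSpace X] {μ : Measure X}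
    {F : X → BoundedContinuousFunction ℝ ℂ} (hF : Integrable F μ) (t : ℝ) :
    (∫ x, F x ∂μ) t = ∫ x, F x t ∂μ :=
  ((BoundedContinuousFunction.evalCLM ℂ t).integral_comp_comm hF).symm

theorem integral_invCoeff_smul_jetComponent (φ η : 𝓢(ℝ, ℂ)) (k l : ℕ) :
    ∫ z : ℝ × ℝ, invCoeff φ η z • jetComponent k l (schwartzShift z.1 (-z.2) η) =
      ((∫ s, ‖η s‖ ^ 2 : ℝ) : ℂ) • jetComponent k l (schwartzConj φ) := by
  ext t
  rw [integral_boundedContinuousFunction_apply (integrable_invCoeff_smul_jetComponent φ η k l)]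
  simp only [BoundedContinuousFunction.coe_smul, jetComponent_apply, smul_eq_mul]
  simp_rw [mul_left_comm (invCoeff φ η _)]
  rw [integral_const_mul, integral_invCoeff_mul_deriv]
  ring

theorem integral_invCoeff_smul_jet (φ η : 𝓢(ℝ, ℂ)) (s : Finset (ℕ × ℕ)) :
    Integrable (fun z : ℝ × ℝ ↦ invCoeff φ η z • jet s (schwartzShift z.1 (-z.2) η)) ∧
    ∫ z : ℝ × ℝ, invCoeff φ η z • jet s (schwartzShift z.1 (-z.2) η) =
      ((∫ s, ‖η s‖ ^ 2 : ℝ) : ℂ) • jet s (schwartzConj φ) := by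
  have h : ∀ i : s, Integrable fun z : ℝ × ℝ ↦
      (invCoeff φ η z • jet s (schwartzShift z.1 (-z.2) η)) i :=
    fun i ↦ integrable_invCoeff_smul_jetComponent φ η i.1.1 i.1.2
  refine ⟨Integrable.of_eval h, funext fun i ↦ ?_⟩
  rw [eval_integral h]
  exact integral_invCoeff_smul_jetComponent φ η i.1.1 i.1.2

/-- The inversion formula `f = ‖η‖⁻² ∬ ⟨f, M_w T_x η⟩ M_w T_x η`, tested on a Schwartz function. -/
theorem integral_apply_schwartzShift (f : 𝓢'(ℝ, ℂ)) (φ η : 𝓢(ℝ, ℂ)) :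
    ∫ z : ℝ × ℝ, f (schwartzShift z.1 (-z.2) η) * invCoeff φ η z =
      ((∫ s, ‖η s‖ ^ 2 : ℝ) : ℂ) * f (schwartzConj φ) := by
  -- The inversion integral is taken in the Banach space of jets, since the Schwartz space is not
  -- normed; the bounded functional `Λ` then passes through it.
  obtain ⟨s, Λ, hΛ⟩ := exists_eq_comp_jet f
  obtain ⟨hint, heq⟩ := integral_invCoeff_smul_jet φ η s
  have h1 : ∀ z : ℝ × ℝ, f (schwartzShift z.1 (-z.2) η) * invCoeff φ η z =
      Λ (invCoeff φ η z • jet s (schwartzShift z.1 (-z.2) η)) := by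
    intro z
    rw [map_smul, ← hΛ, smul_eq_mul, mul_comm]
  simp only [h1]
  rw [Λ.integral_comp_comm hint, heq, map_smul, ← hΛ, smul_eq_mul]

end GaborMod
end

noncomputable section
namespace GaborMod

/-! ### Frame operators -/

/-- If a bounded operator `B` has the quadratic form `∑ |⟨e i, u⟩|²`, then it is the frame operator
of `(e i)`. -/
theorem hasSum_inner_smul {H ι : Type*} [NormedAddCommGroup H] [InnerProductSpace ℂ H]
    [CompleteSpace H] (e : ι → H) (B : H →L[ℂ] H)
    (hs : ∀ u, Summable fun i ↦ ‖inner ℂ (e i) u‖ ^ 2)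
    (hB : ∀ u, inner ℂ (B u) u = ((∑' i, ‖inner ℂ (e i) u‖ ^ 2 : ℝ) : ℂ)) (u : H) :
    HasSum (fun i ↦ (inner ℂ (e i) u : ℂ) • e i) (B u) := by
  classical
  have hmem : ∀ u, Memℓp (fun i ↦ (inner ℂ (e i) u : ℂ)) 2 := fun u ↦
    memℓp_gen (by simpa using hs u)
  let L : H →ₗ[ℂ] lp (fun _ : ι ↦ ℂ) 2 :=
    { toFun := fun u ↦ ⟨fun i ↦ inner ℂ (e i) u, hmem u⟩
      map_add' := fun u v ↦ by ext i; exact inner_add_right _ _ _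
      map_smul' := fun c u ↦ by ext i; exact inner_smul_right _ _ _ }
  have hLi : ∀ u i, L u i = inner ℂ (e i) u := fun u i ↦ rfl
  have hnorm : ∀ u, ‖L u‖ ^ 2 = ∑' i, ‖inner ℂ (e i) u‖ ^ 2 := fun u ↦ by
    have := lp.norm_rpow_eq_tsum (p := 2) (by simp) (L u)
    simpa [hLi] using this
  have hbd : ∀ u, ‖L u‖ ≤ √‖B‖ * ‖u‖ := fun u ↦ by
    rw [← Real.sqrt_sq (norm_nonneg u), ← Real.sqrt_mul (norm_nonneg B)]
    refine Real.le_sqrt_of_sq_le ?_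
    have h1 : ‖L u‖ ^ 2 = ‖inner ℂ (B u) u‖ := by
      rw [hB u, ← hnorm u, Complex.norm_real, Real.norm_of_nonneg (by positivity)]
    calc ‖L u‖ ^ 2 = ‖inner ℂ (B u) u‖ := h1
      _ ≤ ‖B u‖ * ‖u‖ := norm_inner_le_norm _ _
      _ ≤ ‖B‖ * ‖u‖ * ‖u‖ := by gcongr; exact B.le_opNorm u
      _ = _ := by ring
  let C : H →L[ℂ] lp (fun _ : ι ↦ ℂ) 2 := L.mkContinuous _ hbd
  -- On a complex Hilbert space an operator is determined by its quadratic form. Hence `B` is C*C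
  -- for the analysis operator C, and the claimed series is C* applied to the coordinate expansion
  -- of C u.
  have hCB : (C.adjoint ∘L C : H →L[ℂ] H) = B := by
    have := (ext_inner_map ((C.adjoint ∘L C : H →L[ℂ] H) : H →ₗ[ℂ] H) (B : H →ₗ[ℂ] H)).1
      fun x ↦ by
        have h1 : inner ℂ (C.adjoint (C x)) x = inner ℂ (C x) (C x) :=
          ContinuousLinearMap.adjoint_inner_left C x (C x)
        have h2 : ‖C x‖ ^ 2 = ∑' i, ‖inner ℂ (e i) x‖ ^ 2 := hnorm x
        change inner ℂ (C.adjoint (C x)) x = inner ℂ (B x) x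
        rw [h1, hB x, inner_self_eq_norm_sq_to_K, ← h2]
        norm_cast
    exact ContinuousLinearMap.coe_injective this
  have hsingle : ∀ i (c : ℂ), C.adjoint (lp.single 2 i c) = c • e i := fun i c ↦ by
    refine ext_inner_right ℂ fun v ↦ ?_
    rw [ContinuousLinearMap.adjoint_inner_left, lp.inner_single_left, inner_smul_left]
    change inner ℂ c (inner ℂ (e i) v) = _
    simp [mul_comm]
  have h := (lp.hasSum_single (p := 2) (by simp) (C u)).mapL C.adjoint
  simp only [hsingle] at h
  rw [← hCB]
  exact h

/-! ### Multiplication operators on `L²` -/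

theorem exists_mulL (m : ℝ → ℂ) (hm : Measurable m) (C : ℝ) (hC : ∀ t, ‖m t‖ ≤ C) :
    ∃ T : L2 →L[ℂ] L2, ∀ u, T u =ᵐ[volume] fun t ↦ m t * u t := by
  have hmem : ∀ u : L2, MemLp (fun t ↦ m t * u t) 2 volume := fun u ↦ by
    refine (Lp.memLp u).of_le_mul (c := C)
      (hm.aestronglyMeasurable.mul (Lp.aestronglyMeasurable u)) (Eventually.of_forall fun t ↦ ?_)
    rw [norm_mul]; gcongr; exact hC t
  let L : L2 →ₗ[ℂ] L2 :=
    { toFun := fun u ↦ (hmem u).toLp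
      map_add' := fun u v ↦ by
        refine Lp.ext ?_
        filter_upwards [(hmem (u + v)).coeFn_toLp, (hmem u).coeFn_toLp, (hmem v).coeFn_toLp,
          Lp.coeFn_add u v, Lp.coeFn_add (hmem u).toLp (hmem v).toLp] with t h1 h2 h3 h4 h5
        rw [h1, h5, Pi.add_apply, h2, h3, h4, Pi.add_apply, mul_add]
      map_smul' := fun c u ↦ by
        refine Lp.ext ?_
        filter_upwards [(hmem (c • u)).coeFn_toLp, (hmem u).coeFn_toLp,
          Lp.coeFn_smul c u, Lp.coeFn_smul c (hmem u).toLp] with t h1 h2 h4 h5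
        rw [h1, RingHom.id_apply, h5, Pi.smul_apply, h2, h4, Pi.smul_apply, smul_eq_mul,
          smul_eq_mul]
        ring }
  have hL : ∀ u, L u =ᵐ[volume] fun t ↦ m t * u t := fun u ↦ (hmem u).coeFn_toLp
  refine ⟨L.mkContinuous C fun u ↦ ?_, hL⟩
  refine Lp.norm_le_mul_norm_of_ae_le_mul ?_
  filter_upwards [hL u] with t ht
  rw [ht, norm_mul]; gcongr; exact hC t

theorem coeFn_shift (x ξ : ℝ) (h : L2) :
    shift x ξ h =ᵐ[volume] fun t ↦ char ξ t * h (t - x) := (memLp_shift x ξ h).coeFn_toLp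

theorem ae_comp_sub {P : ℝ → Prop} (h : ∀ᵐ t : ℝ, P t) (x : ℝ) : ∀ᵐ t : ℝ, P (t - x) :=
  (measurePreserving_sub_right volume x).quasiMeasurePreserving.ae h

theorem coeFn_shift_congr {h : L2} {h₀ : ℝ → ℂ} (hh : h =ᵐ[volume] h₀) (x ξ : ℝ) :
    shift x ξ h =ᵐ[volume] fun t ↦ char ξ t * h₀ (t - x) := by
  filter_upwards [coeFn_shift x ξ h, ae_comp_sub hh x] with t h1 h2
  rw [h1, h2]

theorem shift_zero_zero (h : L2) : shift 0 0 h = h := by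
  refine Lp.ext ?_
  filter_upwards [coeFn_shift 0 0 h] with t ht
  rw [ht]; simp [char]

end GaborMod
end

noncomputable section
namespace GaborMod

/-! ### Windows with short support -/

/-- A bounded measurable function that is bounded below on `[a,b]` and vanishes elsewhere. -/
structure IsWindow (h : ℝ → ℂ) (a b δ C : ℝ) : Prop where
  measurable : Measurable h
  zero_off : ∀ t, t ∉ Icc a b → h t = 0
  lower : ∀ t ∈ Icc a b, δ ≤ ‖h t‖
  upper : ∀ t, ‖h t‖ ≤ C

/-- Parseval's identity on an interval of length `β⁻¹`. -/
theorem tsum_enorm_integral_char {β c : ℝ} (hβ : 0 < β) (F : ℝ → ℂ) (hF : MemLp F 2 volume)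
    (hF0 : ∀ t, t ∉ Ioc c (c + β⁻¹) → F t = 0) :
    ∑' n : ℤ, ‖∫ t, char (-(β * n)) t * F t‖ₑ ^ 2 = ENNReal.ofReal β⁻¹ * ∫⁻ t, ‖F t‖ₑ ^ 2 := by
  have hlt : c < c + β⁻¹ := by have := inv_pos.2 hβ; linarith
  have hlen : c + β⁻¹ - c = β⁻¹ := by ring
  have hint : ∀ G : ℝ → ℂ, (∀ t, t ∉ Ioc c (c + β⁻¹) → G t = 0) →
      ∫ t in c..(c + β⁻¹), G t = ∫ t, G t := fun G hG ↦ by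
    rw [intervalIntegral.integral_of_le hlt.le]
    exact setIntegral_eq_integral_of_forall_compl_eq_zero hG
  have hcoef : ∀ n : ℤ, fourierCoeffOn hlt F n = (β : ℂ) * ∫ t, char (-(β * n)) t * F t := by
    intro n
    rw [fourierCoeffOn_eq_integral, hlen, ← hint (fun t ↦ char (-(β * n)) t * F t)
      (fun t ht ↦ by rw [hF0 t ht, mul_zero])]
    have : ((1 / β⁻¹ : ℝ)) = β := by simp
    rw [this, Complex.real_smul]
    congr 1
    refine intervalIntegral.integral_congr fun t _ ↦ ?_
    simp only [smul_eq_mul]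
    congr 1
    rw [fourier_coe_apply, char]
    congr 1
    push_cast
    have : (β : ℂ) ≠ 0 := by exact_mod_cast hβ.ne'
    field_simp
  have hP := hasSum_sq_fourierCoeffOn hlt (hF.mono_measure Measure.restrict_le_self)
  have hsq : ∫ t in c..(c + β⁻¹), ‖F t‖ ^ 2 = ∫ t, ‖F t‖ ^ 2 := by
    rw [intervalIntegral.integral_of_le hlt.le]
    exact setIntegral_eq_integral_of_forall_compl_eq_zero fun t ht ↦ by rw [hF0 t ht]; simp
  rw [hsq, hlen, inv_inv] at hP
  have hFint : Integrable (fun t ↦ ‖F t‖ ^ 2) := (memLp_two_iff_integrable_sq_norm hF.1).1 hF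
  have h1 : ∑' n : ℤ, ENNReal.ofReal (‖fourierCoeffOn hlt F n‖ ^ 2) =
      ENNReal.ofReal (β • ∫ t, ‖F t‖ ^ 2) := by
    rw [← ENNReal.ofReal_tsum_of_nonneg (fun n ↦ by positivity) hP.summable, hP.tsum_eq]
  have h2 : ENNReal.ofReal (∫ t, ‖F t‖ ^ 2) = ∫⁻ t, ‖F t‖ₑ ^ 2 := by
    rw [ofReal_integral_eq_lintegral_ofReal hFint (Eventually.of_forall fun t ↦ by positivity)]
    refine lintegral_congr fun t ↦ ?_
    rw [ENNReal.ofReal_pow (norm_nonneg _), ofReal_norm]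
  have h3 : ∀ n : ℤ, ENNReal.ofReal (‖fourierCoeffOn hlt F n‖ ^ 2) =
      ENNReal.ofReal β ^ 2 * ‖∫ t, char (-(β * n)) t * F t‖ₑ ^ 2 := fun n ↦ by
    rw [hcoef, ENNReal.ofReal_pow (norm_nonneg _), ofReal_norm, enorm_mul, mul_pow]
    congr 2
    rw [← ofReal_norm, Complex.norm_real, Real.norm_of_nonneg hβ.le]
  have hb0 : ENNReal.ofReal β ≠ 0 := by simpa using hβ
  -- The squared coefficients carry β² and the mean square carries β, so one factor cancels and β⁻¹
  -- remains.
  simp only [h3, ENNReal.tsum_mul_left, smul_eq_mul, ENNReal.ofReal_mul hβ.le, h2] at h1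
  rw [pow_two, mul_assoc] at h1
  have h4 := (ENNReal.mul_right_inj hb0 ENNReal.ofReal_ne_top).1 h1
  rw [← h4, ← mul_assoc, ← ENNReal.ofReal_mul (by positivity), inv_mul_cancel₀ hβ.ne']
  simp

/-- The multiplier `G(t) = β⁻¹ ∑ |h(t - αk)|²` of the frame operator, with values in `[0, ∞]`. -/
def frameMultiplier (h : ℝ → ℂ) (α β : ℝ) (t : ℝ) : ℝ≥0∞ :=
  ENNReal.ofReal β⁻¹ * ∑' k : ℤ, ‖h (t - α * k)‖ₑ ^ 2

/-- Periodicity makes multiplication by G⁻¹ commute with the shifts of the system, so its canonical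
dual is again a Gabor system. -/
theorem frameMultiplier_periodic (h : ℝ → ℂ) (α β t : ℝ) (k : ℤ) :
    frameMultiplier h α β (t - α * k) = frameMultiplier h α β t := by
  unfold frameMultiplier
  congr 1
  rw [← (Equiv.addLeft k).tsum_eq (fun j : ℤ ↦ ‖h (t - α * j)‖ₑ ^ 2)]
  refine tsum_congr fun j ↦ ?_
  simp only [Equiv.coe_addLeft]
  congr 3
  push_cast; ring

namespace IsWindow

variable {h : ℝ → ℂ} {a b δ C α β : ℝ}

theorem measurable_frameMultiplier (hh : IsWindow h a b δ C) :
    Measurable (frameMultiplier h α β) := by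
  unfold frameMultiplier
  refine (Measurable.tsum fun k ↦ ?_).const_mul _
  exact ((hh.measurable.comp (by fun_prop)).enorm).pow_const 2

theorem ofReal_le_frameMultiplier (hh : IsWindow h a b δ C) (hα : 0 < α) (hαab : α ≤ b - a)
    (hβ : 0 < β) (hδ : 0 < δ) (t : ℝ) :
    ENNReal.ofReal (β⁻¹ * δ ^ 2) ≤ frameMultiplier h α β t := by
  unfold frameMultiplier
  rw [ENNReal.ofReal_mul (by positivity)]
  gcongr
  -- One translate suffices: with k the floor of (t - a)/α, t - αk lies in [a, a + α), and this is
  -- inside [a, b] because α ≤ b - a.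
  refine le_trans ?_ (ENNReal.le_tsum (⌊(t - a) / α⌋ : ℤ))
  rw [ENNReal.ofReal_pow hδ.le, ← ofReal_norm]
  gcongr
  apply hh.lower
  have h1 := Int.floor_le ((t - a) / α)
  have h2 := Int.lt_floor_add_one ((t - a) / α)
  rw [le_div_iff₀ hα] at h1
  rw [div_lt_iff₀ hα] at h2
  constructor <;> nlinarith

theorem frameMultiplier_le (hh : IsWindow h a b δ C) (hα : 0 < α) (hβ : 0 < β) (t : ℝ) :
    frameMultiplier h α β t ≤ ENNReal.ofReal (β⁻¹ * (((b - a) / α + 1) * C ^ 2)) := by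
  unfold frameMultiplier
  rw [ENNReal.ofReal_mul (by positivity)]
  gcongr
  have hC : 0 ≤ C := (norm_nonneg _).trans (hh.upper 0)
  by_cases hab : a ≤ b
  swap
  · have : ∀ k : ℤ, ‖h (t - α * k)‖ₑ ^ 2 = 0 := fun k ↦ by
      rw [hh.zero_off _ (by simp [Icc_eq_empty hab])]; simp
    simp [this]
  -- Only k with t - αk in [a, b] contribute. These lie between (t - b)/α and (t - a)/α, so there
  -- are at most (b - a)/α + 1 of them.
  rw [tsum_eq_sum (s := Finset.Icc ⌈(t - b) / α⌉ ⌊(t - a) / α⌋)]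
  · calc ∑ k ∈ Finset.Icc ⌈(t - b) / α⌉ ⌊(t - a) / α⌋, ‖h (t - α * k)‖ₑ ^ 2
        ≤ ∑ k ∈ Finset.Icc ⌈(t - b) / α⌉ ⌊(t - a) / α⌋, ENNReal.ofReal (C ^ 2) := by
          gcongr with k
          rw [ENNReal.ofReal_pow hC, ← ofReal_norm]
          gcongr
          exact hh.upper _
      _ = ENNReal.ofReal ((Finset.Icc ⌈(t - b) / α⌉ ⌊(t - a) / α⌋).card * C ^ 2) := by
          rw [Finset.sum_const, nsmul_eq_mul, ENNReal.ofReal_mul (by positivity)]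
          simp
      _ ≤ _ := by
          gcongr
          rw [Int.card_Icc]
          have h1 := Int.floor_le ((t - a) / α)
          have h2 := Int.le_ceil ((t - b) / α)
          have h3 : (b - a) / α = (t - a) / α - (t - b) / α := by ring
          have h4 : 0 ≤ (b - a) / α := div_nonneg (by linarith) hα.le
          have h5 : ((⌊(t - a) / α⌋ + 1 - ⌈(t - b) / α⌉ : ℤ).toNat : ℝ) =
              ((max (⌊(t - a) / α⌋ + 1 - ⌈(t - b) / α⌉) 0 : ℤ) : ℝ) := by
            rw [← Int.toNat_eq_max]; norm_cast
          rw [h5]; push_cast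
          refine max_le ?_ ?_ <;> linarith
  · intro k hk
    rw [hh.zero_off]
    · simp
    · contrapose! hk
      rw [Finset.mem_Icc, Int.ceil_le, Int.le_floor, div_le_iff₀ hα, le_div_iff₀ hα]
      constructor <;> nlinarith [hk.1, hk.2]

/-- The quadratic form of the frame operator. -/
theorem tsum_enorm_inner (hh : IsWindow h a b δ C) (hβ : 0 < β) (hab : b - a ≤ β⁻¹) {e : L2}
    (he : e =ᵐ[volume] h) (u : L2) :
    ∑' i, ‖inner ℂ (gaborSystem e α β i) u‖ₑ ^ 2 =
      ∫⁻ t, frameMultiplier h α β t * ‖u t‖ₑ ^ 2 := by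
  have hu : Measurable fun t ↦ u t := (Lp.stronglyMeasurable u).measurable
  have hhm : ∀ k : ℤ, Measurable fun t ↦ h (t - α * k) := fun k ↦
    hh.measurable.comp (by fun_prop)
  have key : ∀ k : ℤ, ∑' n : ℤ, ‖inner ℂ (shift (α * k) (β * n) e) u‖ₑ ^ 2 =
      ENNReal.ofReal β⁻¹ * ∫⁻ t, ‖h (t - α * k)‖ₑ ^ 2 * ‖u t‖ₑ ^ 2 := by
    intro k
    set F : ℝ → ℂ := fun t ↦ conj (h (t - α * k)) * u t with hF
    -- An interval of the full length 1/β containing the support of the shifted window up to one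
    -- point; the half-open form is the one used in Parseval's identity.
    set I : Set ℝ := Ioc (a + α * k) (a + α * k + β⁻¹) with hI
    have hFI : indicator I F =ᵐ[volume] F := by
      have hne : ∀ᵐ t : ℝ, t ≠ a + α * k := by
        simp [ae_iff]
      filter_upwards [hne] with t ht
      by_cases htI : t ∈ I
      · simp [htI]
      · rw [indicator_of_notMem htI, hF]
        simp only
        rw [hh.zero_off]
        · simp
        · intro h2
          exact htI ⟨lt_of_le_of_ne (by linarith [h2.1]) ht.symm, by linarith [h2.2]⟩
    have hFm : Measurable F := (Complex.continuous_conj.measurable.comp (hhm k)).mul hu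
    have hFmem : MemLp F 2 volume := by
      refine (Lp.memLp u).of_le_mul (c := C) hFm.aestronglyMeasurable
        (Eventually.of_forall fun t ↦ ?_)
      rw [hF, norm_mul, RCLike.norm_conj]; gcongr; exact hh.upper _
    have hP := tsum_enorm_integral_char hβ (indicator I F)
      (hFmem.indicator measurableSet_Ioc) (fun t ht ↦ indicator_of_notMem ht _)
    have h1 : ∀ n : ℤ, inner ℂ (shift (α * k) (β * n) e) u =
        ∫ t, char (-(β * n)) t * indicator I F t := fun n ↦ by
      rw [L2.inner_def]
      refine integral_congr_ae ?_
      filter_upwards [coeFn_shift_congr he (α * k) (β * n), hFI] with t h2 h3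
      rw [h2, h3, hF]
      simp only [RCLike.inner_apply, map_mul, conj_char]
      ring
    simp only [h1]
    rw [hP]
    congr 1
    refine lintegral_congr_ae ?_
    filter_upwards [hFI] with t h3
    rw [h3, hF]
    simp only [enorm_mul, mul_pow, RCLike.enorm_conj]
  have h4 : ∀ t, frameMultiplier h α β t * ‖u t‖ₑ ^ 2 =
      ∑' k : ℤ, ENNReal.ofReal β⁻¹ * (‖h (t - α * k)‖ₑ ^ 2 * ‖u t‖ₑ ^ 2) := fun t ↦ by
    rw [ENNReal.tsum_mul_left, ENNReal.tsum_mul_right, frameMultiplier, mul_assoc]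
  simp only [h4]
  have hm : ∀ k : ℤ, Measurable fun t ↦ ‖h (t - α * k)‖ₑ ^ 2 * ‖u t‖ₑ ^ 2 := fun k ↦
    ((hhm k).enorm.pow_const 2).mul (hu.enorm.pow_const 2)
  rw [lintegral_tsum fun k ↦ ((hm k).const_mul _).aemeasurable, ENNReal.tsum_prod']
  refine tsum_congr fun k ↦ ?_
  rw [lintegral_const_mul _ (hm k)]
  exact key k

/-- The operator of multiplication by the frame multiplier and its inverse. -/
theorem exists_frameOperator (hh : IsWindow h a b δ C) (hα : 0 < α) (hαab : α ≤ b - a)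
    (hβ : 0 < β) (hδ : 0 < δ) : ∃ S R : L2 →L[ℂ] L2,
    (∀ u, S u =ᵐ[volume] fun t ↦ ((frameMultiplier h α β t).toReal : ℂ) * u t) ∧
    (∀ u, R u =ᵐ[volume] fun t ↦ ((frameMultiplier h α β t).toReal : ℂ)⁻¹ * u t) ∧
    (∀ u, S (R u) = u) ∧ ∀ u, R (S u) = u := by
  have hm : Measurable fun t ↦ ((frameMultiplier h α β t).toReal : ℂ) :=
    Complex.measurable_ofReal.comp hh.measurable_frameMultiplier.ennreal_toReal
  have hlow : ∀ t, β⁻¹ * δ ^ 2 ≤ (frameMultiplier h α β t).toReal := fun t ↦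
    (ENNReal.ofReal_le_iff_le_toReal (ne_top_of_le_ne_top ENNReal.ofReal_ne_top
      (hh.frameMultiplier_le hα hβ t))).1 (hh.ofReal_le_frameMultiplier hα hαab hβ hδ t)
  have hpos : 0 < β⁻¹ * δ ^ 2 := by positivity
  have hne : ∀ t, ((frameMultiplier h α β t).toReal : ℂ) ≠ 0 := fun t ↦ by
    exact_mod_cast (hpos.trans_le (hlow t)).ne'
  have hup : 0 ≤ β⁻¹ * (((b - a) / α + 1) * C ^ 2) := by
    have : 0 ≤ b - a := hα.le.trans hαab
    positivity
  obtain ⟨S, hS⟩ := exists_mulL _ hm (β⁻¹ * (((b - a) / α + 1) * C ^ 2)) fun t ↦ by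
    rw [Complex.norm_real, Real.norm_of_nonneg ENNReal.toReal_nonneg]
    exact ENNReal.toReal_le_of_le_ofReal hup (hh.frameMultiplier_le hα hβ t)
  obtain ⟨R, hR⟩ := exists_mulL _ hm.inv (β⁻¹ * δ ^ 2)⁻¹ fun t ↦ by
    rw [Pi.inv_apply, norm_inv, Complex.norm_real, Real.norm_of_nonneg ENNReal.toReal_nonneg]
    exact inv_anti₀ hpos (hlow t)
  refine ⟨S, R, hS, hR, fun u ↦ Lp.ext ?_, fun u ↦ Lp.ext ?_⟩
  · filter_upwards [hS (R u), hR u] with t h1 h2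
    rw [h1, h2, Pi.inv_apply, mul_inv_cancel_left₀ (hne t)]
  · filter_upwards [hR (S u), hS u] with t h1 h2
    rw [h1, h2, Pi.inv_apply, inv_mul_cancel_left₀ (hne t)]

theorem tsum_sq_inner (hh : IsWindow h a b δ C) (hα : 0 < α) (hβ : 0 < β)
    (hab : b - a ≤ β⁻¹) {e : L2} (he : e =ᵐ[volume] h) (u : L2) :
    Summable (fun i ↦ ‖inner ℂ (gaborSystem e α β i) u‖ ^ 2) ∧
    ∑' i, ‖inner ℂ (gaborSystem e α β i) u‖ ^ 2 =
      ∫ t, (frameMultiplier h α β t).toReal * ‖u t‖ ^ 2 ∧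
    Integrable fun t ↦ (frameMultiplier h α β t).toReal * ‖u t‖ ^ 2 := by
  have hu : Integrable fun t ↦ ‖u t‖ ^ 2 :=
    (memLp_two_iff_integrable_sq_norm (Lp.aestronglyMeasurable u)).1 (Lp.memLp u)
  have hint : Integrable fun t ↦ (frameMultiplier h α β t).toReal * ‖u t‖ ^ 2 := by
    refine hu.bdd_mul (c := (ENNReal.ofReal (β⁻¹ * (((b - a) / α + 1) * C ^ 2))).toReal)
      hh.measurable_frameMultiplier.ennreal_toReal.aestronglyMeasurable
      (Eventually.of_forall fun t ↦ ?_)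
    rw [Real.norm_of_nonneg ENNReal.toReal_nonneg]
    exact ENNReal.toReal_mono ENNReal.ofReal_ne_top (hh.frameMultiplier_le hα hβ t)
  have h1 : ∑' i, ENNReal.ofReal (‖inner ℂ (gaborSystem e α β i) u‖ ^ 2) =
      ENNReal.ofReal (∫ t, (frameMultiplier h α β t).toReal * ‖u t‖ ^ 2) := by
    rw [ofReal_integral_eq_lintegral_ofReal hint (Eventually.of_forall fun t ↦ by positivity)]
    simp only [ENNReal.ofReal_pow (norm_nonneg _), ofReal_norm]
    rw [hh.tsum_enorm_inner hβ hab he]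
    refine lintegral_congr fun t ↦ ?_
    rw [ENNReal.ofReal_mul ENNReal.toReal_nonneg, ENNReal.ofReal_toReal
      (ne_top_of_le_ne_top ENNReal.ofReal_ne_top (hh.frameMultiplier_le hα hβ t)),
      ENNReal.ofReal_pow (norm_nonneg _), ofReal_norm]
  have hs : Summable (fun i ↦ ‖inner ℂ (gaborSystem e α β i) u‖ ^ 2) := by
    have := ENNReal.summable_toReal (f := fun i ↦
      ENNReal.ofReal (‖inner ℂ (gaborSystem e α β i) u‖ ^ 2)) (by rw [h1]; simp)
    refine this.congr fun i ↦ ?_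
    rw [ENNReal.toReal_ofReal (by positivity)]
  refine ⟨hs, ?_, hint⟩
  rw [← ENNReal.ofReal_tsum_of_nonneg (fun i ↦ by positivity) hs] at h1
  exact (ENNReal.ofReal_eq_ofReal_iff (tsum_nonneg fun i ↦ by positivity)
    (integral_nonneg fun t ↦ by positivity)).1 h1

theorem isFrame (hh : IsWindow h a b δ C) (hα : 0 < α) (hαab : α ≤ b - a)
    (hβ : 0 < β) (hab : b - a ≤ β⁻¹) (hδ : 0 < δ) {e : L2} (he : e =ᵐ[volume] h) :
    IsFrame (gaborSystem e α β) := by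
  have hba : 0 < b - a := hα.trans_le hαab
  have hC : 0 < C := by
    have h1 := hh.lower a ⟨le_rfl, by linarith⟩
    linarith [hh.upper a]
  refine ⟨β⁻¹ * δ ^ 2, β⁻¹ * (((b - a) / α + 1) * C ^ 2), by positivity, by positivity,
    fun u ↦ ?_⟩
  obtain ⟨h1, h2, h3⟩ := hh.tsum_sq_inner hα hβ hab he u
  have hu : Integrable fun t ↦ ‖u t‖ ^ 2 :=
    (memLp_two_iff_integrable_sq_norm (Lp.aestronglyMeasurable u)).1 (Lp.memLp u)
  have hn : ‖u‖ ^ 2 = ∫ t, ‖u t‖ ^ 2 := by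
    have h4 := inner_self_eq_norm_sq_to_K (𝕜 := ℂ) u
    rw [L2.inner_def] at h4
    simp only [inner_self_eq_norm_sq_to_K] at h4
    have h5 : ∫ t, ((‖u t‖ : ℂ)) ^ 2 = ((∫ t, ‖u t‖ ^ 2 : ℝ) : ℂ) := by
      rw [← integral_complex_ofReal]; push_cast; rfl
    have h6 : (‖u‖ : ℂ) ^ 2 = ((∫ t, ‖u t‖ ^ 2 : ℝ) : ℂ) := h4.symm.trans h5
    exact_mod_cast h6
  refine ⟨h1, ?_, ?_⟩
  · rw [h2, hn, ← integral_const_mul]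
    refine integral_mono (hu.const_mul _) h3 fun t ↦ ?_
    simp only
    gcongr
    exact (ENNReal.ofReal_le_iff_le_toReal (ne_top_of_le_ne_top ENNReal.ofReal_ne_top
      (hh.frameMultiplier_le hα hβ t))).1 (hh.ofReal_le_frameMultiplier hα hαab hβ hδ t)
  · rw [h2, hn, ← integral_const_mul]
    refine integral_mono h3 (hu.const_mul _) fun t ↦ ?_
    simp only
    gcongr
    exact ENNReal.toReal_le_of_le_ofReal (by positivity) (hh.frameMultiplier_le hα hβ t)

/-- The atom of the canonical dual frame is `h / G`, and it gives the frame expansion. -/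
theorem exists_dual (hh : IsWindow h a b δ C) (hα : 0 < α) (hαab : α ≤ b - a)
    (hβ : 0 < β) (hab : b - a ≤ β⁻¹) (hδ : 0 < δ) {e : L2} (he : e =ᵐ[volume] h) :
    ∃ γ : L2, (γ =ᵐ[volume] fun t ↦ ((frameMultiplier h α β t).toReal : ℂ)⁻¹ * h t) ∧
      (∀ γ' : L2, IsCanonicalDual (gaborSystem e α β) (gaborSystem γ' α β) ↔ γ' = γ) ∧
      ∀ u v : L2, HasSum (fun j ↦ inner ℂ (gaborSystem e α β j) u *
        inner ℂ v (gaborSystem γ α β j)) (inner ℂ v u) := by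
  obtain ⟨S, R, hS, hR, hSR, hRS⟩ := hh.exists_frameOperator hα hαab hβ hδ
  have hsum := hasSum_inner_smul (gaborSystem e α β) S
    (fun u ↦ (hh.tsum_sq_inner hα hβ hab he u).1) fun u ↦ by
      rw [(hh.tsum_sq_inner hα hβ hab he u).2.1, L2.inner_def, ← integral_complex_ofReal]
      refine integral_congr_ae ?_
      filter_upwards [hS u] with t ht
      rw [ht]
      simp only [RCLike.inner_apply, map_mul, Complex.conj_ofReal]
      push_cast
      rw [mul_left_comm, Complex.mul_conj']
  have hRe : (R e) =ᵐ[volume] fun t ↦ ((frameMultiplier h α β t).toReal : ℂ)⁻¹ * h t := by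
    filter_upwards [hR e, he] with t h1 h2
    rw [h1, h2]
  have hSd : ∀ i, S (gaborSystem (R e) α β i) = gaborSystem e α β i := fun i ↦ by
    have : gaborSystem (R e) α β i = R (gaborSystem e α β i) := by
      refine Lp.ext ?_
      filter_upwards [hR (gaborSystem e α β i), coeFn_shift_congr hRe (α * i.1) (β * i.2),
        coeFn_shift_congr he (α * i.1) (β * i.2)] with t h1 h2 h3
      rw [gaborSystem, gaborSystem] at *
      rw [h1, h2, h3, frameMultiplier_periodic]
      ring
    rw [this, hSR]
  refine ⟨R e, hRe, fun γ' ↦ ⟨fun hd ↦ ?_, fun hd ↦ ?_⟩, fun u v ↦ ?_⟩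
  -- At the index (0, 0) the dual condition reads S γ' = e, and S is injective.
  · have h1 := (hsum (gaborSystem γ' α β (0, 0))).unique (hd.2 (0, 0))
    simp only [gaborSystem, Int.cast_zero, mul_zero, shift_zero_zero] at h1
    rw [← h1, hRS]
  · subst hd
    refine ⟨hh.isFrame hα hαab hβ hab hδ he, fun i ↦ ?_⟩
    have := hsum (gaborSystem (R e) α β i)
    rwa [hSd] at this
  -- Applying the inverse R of S to the series for S u gives the expansion of u in the dual system,
  -- since R sends each atom to its dual.
  · have h1 := ((hsum u).mapL R).mapL (innerSL ℂ v)
    rw [hRS] at h1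
    have h2 : ∀ j, R (gaborSystem e α β j) = gaborSystem (R e) α β j := fun j ↦ by
      rw [← hSd j, hRS]
    simpa [h2, inner_smul_right] using h1

end IsWindow

end GaborMod
end

noncomputable section
namespace GaborMod

/-! ### The window and its dual are piecewise `C¹` -/

theorem IsC1AC.contDiffOn {g : ℝ → ℂ} {a b : ℝ} (hg : IsC1AC g a b) (hab : a < b) :
    ContDiffOn ℝ 1 g (Icc a b) := by
  rw [contDiffOn_one_iff_derivWithin (uniqueDiffOn_Icc hab)]
  have := hg.absCont_deriv.continuousOn
  rw [uIcc_of_le hab.le] at this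
  exact ⟨hg.differentiableOn, this⟩

/-- A function that is `C¹` up to the boundary between consecutive points of a finite set agrees
almost everywhere with a piecewise `C¹` function. -/
theorem exists_isPiecewiseC1 {f : ℝ → ℂ} {a b : ℝ} (s : Finset ℝ)
    (hf : ∀ c d, a ≤ c → c < d → d ≤ b → (∀ x ∈ s, x ∉ Ioo c d) →
      ∃ g : ℝ → ℂ, ContDiffOn ℝ 1 g (Icc c d) ∧ ∀ t ∈ Ioo c d, f t = g t) :
    ∀ c d, a ≤ c → c < d → d ≤ b →
      ∃ k, IsPiecewiseC1 k ∧ indicator (Ioc c d) f =ᵐ[volume] k := by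
  classical
  -- Induction on the number of exceptional points inside (c, d): cutting at one of them removes it
  -- from both halves.
  suffices H : ∀ n : ℕ, ∀ c d, a ≤ c → c < d → d ≤ b → (s.filter (· ∈ Ioo c d)).card = n →
      ∃ k, IsPiecewiseC1 k ∧ indicator (Ioc c d) f =ᵐ[volume] k from
    fun c d h1 h2 h3 ↦ H _ c d h1 h2 h3 rfl
  intro n
  induction n using Nat.strong_induction_on with
  | _ n ih =>
  intro c d hac hcd hdb hn
  by_cases hex : ∃ x ∈ s, x ∈ Ioo c d
  · obtain ⟨x, hxs, hx⟩ := hex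
    have hsub : ∀ c' d', c ≤ c' → d' ≤ d → x ∉ Ioo c' d' →
        (s.filter (· ∈ Ioo c' d')).card < n := fun c' d' hc hd hx' ↦ by
      rw [← hn]
      refine Finset.card_lt_card ⟨fun y hy ↦ ?_, fun hsubset ↦ ?_⟩
      · rw [Finset.mem_filter] at hy ⊢
        exact ⟨hy.1, hc.trans_lt hy.2.1, hy.2.2.trans_le hd⟩
      · exact hx' (Finset.mem_filter.1 (hsubset (Finset.mem_filter.2 ⟨hxs, hx⟩))).2
    obtain ⟨k₁, hk₁, hk₁'⟩ := ih _ (hsub c x le_rfl hx.2.le fun h ↦ lt_irrefl _ h.2) c x hac hx.1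
      (hx.2.le.trans hdb) rfl
    obtain ⟨k₂, hk₂, hk₂'⟩ := ih _ (hsub x d hx.1.le le_rfl fun h ↦ lt_irrefl _ h.1) x d
      (hac.trans hx.1.le) hx.2 hdb rfl
    refine ⟨k₁ + k₂, hk₁.add hk₂, ?_⟩
    rw [← Ioc_union_Ioc_eq_Ioc hx.1.le hx.2.le,
      indicator_union_of_disjoint (Ioc_disjoint_Ioc_of_le le_rfl)]
    exact hk₁'.add hk₂'
  · push Not at hex
    obtain ⟨g, hg, hfg⟩ := hf c d hac hcd hdb hex
    refine ⟨_, IsPiecewiseC1.piece hcd hg, ?_⟩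
    have hne : ∀ᵐ t : ℝ, t ≠ d := by simp [ae_iff]
    filter_upwards [hne] with t ht
    by_cases h : t ∈ Ioc c d
    · rw [indicator_of_mem h, indicator_of_mem h, hfg t ⟨h.1, lt_of_le_of_ne h.2 ht⟩]
    · rw [indicator_of_notMem h, indicator_of_notMem h]

theorem exists_isPiecewiseC1_cutoff {g : ℝ → ℂ} {a b : ℝ} (hg : IsC1AC g a b) (hab : a < b) :
    ∃ k, IsPiecewiseC1 k ∧ cutoff hg =ᵐ[volume] k := by
  refine ⟨_, IsPiecewiseC1.piece hab (hg.contDiffOn hab), hg.memLp.coeFn_toLp.trans ?_⟩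
  exact indicator_ae_eq_of_ae_eq_set Ioc_ae_eq_Icc.symm

theorem isWindow_indicator {g : ℝ → ℂ} {a b δ : ℝ} (hg : IsC1AC g a b)
    (hgδ : ∀ x ∈ Icc a b, δ ≤ ‖g x‖) : ∃ C, IsWindow (indicator (Icc a b) g) a b δ C := by
  classical
  obtain ⟨C, hC⟩ := isCompact_Icc.exists_bound_of_continuousOn hg.differentiableOn.continuousOn
  refine ⟨max C 0, ?_, fun t ht ↦ indicator_of_notMem ht _, fun t ht ↦ ?_, fun t ↦ ?_⟩
  · have := hg.differentiableOn.continuousOn.measurable_piecewise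
      (continuousOn_const (c := (0 : ℂ))) (measurableSet_Icc (a := a) (b := b))
    rw [← piecewise_eq_indicator]
    exact this
  · rw [indicator_of_mem ht]; exact hgδ t ht
  · by_cases ht : t ∈ Icc a b
    · rw [indicator_of_mem ht]; exact (hC t ht).trans (le_max_left _ _)
    · rw [indicator_of_notMem ht]; simp

/-- Between consecutive endpoints of translates of [a, b] the set of active k does not change. There
G is a finite sum of functions |g(t - αk)|², each C¹ up to the ends, and the term k = 0 keeps it
positive, so g/G is C¹ up to the ends. -/
theorem exists_isPiecewiseC1_dual {g : ℝ → ℂ} {a b α β δ : ℝ} (hg : IsC1AC g a b) (hab : a < b)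
    (hα : 0 < α) (hβ : 0 < β) (hδ : 0 < δ) (hgδ : ∀ x ∈ Icc a b, δ ≤ ‖g x‖) :
    ∃ k, IsPiecewiseC1 k ∧ (fun t ↦
      ((frameMultiplier (indicator (Icc a b) g) α β t).toReal : ℂ)⁻¹ * indicator (Icc a b) g t)
      =ᵐ[volume] k := by
  classical
  set h := indicator (Icc a b) g with hh
  set f : ℝ → ℂ := fun t ↦ ((frameMultiplier h α β t).toReal : ℂ)⁻¹ * h t with hf
  -- If t and t - αk both lie in [a, b], then α|k| ≤ b - a, so |k| < N; finitely many breakpoints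
  -- suffice.
  obtain ⟨N, hN⟩ := exists_nat_gt ((b - a) / α)
  rw [div_lt_iff₀ hα] at hN
  set I : Finset ℤ := Finset.Icc (-(N : ℤ)) N with hI
  set s : Finset ℝ := I.image (fun k : ℤ ↦ a + α * k) ∪ I.image (fun k : ℤ ↦ b + α * k) with hs
  have hfi : f =ᵐ[volume] indicator (Ioc a b) f := by
    have hne : ∀ᵐ t : ℝ, t ≠ a := by simp [ae_iff]
    filter_upwards [hne] with t ht
    by_cases h1 : t ∈ Ioc a b
    · rw [indicator_of_mem h1]
    · rw [indicator_of_notMem h1, hf]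
      simp only
      rw [hh, indicator_of_notMem, mul_zero]
      exact fun h2 ↦ h1 ⟨lt_of_le_of_ne h2.1 ht.symm, h2.2⟩
  suffices H : ∃ k, IsPiecewiseC1 k ∧ indicator (Ioc a b) f =ᵐ[volume] k by
    obtain ⟨k, h1, h2⟩ := H
    exact ⟨k, h1, hfi.trans h2⟩
  refine exists_isPiecewiseC1 (a := a) (b := b) s (fun c d hac hcd hdb hcds ↦ ?_) a b le_rfl hab
    le_rfl
  -- The translates of [a, b] containing the whole of [c, d]. A translate that meets (c, d) without
  -- containing [c, d] would have an endpoint inside (c, d), which is excluded.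
  set K : Finset ℤ := I.filter (fun k ↦ a + α * k ≤ c ∧ d ≤ b + α * k) with hK
  have hmaps : ∀ k ∈ K, MapsTo (fun t : ℝ ↦ t - α * k) (Icc c d) (Icc a b) := fun k hk t ht ↦ by
    have h2 := (Finset.mem_filter.1 hk).2
    exact ⟨by linarith [h2.1, ht.1], by linarith [h2.2, ht.2]⟩
  have h0K : (0 : ℤ) ∈ K := by
    rw [hK, Finset.mem_filter, hI, Finset.mem_Icc]
    refine ⟨⟨by omega, by omega⟩, ?_, ?_⟩ <;> simpa
  have hgC := hg.contDiffOn hab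
  set D : ℝ → ℝ := fun t ↦ β⁻¹ * ∑ k ∈ K, ‖g (t - α * k)‖ ^ 2 with hD
  have hDC : ContDiffOn ℝ 1 D (Icc c d) := by
    refine contDiffOn_const.mul (ContDiffOn.sum fun k hk ↦ ?_)
    exact (hgC.comp (by fun_prop) (hmaps k hk)).norm_sq ℝ
  have hDpos : ∀ t ∈ Icc c d, 0 < D t := fun t ht ↦ by
    refine mul_pos (inv_pos.2 hβ) ?_
    refine lt_of_lt_of_le ?_ (Finset.single_le_sum
      (f := fun k : ℤ ↦ ‖g (t - α * k)‖ ^ 2) (fun k _ ↦ by positivity) h0K)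
    have := hgδ _ (hmaps 0 h0K ht)
    have : 0 < ‖g (t - α * (0 : ℤ))‖ := hδ.trans_le this
    positivity
  refine ⟨fun t ↦ ((D t : ℂ))⁻¹ * g t, ?_, fun t ht ↦ ?_⟩
  · refine ContDiffOn.mul ?_ (hgC.mono (Icc_subset_Icc hac hdb))
    refine ContDiffOn.inv (Complex.ofRealCLM.contDiff.comp_contDiffOn hDC) fun t ht ↦ ?_
    exact_mod_cast (hDpos t ht).ne'
  · have htab : t ∈ Icc a b := ⟨hac.trans ht.1.le, ht.2.le.trans hdb⟩
    rw [hf]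
    simp only
    rw [hh, indicator_of_mem htab, ← hh]
    congr 3
    have hsum : ∑' k : ℤ, ‖h (t - α * k)‖ₑ ^ 2 = ∑ k ∈ K, ENNReal.ofReal (‖g (t - α * k)‖ ^ 2) := by
      rw [tsum_eq_sum (s := K)]
      · refine Finset.sum_congr rfl fun k hk ↦ ?_
        rw [hh, indicator_of_mem (hmaps k hk ⟨ht.1.le, ht.2.le⟩), ENNReal.ofReal_pow (norm_nonneg _),
          ofReal_norm]
      · intro k hk
        rw [hh, indicator_of_notMem]
        · simp
        · intro hmem
          refine hk ?_
          have hkI : k ∈ I := by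
            rw [hI, Finset.mem_Icc]
            have h1 : α * k ≤ b - a := by linarith [hmem.1, htab.2]
            have h2 : -(b - a) ≤ α * k := by linarith [hmem.2, htab.1]
            have h3 : (k : ℝ) < N := by nlinarith
            have h4 : -(N : ℝ) < k := by nlinarith
            constructor
            · exact_mod_cast h4.le
            · exact_mod_cast h3.le
          refine Finset.mem_filter.2 ⟨hkI, ?_, ?_⟩
          · by_contra! hlt
            refine hcds (a + α * k) ?_ ⟨hlt, by linarith [hmem.1, ht.2]⟩
            exact Finset.mem_union_left _ (Finset.mem_image_of_mem _ hkI)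
          · by_contra! hlt
            refine hcds (b + α * k) ?_ ⟨by linarith [hmem.2, ht.1], hlt⟩
            exact Finset.mem_union_right _ (Finset.mem_image_of_mem _ hkI)
    rw [frameMultiplier, hsum, ← ENNReal.ofReal_sum_of_nonneg (fun k _ ↦ by positivity),
      ← ENNReal.ofReal_mul (by positivity), ENNReal.toReal_ofReal]
    positivity

end GaborMod
end

noncomputable section
namespace GaborMod

/-! ### The short-time Fourier transform of Gabor systems -/

theorem inner_toLp (η : 𝓢(ℝ, ℂ)) (e : L2) :
    inner ℂ (η.toLp 2 volume) e = ∫ t, conj (η t) * e t := by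
  rw [L2.inner_def]
  refine integral_congr_ae ?_
  filter_upwards [η.coeFn_toLp 2 volume] with t ht
  rw [ht, RCLike.inner_apply, mul_comm]

theorem stft_coe_L2 (ψ : 𝓢(ℝ, ℂ)) (e : L2) (x w : ℝ) :
    stft ψ (e : 𝓢'(ℝ, ℂ)) x w = inner ℂ ((schwartzShift x w ψ).toLp 2 volume) e := by
  rw [inner_toLp, stft, Lp.toTemperedDistribution_apply]
  rfl

theorem fourierInv_schwartzShift_apply (ψ : 𝓢(ℝ, ℂ)) (x w t : ℝ) :
    (𝓕⁻ (schwartzShift x w ψ)) t = char x (t + w) * (𝓕⁻ ψ) (t + w) := by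
  rw [SchwartzMap.fourierInv_coe, SchwartzMap.fourierInv_coe, Real.fourierInv_eq',
    Real.fourierInv_eq', ← integral_const_mul,
    ← integral_add_right_eq_self _ x]
  refine integral_congr_ae (Eventually.of_forall fun s ↦ ?_)
  simp only [smul_eq_mul, schwartzShift_apply, char]
  rw [← mul_assoc, ← mul_assoc, ← Complex.exp_add, ← Complex.exp_add]
  rw [add_sub_cancel_right]
  congr 2
  simp only [RCLike.inner_apply, conj_trivial]
  push_cast
  ring

theorem stft_fourier (ψ : 𝓢(ℝ, ℂ)) (e : L2) (x w : ℝ) :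
    stft ψ ((𝓕 e : L2) : 𝓢'(ℝ, ℂ)) x w =
      inner ℂ ((𝓕⁻ (schwartzShift x w ψ)).toLp 2 volume) e := by
  rw [stft_coe_L2, ← Lp.inner_fourier_eq _ e, SchwartzMap.toLp_fourier_eq,
    FourierTransform.fourier_fourierInv_eq]

theorem inner_toLp_shift (η : 𝓢(ℝ, ℂ)) (e : L2) (u ξ : ℝ) :
    inner ℂ (η.toLp 2 volume) (shift u ξ e) = ∫ t, conj (η (t + u)) * (char ξ (t + u) * e t) := by
  rw [inner_toLp, ← integral_add_right_eq_self _ u]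
  refine integral_congr_ae ?_
  have h := (measurePreserving_add_right volume u).quasiMeasurePreserving.ae (coeFn_shift u ξ e)
  filter_upwards [h] with t ht
  rw [ht, add_sub_cancel_right]

theorem char_neg_left (ξ t : ℝ) : char (-ξ) t = char ξ (-t) := by
  unfold char; push_cast; ring_nf

theorem char_mul_char_neg (ξ t : ℝ) : char ξ t * char ξ (-t) = 1 := by
  rw [← char_add, add_neg_cancel]; simp [char]

theorem stft_shift (ψ : 𝓢(ℝ, ℂ)) (e : L2) (u ξ x w : ℝ) :
    stft ψ (shift u ξ e : L2) x w = char (ξ - w) u * stft ψ e (x - u) (w - ξ) := by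
  rw [stft_coe_L2, stft_coe_L2, inner_toLp_shift, inner_toLp, ← integral_const_mul]
  refine integral_congr_ae (Eventually.of_forall fun t ↦ ?_)
  simp only [schwartzShift_apply, map_mul, conj_char]
  rw [show t + u - x = t - (x - u) by ring]
  have h : char (-w) (t + u) * char ξ (t + u) = char (ξ - w) u * char (-(w - ξ)) t := by
    unfold char
    rw [← Complex.exp_add, ← Complex.exp_add]
    push_cast; ring_nf
  linear_combination (conj (ψ (t - (x - u))) * e t) * h

/-- Plancherel moves the Fourier transform onto the Schwartz atom, where it exchanges translation
and modulation. What remains is an integral against the window itself. -/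
theorem stft_fourier_eq_windowKernel (ψ : 𝓢(ℝ, ℂ)) {e : L2} {h : ℝ → ℂ} (he : e =ᵐ[volume] h)
    (x w : ℝ) :
    stft ψ ((𝓕 e : L2) : 𝓢'(ℝ, ℂ)) x w = char (-x) w * windowKernel (𝓕⁻ ψ) h x w := by
  rw [stft_fourier, inner_toLp, windowKernel, ← integral_const_mul]
  refine integral_congr_ae ?_
  filter_upwards [he] with t ht
  rw [ht, fourierInv_schwartzShift_apply, map_mul, conj_char, char_add]
  ring

/-- The phase factor does not depend on the translation parameter. -/
theorem stft_gaborSystem (ψ : 𝓢(ℝ, ℂ)) {e : L2} {h : ℝ → ℂ} (he : e =ᵐ[volume] h) (α β : ℝ)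
    (i : ℤ × ℤ) (x w : ℝ) :
    stft ψ (gaborSystem (𝓕 e) β α i : L2) x w =
      char (-x) (w - α * i.2) * windowKernel (𝓕⁻ ψ) h (x - β * i.1) (w - α * i.2) := by
  rw [gaborSystem, stft_shift, stft_fourier_eq_windowKernel ψ he, ← mul_assoc]
  congr 1
  unfold char
  rw [← Complex.exp_add]
  push_cast; ring_nf

/-- The Fourier transform exchanges translations and modulations, hence the reindexing (k, n) ↦ (-n,
k). The unimodular factor is independent of the window, so it cancels in products of an atom and a
conjugated dual atom. -/
theorem stft_gaborSystem_eq_inner (ψ : 𝓢(ℝ, ℂ)) (e : L2) (α β : ℝ) (i : ℤ × ℤ) (x w : ℝ) :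
    stft ψ (gaborSystem (𝓕 e) β α i : L2) x w =
      char (β * i.1) (α * i.2) * inner ℂ ((𝓕⁻ (schwartzShift x w ψ)).toLp 2 volume)
        (gaborSystem e α β (-i.2, i.1)) := by
  rw [stft_gaborSystem ψ (EventuallyEq.refl _ _), gaborSystem, inner_toLp_shift, windowKernel,
    ← integral_const_mul, ← integral_const_mul]
  refine integral_congr_ae (Eventually.of_forall fun t ↦ ?_)
  simp only [fourierInv_schwartzShift_apply, map_mul, conj_char]
  rw [show t + α * ((-i.2 : ℤ) : ℝ) + w = t + (w - α * i.2) by push_cast; ring]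
  have h : char (-x) (w - α * i.2) * char (-(x - β * i.1)) t =
      char (β * i.1) (α * i.2) *
        (char (-x) (t + (w - α * i.2)) * char (β * i.1) (t + α * ((-i.2 : ℤ) : ℝ))) := by
    unfold char
    rw [← Complex.exp_add, ← Complex.exp_add, ← Complex.exp_add]
    push_cast; ring_nf
  linear_combination (e t * conj ((𝓕⁻ ψ) (t + (w - α * i.2)))) * h

/-- The Gabor systems of `e` and `d` are dual to each other in `L²`. -/
def IsDualPair (e d : L2) (α β : ℝ) : Prop :=
  ∀ u v : L2, HasSum (fun j ↦ inner ℂ (gaborSystem d α β j) u * inner ℂ v (gaborSystem e α β j))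
    (inner ℂ v u)

theorem IsDualPair.symm {e d : L2} {α β : ℝ} (h : IsDualPair e d α β) : IsDualPair d e α β := by
  intro u v
  have := (h v u).map (starRingEnd ℂ) Complex.continuous_conj
  simp only [inner_conj_symm] at this
  convert this using 1
  funext j
  simp only [Function.comp_apply, map_mul, inner_conj_symm]
  rw [mul_comm]

/-- This is the L² expansion tested on two Schwartz atoms. The sum is the inner product of these
atoms, which is exactly the coefficient in the inversion formula for distributions. -/
theorem IsDualPair.hasSum_stft {e d : L2} {α β : ℝ} (h : IsDualPair e d α β) (ψ : 𝓢(ℝ, ℂ))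
    (x₀ w₀ x w : ℝ) :
    HasSum (fun i ↦ conj (stft ψ (gaborSystem (𝓕 d) β α i : L2) x w) *
        stft ψ (gaborSystem (𝓕 e) β α i : L2) x₀ w₀)
      (invCoeff (schwartzShift x₀ w₀ ψ) (schwartzConj ψ) (x, w)) := by
  have h1 := h ((𝓕⁻ (schwartzShift x w ψ)).toLp 2 volume)
    ((𝓕⁻ (schwartzShift x₀ w₀ ψ)).toLp 2 volume)
  let E : ℤ × ℤ ≃ ℤ × ℤ :=
    { toFun := fun i ↦ (-i.2, i.1)
      invFun := fun i ↦ (i.2, -i.1)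
      left_inv := fun i ↦ by simp
      right_inv := fun i ↦ by simp }
  have h2 := (E.hasSum_iff).2 h1
  have h3 : inner ℂ ((𝓕⁻ (schwartzShift x₀ w₀ ψ)).toLp 2 volume)
      ((𝓕⁻ (schwartzShift x w ψ)).toLp 2 volume) =
      invCoeff (schwartzShift x₀ w₀ ψ) (schwartzConj ψ) (x, w) := by
    rw [← Lp.inner_fourier_eq, SchwartzMap.toLp_fourier_eq, SchwartzMap.toLp_fourier_eq,
      FourierTransform.fourier_fourierInv_eq, FourierTransform.fourier_fourierInv_eq, inner_toLp,
      invCoeff, crossShift, ← integral_conj]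
    refine integral_congr_ae ?_
    filter_upwards [(schwartzShift x w ψ).coeFn_toLp 2 volume] with t ht
    rw [ht, ← schwartzConj_schwartzShift, schwartzConj_apply, map_mul, Complex.conj_conj]
  rw [h3] at h2
  convert h2 using 1
  funext i
  rw [stft_gaborSystem_eq_inner, stft_gaborSystem_eq_inner, map_mul, inner_conj_symm]
  simp only [Function.comp_apply, E, Equiv.coe_fn_mk]
  have h4 : conj (char (β * i.1) (α * i.2)) * char (β * i.1) (α * i.2) = 1 := by
    rw [conj_char, char_neg_left, mul_comm, char_mul_char_neg]
  linear_combination (inner ℂ (gaborSystem d α β (-i.2, i.1))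
    ((𝓕⁻ (schwartzShift x w ψ)).toLp 2 volume) * inner ℂ
    ((𝓕⁻ (schwartzShift x₀ w₀ ψ)).toLp 2 volume) (gaborSystem e α β (-i.2, i.1))) * h4

end GaborMod
end

noncomputable section
namespace GaborMod

/-! ### Weighted estimates -/

theorem lintegral_rho_sub (r y : ℝ) :
    ∫⁻ w, ENNReal.ofReal (rho r (w - y)) = ∫⁻ w, ENNReal.ofReal (rho r w) :=
  lintegral_sub_right_eq_self (fun w ↦ ENNReal.ofReal (rho r w)) y

theorem measurable_ofReal_rho (r y : ℝ) : Measurable fun w ↦ ENNReal.ofReal (rho r (w - y)) :=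
  ((continuous_rho r).measurable.comp (by fun_prop)).ennreal_ofReal

theorem exists_lintegral_rho_mul_le {q : ℝ} (hq : 1 ≤ q) :
    ∃ C : ℝ≥0∞, C ≠ ∞ ∧ ∀ (y : ℝ) (u : ℝ → ℝ≥0∞), Measurable u →
      ∫⁻ w, ENNReal.ofReal (rho 2 (w - y)) * u w ≤ C * lpn q volume u := by
  have hq0 : 0 < q := by linarith
  set I := ∫⁻ w, ENNReal.ofReal (rho 2 w) with hI
  have hIfin : I ≠ ∞ := (lintegral_rho_lt_top (by norm_num)).ne
  refine ⟨(I ^ (q - 1)) ^ (1 / q), ENNReal.rpow_ne_top_of_nonneg (by positivity)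
    (ENNReal.rpow_ne_top_of_nonneg (by linarith) hIfin), fun y u hu ↦ ?_⟩
  have h := lintegral_mul_rpow_le (μ := volume) hq
    (measurable_ofReal_rho 2 y).aemeasurable hu.aemeasurable
  rw [lintegral_rho_sub, ← hI] at h
  rw [lpn, ← ENNReal.mul_rpow_of_nonneg _ _ (by positivity)]
  have h2 : (∫⁻ w, ENNReal.ofReal (rho 2 (w - y)) * u w) ^ q ≤
      I ^ (q - 1) * ∫⁻ w, u w ^ q := by
    refine h.trans ?_
    gcongr with w
    refine mul_le_of_le_one_left zero_le ?_
    rw [ENNReal.ofReal_le_one]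
    exact rho_le_one (by norm_num) _
  have h3 := ENNReal.rpow_le_rpow h2 (by positivity : 0 ≤ 1 / q)
  rwa [← ENNReal.rpow_mul, mul_one_div_cancel hq0.ne', ENNReal.rpow_one] at h3

theorem rho_anti_abs {r x y : ℝ} (hr : 0 ≤ r) (h : |x| ≤ |y|) : rho r y ≤ rho r x := by
  unfold rho
  exact Real.rpow_le_rpow_of_nonpos (by positivity) (by linarith) (by linarith)

/-- The larger of |x| and |y| is at least |x - y|/2, so a part σ of its decay can be traded for
decay in x - y. The remaining total order 2 - σ falls on the smaller variable. -/
theorem rho_one_mul_rho_one_le {σ : ℝ} (hσ : 0 ≤ σ) (hσ1 : σ ≤ 1) (x y : ℝ) :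
    rho 1 x * rho 1 y ≤ 2 ^ σ * rho σ (x - y) * (rho (2 - σ) x + rho (2 - σ) y) := by
  wlog hxy : |y| ≤ |x| generalizing x y
  · have := this y x (by linarith)
    rwa [mul_comm, add_comm, ← rho_neg σ, neg_sub] at this
  have h1 : rho 1 x = rho σ x * rho (1 - σ) x := by rw [rho_mul]; congr 1; ring
  have h2 : rho (1 - σ) x ≤ rho (1 - σ) y := rho_anti_abs (by linarith) hxy
  have h3 : rho (1 - σ) y * rho 1 y = rho (2 - σ) y := by rw [rho_mul]; congr 1; ring
  have h4 : rho σ x ≤ 2 ^ σ * rho σ (x - y) := by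
    unfold rho
    have : (2 : ℝ) ^ σ = (2⁻¹ : ℝ) ^ (-σ) := by
      rw [Real.inv_rpow (by norm_num), Real.rpow_neg (by norm_num), inv_inv]
    rw [this, ← Real.mul_rpow (by norm_num) (by positivity)]
    refine Real.rpow_le_rpow_of_nonpos (by positivity) ?_ (by linarith)
    have := abs_sub x y
    linarith
  have p1 := rho_pos σ x
  have p2 := rho_pos (1 - σ) x
  have p3 := rho_pos 1 y
  have p4 := rho_pos (2 - σ) x
  have p5 := rho_pos σ (x - y)
  calc rho 1 x * rho 1 y = rho σ x * (rho (1 - σ) x * rho 1 y) := by rw [h1]; ring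
    _ ≤ 2 ^ σ * rho σ (x - y) * (rho (1 - σ) y * rho 1 y) := by gcongr
    _ ≤ _ := by rw [h3]; gcongr; linarith

/-- Weights of order one are not summable over the lattice. Their product keeps an order 2 - σ > 1
that sums over k, and a factor of order σ in x - x₀ that Hölder pairs with F. -/
theorem exists_tsum_rho_one_mul_le {p p' β : ℝ} (hp : p.HolderConjugate p') (hβ : 0 < β) :
    ∃ C : ℝ≥0∞, C ≠ ∞ ∧ ∀ (x₀ : ℝ) (F : ℝ → ℝ≥0∞), Measurable F →
      ∑' k : ℤ, ENNReal.ofReal (rho 1 (x₀ - β * k)) *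
        ∫⁻ x, ENNReal.ofReal (rho 1 (x - β * k)) * F x ≤ C * lpn p volume F := by
  have hp'1 : 1 < p' := hp.symm.lt
  have hp'0 : 0 < p' := by linarith
  -- The midpoint of (1/p', 1): σp' > 1 puts the weight of order σ in L^{p'}, and σ < 1 keeps 2 - σ
  -- > 1.
  set σ : ℝ := (p'⁻¹ + 1) / 2 with hσ
  have hinv : p'⁻¹ < 1 := inv_lt_one_of_one_lt₀ hp'1
  have hinv0 : 0 < p'⁻¹ := by positivity
  have hσ0 : 0 ≤ σ := by rw [hσ]; linarith
  have hσ1 : σ < 1 := by rw [hσ]; linarith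
  have hσp : 1 < σ * p' := by
    have h1 : p'⁻¹ < σ := by rw [hσ]; linarith
    have := mul_lt_mul_of_pos_right h1 hp'0
    rwa [inv_mul_cancel₀ hp'0.ne'] at this
  obtain ⟨D, hD, hDb⟩ := exists_tsum_rho_le (r := 2 - σ) (β := β) (by linarith) hβ
  set J := lpn p' volume (fun x ↦ ENNReal.ofReal (rho σ x)) with hJ
  have hJfin : J ≠ ∞ := by
    refine ENNReal.rpow_ne_top_of_nonneg (by positivity) ?_
    have : ∀ x, ENNReal.ofReal (rho σ x) ^ p' = ENNReal.ofReal (rho (σ * p') x) := fun x ↦ by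
      rw [ENNReal.ofReal_rpow_of_pos (rho_pos _ _), rho_rpow]
    simp only [this]
    exact (lintegral_rho_lt_top hσp).ne
  refine ⟨ENNReal.ofReal (2 ^ σ) * (D + D) * J, by finiteness, fun x₀ F hF ↦ ?_⟩
  have hm : ∀ k : ℤ, Measurable fun x ↦ ENNReal.ofReal (rho 1 (x - β * k)) * F x := fun k ↦
    (measurable_ofReal_rho 1 (β * k)).mul hF
  calc ∑' k : ℤ, ENNReal.ofReal (rho 1 (x₀ - β * k)) *
        ∫⁻ x, ENNReal.ofReal (rho 1 (x - β * k)) * F x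
      = ∫⁻ x, ∑' k : ℤ, ENNReal.ofReal (rho 1 (x₀ - β * k)) *
          (ENNReal.ofReal (rho 1 (x - β * k)) * F x) := by
        rw [lintegral_tsum fun k ↦ ((hm k).const_mul _).aemeasurable]
        exact tsum_congr fun k ↦ (lintegral_const_mul _ (hm k)).symm
    _ ≤ ∫⁻ x, ENNReal.ofReal (2 ^ σ) * (D + D) * (F x * ENNReal.ofReal (rho σ (x - x₀))) := by
        refine lintegral_mono fun x ↦ ?_
        have hk : ∀ k : ℤ, ENNReal.ofReal (rho 1 (x₀ - β * k)) *
            (ENNReal.ofReal (rho 1 (x - β * k)) * F x) ≤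
            ENNReal.ofReal (2 ^ σ) * (F x * ENNReal.ofReal (rho σ (x - x₀))) *
              (ENNReal.ofReal (rho (2 - σ) (x - β * k)) +
                ENNReal.ofReal (rho (2 - σ) (x₀ - β * k))) := fun k ↦ by
          have h1 := rho_one_mul_rho_one_le hσ0 hσ1.le (x - β * k) (x₀ - β * k)
          rw [sub_sub_sub_cancel_right] at h1
          have h2 := ENNReal.ofReal_le_ofReal h1
          rw [ENNReal.ofReal_mul (rho_pos _ _).le, ENNReal.ofReal_mul
            (mul_nonneg (by positivity) (rho_pos _ _).le), ENNReal.ofReal_mul (by positivity),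
            ENNReal.ofReal_add (rho_pos _ _).le (rho_pos _ _).le] at h2
          calc _ = ENNReal.ofReal (rho 1 (x - β * k)) * ENNReal.ofReal (rho 1 (x₀ - β * k)) *
                F x := by ring
            _ ≤ ENNReal.ofReal (2 ^ σ) * ENNReal.ofReal (rho σ (x - x₀)) *
                (ENNReal.ofReal (rho (2 - σ) (x - β * k)) +
                  ENNReal.ofReal (rho (2 - σ) (x₀ - β * k))) * F x := by gcongr
            _ = _ := by ring
        refine (ENNReal.tsum_le_tsum hk).trans ?_
        rw [ENNReal.tsum_mul_left, ENNReal.tsum_add]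
        calc _ ≤ ENNReal.ofReal (2 ^ σ) * (F x * ENNReal.ofReal (rho σ (x - x₀))) * (D + D) := by
              gcongr
              · exact hDb x
              · exact hDb x₀
          _ = _ := by ring
    _ ≤ ENNReal.ofReal (2 ^ σ) * (D + D) * (lpn p volume F * J) := by
        have hm' : Measurable fun x ↦ F x * ENNReal.ofReal (rho σ (x - x₀)) :=
          hF.mul (measurable_ofReal_rho σ x₀)
        rw [lintegral_const_mul _ hm']
        gcongr
        refine (lintegral_mul_le_lpn_mul_lpn hp hF.aemeasurable
          (measurable_ofReal_rho σ x₀).aemeasurable).trans ?_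
        gcongr
        exact (congrArg (· ^ (1 / p')) (lintegral_sub_right_eq_self
          (fun x ↦ ENNReal.ofReal (rho σ x) ^ p') x₀)).le
    _ = _ := by ring

/-! ### Mixed norms -/

/-- The mixed norm of `L^{p,q}(ℝ²)`, with the inner integral in the first variable. -/
def mixedNorm (p q : ℝ) (V : ℝ × ℝ → ℝ≥0∞) : ℝ≥0∞ :=
  lpn q volume fun w ↦ lpn p volume fun x ↦ V (x, w)

theorem modNorm_eq_mixedNorm (ψ : 𝓢(ℝ, ℂ)) (p q : ℝ) (f : 𝓢'(ℝ, ℂ)) :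
    modNorm ψ p q f = mixedNorm p q fun z ↦ ‖stft ψ f z.1 z.2‖ₑ := by
  simp only [modNorm, mixedNorm, lpn, ← ENNReal.rpow_mul, one_div_mul_eq_div]

theorem seqNorm_eq_lpn (p q : ℝ) (c : ℤ × ℤ → ℂ) :
    seqNorm p q c =
      lpn q Measure.count fun n : ℤ ↦ lpn p Measure.count fun k : ℤ ↦ ‖c (k, n)‖ₑ := by
  simp only [seqNorm, lpn_count, ← ENNReal.rpow_mul, one_div_mul_eq_div]

theorem measurable_lpn_left {V : ℝ × ℝ → ℝ≥0∞} (hV : Measurable V) (p : ℝ) :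
    Measurable fun w ↦ lpn p volume fun x ↦ V (x, w) :=
  ((hV.pow_const p).lintegral_prod_left').pow_const _

/-- The weights majorise the transforms of the atoms of both systems. The bound therefore gives the
absolute convergence needed to exchange the sum over atoms with the integral over the time-frequency
plane. -/
theorem exists_tsum_rho_lintegral_le {p q α β : ℝ} (hp : 1 < p) (hq : 1 ≤ q) (hα : 0 < α)
    (hβ : 0 < β) :
    ∃ C : ℝ≥0∞, C ≠ ∞ ∧ ∀ (x₀ w₀ : ℝ) (V : ℝ × ℝ → ℝ≥0∞), Measurable V →
      ∑' i : ℤ × ℤ, (ENNReal.ofReal (rho 1 (x₀ - β * i.1)) *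
        ENNReal.ofReal (rho 2 (w₀ - α * i.2))) *
        ∫⁻ z, (ENNReal.ofReal (rho 1 (z.1 - β * i.1)) * ENNReal.ofReal (rho 2 (z.2 - α * i.2))) *
          V z ≤ C * mixedNorm p q V := by
  obtain ⟨C₁, hC₁, h₁⟩ := exists_tsum_rho_one_mul_le (Real.HolderConjugate.conjExponent hp) hβ
  obtain ⟨C₂, hC₂, h₂⟩ := exists_lintegral_rho_mul_le hq
  obtain ⟨C₃, hC₃, h₃⟩ := exists_tsum_rho_le (r := 2) (β := α) (by norm_num) hα
  refine ⟨C₃ * (C₁ * C₂), by finiteness, fun x₀ w₀ V hV ↦ ?_⟩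
  have hVw : ∀ w, Measurable fun x ↦ V (x, w) := fun w ↦ hV.comp measurable_prodMk_right
  have hin : ∀ k : ℤ, Measurable fun w ↦ ∫⁻ x, ENNReal.ofReal (rho 1 (x - β * k)) * V (x, w) :=
    fun k ↦ Measurable.lintegral_prod_left'
      (((measurable_ofReal_rho 1 (β * k)).comp measurable_fst).mul hV)
  have hsplit : ∀ k n : ℤ, ∫⁻ z : ℝ × ℝ, (ENNReal.ofReal (rho 1 (z.1 - β * k)) *
      ENNReal.ofReal (rho 2 (z.2 - α * n))) * V z =
      ∫⁻ w, ENNReal.ofReal (rho 2 (w - α * n)) *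
        ∫⁻ x, ENNReal.ofReal (rho 1 (x - β * k)) * V (x, w) := fun k n ↦ by
    have hmk : Measurable fun z : ℝ × ℝ ↦ ENNReal.ofReal (rho 1 (z.1 - β * k)) :=
      (measurable_ofReal_rho 1 (β * k)).comp measurable_fst
    have hmn : Measurable fun z : ℝ × ℝ ↦ ENNReal.ofReal (rho 2 (z.2 - α * n)) :=
      (measurable_ofReal_rho 2 (α * n)).comp measurable_snd
    have hm : Measurable fun z : ℝ × ℝ ↦ (ENNReal.ofReal (rho 1 (z.1 - β * k)) *
        ENNReal.ofReal (rho 2 (z.2 - α * n))) * V z := (hmk.mul hmn).mul hV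
    have hm' : Measurable fun x ↦ ENNReal.ofReal (rho 1 (x - β * k)) := measurable_ofReal_rho 1 _
    rw [Measure.volume_eq_prod, lintegral_prod_symm _ hm.aemeasurable]
    refine lintegral_congr fun w ↦ ?_
    rw [← lintegral_const_mul (f := fun x ↦ ENNReal.ofReal (rho 1 (x - β * k)) * V (x, w)) _
      (hm'.mul (hVw w))]
    refine lintegral_congr fun x ↦ ?_
    ring
  have hn : ∀ n : ℤ, ∑' k : ℤ, (ENNReal.ofReal (rho 1 (x₀ - β * k)) *
        ENNReal.ofReal (rho 2 (w₀ - α * n))) *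
        ∫⁻ z : ℝ × ℝ, (ENNReal.ofReal (rho 1 (z.1 - β * k)) * ENNReal.ofReal (rho 2 (z.2 - α * n))) *
          V z ≤ ENNReal.ofReal (rho 2 (w₀ - α * n)) * (C₁ * C₂ * mixedNorm p q V) := fun n ↦ by
    have hk : ∀ k : ℤ, (ENNReal.ofReal (rho 1 (x₀ - β * k)) *
        ENNReal.ofReal (rho 2 (w₀ - α * n))) *
        ∫⁻ z : ℝ × ℝ, (ENNReal.ofReal (rho 1 (z.1 - β * k)) *
          ENNReal.ofReal (rho 2 (z.2 - α * n))) * V z =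
        ENNReal.ofReal (rho 2 (w₀ - α * n)) * (ENNReal.ofReal (rho 1 (x₀ - β * k)) *
          ∫⁻ w, ENNReal.ofReal (rho 2 (w - α * n)) *
            ∫⁻ x, ENNReal.ofReal (rho 1 (x - β * k)) * V (x, w)) := fun k ↦ by
      rw [hsplit]; ring
    rw [tsum_congr hk, ENNReal.tsum_mul_left, mul_assoc C₁]
    gcongr
    calc ∑' k : ℤ, ENNReal.ofReal (rho 1 (x₀ - β * k)) *
          ∫⁻ w, ENNReal.ofReal (rho 2 (w - α * n)) *
            ∫⁻ x, ENNReal.ofReal (rho 1 (x - β * k)) * V (x, w)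
        = ∫⁻ w, ENNReal.ofReal (rho 2 (w - α * n)) *
            ∑' k : ℤ, ENNReal.ofReal (rho 1 (x₀ - β * k)) *
              ∫⁻ x, ENNReal.ofReal (rho 1 (x - β * k)) * V (x, w) := by
          have hmk : ∀ k : ℤ, Measurable fun w ↦ ENNReal.ofReal (rho 2 (w - α * n)) *
              ∫⁻ x, ENNReal.ofReal (rho 1 (x - β * k)) * V (x, w) := fun k ↦
            (measurable_ofReal_rho 2 (α * n)).mul (hin k)
          simp only [← ENNReal.tsum_mul_left]
          have hmk' : ∀ k : ℤ, Measurable fun w ↦ ENNReal.ofReal (rho 2 (w - α * n)) *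
              (ENNReal.ofReal (rho 1 (x₀ - β * k)) *
                ∫⁻ x, ENNReal.ofReal (rho 1 (x - β * k)) * V (x, w)) := fun k ↦
            (measurable_ofReal_rho 2 (α * n)).mul ((hin k).const_mul _)
          rw [lintegral_tsum fun k ↦ (hmk' k).aemeasurable]
          refine tsum_congr fun k ↦ ?_
          rw [← lintegral_const_mul _ (hmk k)]
          refine lintegral_congr fun w ↦ ?_
          ring
      _ ≤ ∫⁻ w, C₁ * (ENNReal.ofReal (rho 2 (w - α * n)) * lpn p volume fun x ↦ V (x, w)) := by
          refine lintegral_mono fun w ↦ ?_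
          rw [mul_left_comm]
          gcongr
          exact h₁ x₀ _ (hVw w)
      _ ≤ C₁ * (C₂ * mixedNorm p q V) := by
          rw [lintegral_const_mul' _ _ hC₁]
          gcongr
          exact h₂ _ _ (measurable_lpn_left hV p)
  rw [ENNReal.tsum_prod', ENNReal.tsum_comm]
  refine (ENNReal.tsum_le_tsum hn).trans ?_
  rw [ENNReal.tsum_mul_right, mul_assoc C₃]
  gcongr
  exact h₃ w₀

end GaborMod
end

noncomputable section
namespace GaborMod

/-! ### Pointwise reconstruction of the short-time Fourier transform -/

section Reconstruction

variable {ψ : 𝓢(ℝ, ℂ)} {p q α β : ℝ} {e d : L2} {h k : ℝ → ℂ}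

theorem exists_enorm_stft_gaborSystem_le (ψ : 𝓢(ℝ, ℂ)) (α β : ℝ) (hh : IsPiecewiseC1 h)
    (he : e =ᵐ[volume] h) :
    ∃ C : ℝ≥0∞, C ≠ ∞ ∧ ∀ (i : ℤ × ℤ) (x w : ℝ),
      ‖stft ψ (gaborSystem (𝓕 e) β α i : L2) x w‖ₑ ≤
        C * (ENNReal.ofReal (rho 1 (x - β * i.1)) * ENNReal.ofReal (rho 2 (w - α * i.2))) := by
  obtain ⟨C, hC, hCb⟩ := hh.exists_norm_windowKernel_le (𝓕⁻ ψ)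
  refine ⟨ENNReal.ofReal C, ENNReal.ofReal_ne_top, fun i x w ↦ ?_⟩
  rw [stft_gaborSystem ψ he, enorm_mul, enorm_char, one_mul, ← ENNReal.ofReal_mul (rho_pos _ _).le,
    ← ENNReal.ofReal_mul hC, ← ofReal_norm]
  exact ENNReal.ofReal_le_ofReal (hCb _ _)

theorem measurable_stft (ψ : 𝓢(ℝ, ℂ)) (f : 𝓢'(ℝ, ℂ)) :
    Measurable fun z : ℝ × ℝ ↦ stft ψ f z.1 z.2 := (continuous_stft ψ f).measurable

theorem enorm_pairingIntegrand (ψ : 𝓢(ℝ, ℂ)) (f g : 𝓢'(ℝ, ℂ)) (z : ℝ × ℝ) :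
    ‖pairingIntegrand ψ f g z‖ₑ = ‖stft ψ g z.1 z.2‖ₑ * ‖stft ψ f z.1 z.2‖ₑ := by
  rw [pairingIntegrand, enorm_mul, RCLike.enorm_conj, mul_comm]

theorem continuous_pairingIntegrand (ψ : 𝓢(ℝ, ℂ)) (f g : 𝓢'(ℝ, ℂ)) :
    Continuous (pairingIntegrand ψ f g) :=
  (continuous_stft ψ f).mul (Complex.continuous_conj.comp (continuous_stft ψ g))

theorem lintegral_enorm_pairingIntegrand_le {C : ℝ≥0∞} (hC : C ≠ ∞)
    (hCb : ∀ (i : ℤ × ℤ) (x w : ℝ), ‖stft ψ (gaborSystem (𝓕 d) β α i : L2) x w‖ₑ ≤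
        C * (ENNReal.ofReal (rho 1 (x - β * i.1)) * ENNReal.ofReal (rho 2 (w - α * i.2))))
    (f : 𝓢'(ℝ, ℂ)) (i : ℤ × ℤ) :
    ∫⁻ z, ‖pairingIntegrand ψ f (gaborSystem (𝓕 d) β α i : L2) z‖ₑ ≤
      C * ∫⁻ z : ℝ × ℝ, (ENNReal.ofReal (rho 1 (z.1 - β * i.1)) *
        ENNReal.ofReal (rho 2 (z.2 - α * i.2))) * ‖stft ψ f z.1 z.2‖ₑ := by
  rw [← lintegral_const_mul' _ _ hC]
  refine lintegral_mono fun z ↦ ?_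
  rw [enorm_pairingIntegrand, ← mul_assoc]
  gcongr
  exact hCb i z.1 z.2

theorem integrable_pairingIntegrand (hp : 1 < p) (hq : 1 ≤ q) (hα : 0 < α) (hβ : 0 < β)
    (hk : IsPiecewiseC1 k) (hd : d =ᵐ[volume] k) {f : 𝓢'(ℝ, ℂ)} (hf : f ∈ modSpace ψ p q)
    (i : ℤ × ℤ) : Integrable (pairingIntegrand ψ f (gaborSystem (𝓕 d) β α i : L2)) := by
  obtain ⟨C, hC, hCb⟩ := exists_enorm_stft_gaborSystem_le ψ α β hk hd
  obtain ⟨D, hD, hDb⟩ := exists_tsum_rho_lintegral_le hp hq hα hβ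
  refine ⟨(continuous_pairingIntegrand ψ f _).aestronglyMeasurable, ?_⟩
  refine (lintegral_enorm_pairingIntegrand_le hC hCb f i).trans_lt ?_
  -- A single term of the convergent double sum centred at the origin. Its prefactor is positive, so
  -- the integral itself is finite.
  have h1 := (ENNReal.le_tsum i).trans (hDb 0 0 _ (measurable_stft ψ f).enorm)
  rw [← modNorm_eq_mixedNorm] at h1
  have h2 := h1.trans_lt (ENNReal.mul_lt_top hD.lt_top hf)
  refine ENNReal.mul_lt_top hC.lt_top ?_
  rw [lt_top_iff_ne_top]
  intro htop
  rw [htop, ENNReal.mul_top] at h2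
  · exact lt_irrefl _ h2
  · exact mul_ne_zero (by simpa using rho_pos _ _) (by simpa using rho_pos _ _)

theorem integral_sq_norm_ne_zero (hψ : ψ ≠ 0) : ((∫ t, ‖ψ t‖ ^ 2 : ℝ) : ℂ) ≠ 0 := by
  obtain ⟨t, ht⟩ : ∃ t, ψ t ≠ 0 := by
    by_contra! h
    exact hψ (by ext t; simpa using h t)
  have hc : Continuous fun t ↦ ‖ψ t‖ ^ 2 := by
    have := ψ.continuous
    fun_prop
  have hint : Integrable fun t ↦ ‖ψ t‖ ^ 2 := by
    have := (ψ.memLp 2 volume)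
    exact (memLp_two_iff_integrable_sq_norm this.1).1 this
  have : 0 < ∫ t, ‖ψ t‖ ^ 2 :=
    integral_pos_of_integrable_nonneg_nonzero hc hint (fun t ↦ by positivity)
      (pow_ne_zero 2 (norm_ne_zero_iff.2 ht))
  exact_mod_cast this.ne'

/-- Sum the L² duality relation under the integral against V_ψ f. The sum over atoms turns the
integrand into that of the inversion formula, and division by ‖ψ‖² returns V_ψ f at the chosen
point. -/
theorem hasSum_coeffs_mul_stft (hψ : ψ ≠ 0) (hp : 1 < p) (hq : 1 ≤ q) (hα : 0 < α) (hβ : 0 < β)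
    (hh : IsPiecewiseC1 h) (he : e =ᵐ[volume] h) (hk : IsPiecewiseC1 k) (hd : d =ᵐ[volume] k)
    (hdual : IsDualPair e d α β) {f : 𝓢'(ℝ, ℂ)} (hf : f ∈ modSpace ψ p q) (x₀ w₀ : ℝ) :
    HasSum (fun i ↦ coeffs ψ (gaborSystem (𝓕 d) β α) f i *
      stft ψ (gaborSystem (𝓕 e) β α i : L2) x₀ w₀) (stft ψ f x₀ w₀) := by
  obtain ⟨C, hC, hCb⟩ := exists_enorm_stft_gaborSystem_le ψ α β hk hd
  obtain ⟨C', hC', hCb'⟩ := exists_enorm_stft_gaborSystem_le ψ α β hh he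
  obtain ⟨D, hD, hDb⟩ := exists_tsum_rho_lintegral_le hp hq hα hβ
  have hψ' := integral_sq_norm_ne_zero hψ
  set F : ℤ × ℤ → ℝ × ℝ → ℂ := fun i z ↦
    pairingIntegrand ψ f (gaborSystem (𝓕 d) β α i : L2) z *
      stft ψ (gaborSystem (𝓕 e) β α i : L2) x₀ w₀ with hF
  have hFint : ∀ i, Integrable (F i) := fun i ↦
    (integrable_pairingIntegrand hp hq hα hβ hk hd hf i).mul_const _
  have hFsum : ∑' i, ∫⁻ z, ‖F i z‖ₑ ≠ ∞ := by
    refine ne_top_of_le_ne_top (b := C * C' * (D * modNorm ψ p q f)) ?_ ?_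
    · exact ENNReal.mul_ne_top (ENNReal.mul_ne_top hC hC') (ENNReal.mul_ne_top hD (ne_of_lt hf))
    rw [modNorm_eq_mixedNorm]
    refine le_trans ?_ (mul_le_mul_right (hDb x₀ w₀ _ (measurable_stft ψ f).enorm) _)
    rw [← ENNReal.tsum_mul_left]
    refine ENNReal.tsum_le_tsum fun i ↦ ?_
    simp only [hF, enorm_mul]
    rw [lintegral_mul_const' _ _ enorm_ne_top]
    calc _ ≤ (C * ∫⁻ z : ℝ × ℝ, (ENNReal.ofReal (rho 1 (z.1 - β * i.1)) *
          ENNReal.ofReal (rho 2 (z.2 - α * i.2))) * ‖stft ψ f z.1 z.2‖ₑ) *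
          (C' * (ENNReal.ofReal (rho 1 (x₀ - β * i.1)) *
            ENNReal.ofReal (rho 2 (w₀ - α * i.2)))) := by
          gcongr
          · exact lintegral_enorm_pairingIntegrand_le hC hCb f i
          · exact hCb' i x₀ w₀
      _ = _ := by ring
  have hs : Summable fun i ↦ ∫ z, ‖F i z‖ := by
    have := ENNReal.summable_toReal hFsum
    refine this.congr fun i ↦ ?_
    rw [integral_norm_eq_lintegral_enorm (hFint i).1]
  have h1 := hasSum_integral_of_summable_integral_norm hFint hs
  have h2 : ∀ z, ∑' i, F i z = f (schwartzShift z.1 (-z.2) (schwartzConj ψ)) *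
      invCoeff (schwartzShift x₀ w₀ ψ) (schwartzConj ψ) z := fun z ↦ by
    rw [← stft_eq, ← ((hdual.hasSum_stft ψ x₀ w₀ z.1 z.2).mul_left (stft ψ f z.1 z.2)).tsum_eq]
    refine tsum_congr fun i ↦ ?_
    rw [hF]
    simp only [pairingIntegrand, mul_assoc]
  simp only [h2] at h1
  rw [integral_apply_schwartzShift] at h1
  have h3 : (∫ s, ‖schwartzConj ψ s‖ ^ 2) = ∫ s, ‖ψ s‖ ^ 2 := by
    simp only [schwartzConj_apply, RCLike.norm_conj]
  rw [h3] at h1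
  have h4 := h1.div_const (((∫ t, ‖ψ t‖ ^ 2 : ℝ) : ℂ))
  rw [mul_div_cancel_left₀ _ hψ'] at h4
  refine h4.congr_fun fun i ↦ ?_
  rw [coeffs, pairing, hF, integral_mul_const, div_mul_eq_mul_div]

end Reconstruction

end GaborMod
end

noncomputable section
namespace GaborMod

/-! ### Boundedness of analysis and synthesis -/

/-- The bound for finite sums passes to pointwise convergent series by Fatou's lemma. -/
theorem SynBound.hasSum {β p : ℝ} (hp : 0 < p) {K : ℝ → ℂ} {M : ℝ≥0∞} (h : SynBound β p K M)
    (hK : Measurable K) {c : ℤ → ℂ} {H : ℝ → ℂ}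
    (hH : ∀ x, HasSum (fun k ↦ c k * K (x - β * k)) (H x)) :
    lpn p volume (fun x ↦ ‖H x‖ₑ) ≤ M * lpn p Measure.count fun k : ℤ ↦ ‖c k‖ₑ := by
  -- Fatou's lemma is applied along a sequence, so the net of finite sets is replaced by a sequence
  -- tending to infinity in it.
  obtain ⟨s, hs⟩ : ∃ s : ℕ → Finset ℤ, Tendsto s atTop atTop :=
    exists_seq_tendsto _
  refine lpn_le_of_rpow_le hp ?_
  have hlim : ∀ x, ‖H x‖ₑ ^ p =
      liminf (fun N : ℕ ↦ ‖∑ k ∈ s N, c k * K (x - β * k)‖ₑ ^ p) atTop := fun x ↦ by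
    refine (Tendsto.liminf_eq ?_).symm
    exact (ENNReal.continuous_rpow_const.tendsto _).comp
      ((continuous_enorm.tendsto _).comp ((hH x).comp hs))
  simp only [hlim]
  refine (lintegral_liminf_le fun N ↦
    ((measurable_synthesis hK (s N) c).enorm.pow_const p)).trans ?_
  refine liminf_le_of_le (by isBoundedDefault) fun b hb ↦ ?_
  obtain ⟨N, hN⟩ := hb.exists
  refine hN.trans ?_
  rw [← lpn_rpow hp]
  refine ENNReal.rpow_le_rpow ((h (s N) c).trans ?_) hp.le
  gcongr
  rw [lpn_count]
  gcongr
  exact ENNReal.sum_le_tsum _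

theorem continuous_stft_left (ψ : 𝓢(ℝ, ℂ)) (f : 𝓢'(ℝ, ℂ)) (w : ℝ) :
    Continuous fun x ↦ stft ψ f x w := by
  have h : Continuous fun x : ℝ ↦ (x, w) := by fun_prop
  have h' := (continuous_stft ψ f).comp h
  simpa only [Function.comp_def] using h'

section Bounds

variable {ψ : 𝓢(ℝ, ℂ)} {p q α β : ℝ} {e d : L2} {h k : ℝ → ℂ}

theorem measurable_rho_lattice (α r : ℝ) :
    Measurable (Function.uncurry fun (n : ℤ) (w : ℝ) ↦ ENNReal.ofReal (rho r (w - α * n))) := by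
  refine Measurable.ennreal_ofReal ((continuous_rho r).measurable.comp ?_)
  exact measurable_snd.sub
    (((measurable_of_countable (fun k : ℤ ↦ (k : ℝ))).comp measurable_fst).const_mul α)

theorem exists_rho_marginals_le (hα : 0 < α) :
    ∃ C : ℝ≥0∞, C ≠ ∞ ∧ (∀ w : ℝ, ∫⁻ n : ℤ, ENNReal.ofReal (rho 2 (w - α * n)) ∂Measure.count ≤ C) ∧
      ∀ n : ℤ, ∫⁻ w : ℝ, ENNReal.ofReal (rho 2 (w - α * n)) ≤ C := by
  obtain ⟨C, hC, hCb⟩ := exists_tsum_rho_le (r := 2) (β := α) (by norm_num) hα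
  refine ⟨C + ∫⁻ w, ENNReal.ofReal (rho 2 w), ?_, fun w ↦ ?_, fun n ↦ ?_⟩
  · exact ENNReal.add_ne_top.2 ⟨hC, (lintegral_rho_lt_top (by norm_num)).ne⟩
  · rw [lintegral_count]
    exact (hCb w).trans le_self_add
  · rw [lintegral_rho_sub]
    exact le_add_self

/-- Boundedness of the synthesis operator from `ℓ^{p,q}` to `L^{p,q}(ℝ²)`. -/
theorem exists_mixedNorm_le_seqNorm (ψ : 𝓢(ℝ, ℂ)) (hp : 1 < p) (hq : 1 ≤ q) (hα : 0 < α)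
    (hβ : 0 < β) (hh : IsPiecewiseC1 h) (he : e =ᵐ[volume] h) :
    ∃ C : ℝ≥0∞, C ≠ ∞ ∧ ∀ (c : ℤ × ℤ → ℂ) (H : ℝ → ℝ → ℂ),
      (∀ x w, HasSum (fun i ↦ c i * stft ψ (gaborSystem (𝓕 e) β α i : L2) x w) (H x w)) →
      mixedNorm p q (fun z ↦ ‖H z.1 z.2‖ₑ) ≤ C * seqNorm p q c := by
  have hp0 : 0 < p := by linarith
  have hq0 : 0 < q := by linarith
  obtain ⟨M, hM, hMb⟩ := hh.exists_synBound (𝓕⁻ ψ) hβ hp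
  obtain ⟨C, hC, hC₁, hC₂⟩ := exists_rho_marginals_le hα
  refine ⟨M * C, ENNReal.mul_ne_top hM hC, fun c H hH ↦ ?_⟩
  have hK : Continuous fun z : ℝ × ℝ ↦ windowKernel (𝓕⁻ ψ) h z.1 z.2 :=
    continuous_windowKernel _ hh.integrable
  set a : ℤ → ℝ≥0∞ := fun n ↦ lpn p Measure.count fun k : ℤ ↦ ‖c (k, n)‖ₑ with ha
  -- For fixed w and n the phase does not depend on k, so it has no effect on the modulus of the row
  -- sum. The kernel bound treats each row, Minkowski adds the rows, and the Schur test in (w, n)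
  -- finishes.
  have key : ∀ w, lpn p volume (fun x ↦ ‖H x w‖ₑ) ≤
      ∫⁻ n : ℤ, ENNReal.ofReal (rho 2 (w - α * n)) * (M * a n) ∂Measure.count := by
    intro w
    have hsum : ∀ x n, Summable fun k : ℤ ↦ c (k, n) *
        windowKernel (𝓕⁻ ψ) h (x - β * k) (w - α * n) := fun x n ↦ by
      have h1 := (((hH x w).summable.comp_injective (Prod.mk_left_injective n))).mul_left
        (char x (w - α * n))
      refine h1.congr fun k ↦ ?_
      simp only [Function.comp_apply, stft_gaborSystem ψ he]
      rw [char_neg_left]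
      linear_combination (c (k, n) * windowKernel (𝓕⁻ ψ) h (x - β * k) (w - α * n)) *
        char_mul_char_neg x (w - α * n)
    set S : ℝ → ℤ → ℂ := fun x n ↦
      ∑' k : ℤ, c (k, n) * windowKernel (𝓕⁻ ψ) h (x - β * k) (w - α * n) with hS
    have hle : ∀ x, ‖H x w‖ₑ ≤ ∫⁻ n : ℤ, ‖S x n‖ₑ ∂Measure.count := fun x ↦ by
      rw [lintegral_count]
      have h1 : HasSum (fun i : ℤ × ℤ ↦ c i.swap *
          stft ψ (gaborSystem (𝓕 e) β α i.swap : L2) x w) (H x w) :=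
        ((Equiv.prodComm ℤ ℤ).hasSum_iff).2 (hH x w)
      have h2 : HasSum (fun n : ℤ ↦ char (-x) (w - α * n) * S x n) (H x w) := by
        refine h1.prod_fiberwise fun n ↦ ?_
        have := ((hsum x n).hasSum).mul_left (char (-x) (w - α * n))
        refine this.congr_fun fun k ↦ ?_
        simp only [Prod.swap_prod_mk, stft_gaborSystem ψ he]
        ring
      rw [← h2.tsum_eq]
      refine enorm_tsum_le_tsum_enorm.trans (ENNReal.tsum_le_tsum fun n ↦ ?_)
      rw [enorm_mul, enorm_char, one_mul]
    have hSm : Measurable (Function.uncurry fun (x : ℝ) (n : ℤ) ↦ ‖S x n‖ₑ) := by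
      refine measurable_from_prod_countable_left fun n ↦ ?_
      refine Measurable.enorm (Measurable.tsum fun k ↦ ?_)
      have h1 : Measurable fun x : ℝ ↦ windowKernel (𝓕⁻ ψ) h (x - β * k) (w - α * n) :=
        (continuous_windowKernel_left (𝓕⁻ ψ) hh.integrable (w - α * n)).measurable.comp
          (by fun_prop : Measurable fun x : ℝ ↦ x - β * k)
      exact h1.const_mul (c (k, n))
    calc lpn p volume (fun x ↦ ‖H x w‖ₑ)
        ≤ lpn p volume (fun x ↦ ∫⁻ n : ℤ, ‖S x n‖ₑ ∂Measure.count) := lpn_mono hp0.le hle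
      _ ≤ ∫⁻ n : ℤ, lpn p volume (fun x ↦ ‖S x n‖ₑ) ∂Measure.count := lpn_lintegral_le hp.le hSm
      _ ≤ _ := by
        refine lintegral_mono fun n ↦ ?_
        have h1 := SynBound.hasSum hp0 (hMb (w - α * n))
          (continuous_windowKernel_left _ hh.integrable _).measurable
          (c := fun k ↦ c (k, n)) (H := fun x ↦ S x n) fun x ↦ (hsum x n).hasSum
        refine h1.trans_eq ?_
        rw [ha]; ring
  calc mixedNorm p q (fun z ↦ ‖H z.1 z.2‖ₑ)
      ≤ lpn q volume (fun w : ℝ ↦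
          ∫⁻ n : ℤ, ENNReal.ofReal (rho 2 (w - α * n)) * (M * a n) ∂Measure.count) :=
        lpn_mono hq0.le key
    _ ≤ C * lpn q Measure.count (fun n ↦ M * a n) :=
        lpn_lintegral_mul_le hq (measurable_lattice_rho α 2) (measurable_of_countable _) hC₁ hC₂
    _ = _ := by rw [lpn_const_mul hq0 hM, seqNorm_eq_lpn]; ring

/-- Boundedness of the analysis operator from `M^{p,q}` to `ℓ^{p,q}`. -/
theorem exists_seqNorm_coeffs_le (hp : 1 < p) (hq : 1 ≤ q) (hα : 0 < α) (hβ : 0 < β)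
    (hk : IsPiecewiseC1 k) (hd : d =ᵐ[volume] k) :
    ∃ C : ℝ≥0∞, C ≠ ∞ ∧ ∀ f ∈ modSpace ψ p q,
      seqNorm p q (coeffs ψ (gaborSystem (𝓕 d) β α) f) ≤ C * modNorm ψ p q f := by
  have hp0 : 0 < p := by linarith
  have hq0 : 0 < q := by linarith
  -- Analysis into ℓ^p is the transpose of synthesis on ℓ^{p'}, so the kernel bound is taken at the
  -- conjugate exponent, again greater than one.
  have hpp' := Real.HolderConjugate.conjExponent hp
  obtain ⟨M, hM, hMb⟩ := hk.exists_synBound (𝓕⁻ ψ) hβ hpp'.symm.lt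
  obtain ⟨C, hC, hC₁, hC₂⟩ := exists_rho_marginals_le hα
  set N₀ : ℝ≥0∞ := ‖(((∫ t, ‖ψ t‖ ^ 2 : ℝ) : ℂ))⁻¹‖ₑ with hN₀
  refine ⟨N₀ * M * C, by finiteness, fun f hf ↦ ?_⟩
  have hVm := (measurable_stft ψ f).enorm
  set N : ℝ → ℝ≥0∞ := fun w ↦ lpn p volume fun x ↦ ‖stft ψ f x w‖ₑ with hN
  have hNm : Measurable N := measurable_lpn_left hVm p
  -- The transpose estimate on a horizontal slice requires that slice to lie in L^p, which holds for
  -- almost every w.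
  have hNfin : ∀ᵐ w, N w ≠ ∞ := by
    have h1 : ∫⁻ w, N w ^ q ≠ ∞ := by
      have : modNorm ψ p q f = lpn q volume N := modNorm_eq_mixedNorm ψ p q f
      rw [← lpn_rpow hq0, ← this]
      exact ENNReal.rpow_ne_top_of_nonneg hq0.le (ne_of_lt hf)
    filter_upwards [ae_lt_top (hNm.pow_const q) h1] with w hw htop
    rw [htop, ENNReal.top_rpow_of_pos hq0] at hw
    exact lt_irrefl _ hw
  set P : ℤ × ℤ → ℝ → ℂ := fun i w ↦
    ∫ x, pairingIntegrand ψ f (gaborSystem (𝓕 d) β α i : L2) (x, w) with hP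
  have hPm : ∀ i, Measurable (P i) := fun i ↦
    (StronglyMeasurable.integral_prod_left'
      (continuous_pairingIntegrand ψ f _).stronglyMeasurable).measurable
  have hcoef : ∀ i, ‖coeffs ψ (gaborSystem (𝓕 d) β α) f i‖ₑ ≤ ∫⁻ w, N₀ * ‖P i w‖ₑ := fun i ↦ by
    have hint := integrable_pairingIntegrand hp hq hα hβ hk hd hf i
    rw [lintegral_const_mul _ (hPm i).enorm, coeffs, pairing, div_eq_mul_inv, enorm_mul, mul_comm,
      Measure.volume_eq_prod, integral_prod_symm _ hint]
    gcongr
    exact enorm_integral_le_lintegral_enorm _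
  have hslice : ∀ n : ℤ, ∀ᵐ w, lpn p Measure.count (fun k : ℤ ↦ N₀ * ‖P (k, n) w‖ₑ) ≤
      N₀ * M * (ENNReal.ofReal (rho 2 (w - α * n)) * N w) := fun n ↦ by
    filter_upwards [hNfin] with w hw
    -- The pairing conjugates the window while the transpose is bilinear, so the integral is
    -- conjugated. The phase of the atom, independent of k, is moved into `F`.
    set F : ℝ → ℂ := fun x ↦ conj (stft ψ f x w) * char (-(w - α * n)) x with hF
    have hFn : ∀ x, ‖F x‖ₑ = ‖stft ψ f x w‖ₑ := fun x ↦ by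
      rw [hF, enorm_mul, enorm_char, mul_one, RCLike.enorm_conj]
    have hFm : Measurable F := by
      exact ((Complex.continuous_conj.comp (continuous_stft_left ψ f w)).mul (continuous_char _)).measurable
    have h1 := SynBound.analysis (K := fun x ↦ windowKernel (𝓕⁻ ψ) k x (w - α * n))
      (M := M * ENNReal.ofReal (rho 2 (w - α * n))) (F := F) (β := β) hpp'.symm
      (ENNReal.mul_ne_top hM ENNReal.ofReal_ne_top)
      (continuous_windowKernel_left (𝓕⁻ ψ) hk.integrable (w - α * n)).measurable
      (hMb (w - α * n)) hFm
      (by simp only [hFn]; exact hw)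
    simp only [hFn] at h1
    rw [lpn_const_mul hp0 enorm_ne_top]
    calc _ ≤ N₀ * (M * ENNReal.ofReal (rho 2 (w - α * n)) * N w) := by
          gcongr
          refine le_trans (le_of_eq ?_) h1
          congr 1
          funext k
          rw [hP, ← RCLike.enorm_conj]
          simp only
          rw [← integral_conj]
          congr 1
          refine integral_congr_ae (Eventually.of_forall fun x ↦ ?_)
          simp only [pairingIntegrand, map_mul, Complex.conj_conj, hF]
          rw [stft_gaborSystem ψ hd, char_comm (-(w - α * n)) x]
          rw [← char_neg_left]
          ring
      _ = _ := by ring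
  rw [seqNorm_eq_lpn]
  calc _ ≤ lpn q Measure.count (fun n : ℤ ↦
        ∫⁻ w, ENNReal.ofReal (rho 2 (w - α * n)) * (N₀ * M * N w)) := by
        refine lpn_mono hq0.le fun n ↦ ?_
        calc lpn p Measure.count (fun k : ℤ ↦ ‖coeffs ψ (gaborSystem (𝓕 d) β α) f (k, n)‖ₑ)
            ≤ lpn p Measure.count (fun k : ℤ ↦ ∫⁻ w, N₀ * ‖P (k, n) w‖ₑ) :=
              lpn_mono hp0.le fun k ↦ hcoef (k, n)
          _ ≤ ∫⁻ w, lpn p Measure.count (fun k : ℤ ↦ N₀ * ‖P (k, n) w‖ₑ) :=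
              lpn_lintegral_le hp.le (measurable_from_prod_countable_right fun k ↦
                (hPm (k, n)).enorm.const_mul _)
          _ ≤ _ := by
              refine lintegral_mono_ae ?_
              filter_upwards [hslice n] with w hw
              refine hw.trans_eq ?_
              ring
    _ ≤ C * lpn q volume (fun w ↦ N₀ * M * N w) :=
        lpn_lintegral_mul_le hq (measurable_rho_lattice α 2) (hNm.const_mul _) hC₂ hC₁
    _ = _ := by
        rw [lpn_const_mul hq0 (ENNReal.mul_ne_top enorm_ne_top hM), modNorm_eq_mixedNorm, mixedNorm]
        ring

end Bounds

end GaborMod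
end

noncomputable section
namespace GaborMod

/-! ### Unconditional convergence of the expansions -/

/-- The tails of a sequence in `ℓ^{p,q}` tend to zero. -/
theorem tendsto_seqNorm_compl {p q : ℝ} (hp : 0 < p) (hq : 0 < q) {c : ℤ × ℤ → ℂ}
    (hc : seqNorm p q c ≠ ∞) :
    Tendsto (fun s : Finset (ℤ × ℤ) ↦ seqNorm p q ((s : Set (ℤ × ℤ))ᶜ.indicator c))
      atTop (𝓝 0) := by
  have hqp : 0 < q / p := div_pos hq hp
  have hle : ∀ (s : Finset (ℤ × ℤ)) i, ‖(s : Set (ℤ × ℤ))ᶜ.indicator c i‖ₑ ≤ ‖c i‖ₑ := fun s i ↦ by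
    by_cases hi : i ∈ (s : Set (ℤ × ℤ))ᶜ
    · rw [indicator_of_mem hi]
    · rw [indicator_of_notMem hi]; simp
  have htot : ∑' n : ℤ, (∑' k : ℤ, ‖c (k, n)‖ₑ ^ p) ^ (q / p) ≠ ∞ := fun htop ↦ by
    rw [seqNorm, htop, ENNReal.top_rpow_of_pos (by positivity)] at hc
    exact hc rfl
  have hrow : ∀ n : ℤ, ∑' k : ℤ, ‖c (k, n)‖ₑ ^ p ≠ ∞ := fun n htop ↦ by
    refine ENNReal.ne_top_of_tsum_ne_top htot n ?_
    rw [htop, ENNReal.top_rpow_of_pos hqp]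
  -- Dominated convergence is used twice, within each row and then over the rows; a fixed index
  -- leaves the complement as soon as `s` contains it.
  have hrowlim : ∀ n : ℤ, Tendsto (fun s : Finset (ℤ × ℤ) ↦
      ∑' k : ℤ, ‖(s : Set (ℤ × ℤ))ᶜ.indicator c (k, n)‖ₑ ^ p) atTop (𝓝 0) := fun n ↦ by
    simp only [← lintegral_count]
    have h0 : (0 : ℝ≥0∞) = ∫⁻ _ : ℤ, 0 ∂Measure.count := by simp
    rw [h0]
    refine tendsto_lintegral_filter_of_dominated_convergence (fun k : ℤ ↦ ‖c (k, n)‖ₑ ^ p)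
      (Eventually.of_forall fun s ↦ measurable_of_countable _)
      (Eventually.of_forall fun s ↦ Eventually.of_forall fun k ↦
        ENNReal.rpow_le_rpow (hle s _) hp.le) (by rw [lintegral_count]; exact hrow n)
      (Eventually.of_forall fun k ↦ ?_)
    refine tendsto_const_nhds.congr' ?_
    filter_upwards [eventually_ge_atTop {(k, n)}] with s hs
    rw [indicator_of_notMem]
    · simp [hp]
    · simpa using hs
  have hlim : Tendsto (fun s : Finset (ℤ × ℤ) ↦
      ∑' n : ℤ, (∑' k : ℤ, ‖(s : Set (ℤ × ℤ))ᶜ.indicator c (k, n)‖ₑ ^ p) ^ (q / p))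
      atTop (𝓝 0) := by
    simp only [← lintegral_count (α := ℤ) (fun n ↦ (_ : ℝ≥0∞) ^ (q / p))]
    have h0 : (0 : ℝ≥0∞) = ∫⁻ _ : ℤ, 0 ∂Measure.count := by simp
    rw [h0]
    refine tendsto_lintegral_filter_of_dominated_convergence
      (fun n : ℤ ↦ (∑' k : ℤ, ‖c (k, n)‖ₑ ^ p) ^ (q / p))
      (Eventually.of_forall fun s ↦ measurable_of_countable _)
      (Eventually.of_forall fun s ↦ Eventually.of_forall fun n ↦
        ENNReal.rpow_le_rpow (ENNReal.tsum_le_tsum fun k ↦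
          ENNReal.rpow_le_rpow (hle s _) hp.le) hqp.le) (by rw [lintegral_count]; exact htot)
      (Eventually.of_forall fun n ↦ ?_)
    have := (ENNReal.continuous_rpow_const (y := q / p)).tendsto 0
    rw [ENNReal.zero_rpow_of_pos hqp] at this
    exact this.comp (hrowlim n)
  have := (ENNReal.continuous_rpow_const (y := 1 / q)).tendsto 0
  rw [ENNReal.zero_rpow_of_pos (by positivity)] at this
  exact this.comp hlim

theorem seqNorm_ne_top_of_finite {p q : ℝ} (hp : 0 < p) (hq : 0 < q) (c : ℤ × ℤ → ℂ)
    (s : Finset (ℤ × ℤ)) (hc : ∀ i ∉ s, c i = 0) : seqNorm p q c ≠ ∞ := by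
  classical
  have hqp : 0 < q / p := div_pos hq hp
  have hrow : ∀ n : ℤ, ∑' k : ℤ, ‖c (k, n)‖ₑ ^ p ≠ ∞ := fun n ↦ by
    rw [tsum_eq_sum (s := s.image Prod.fst)]
    · refine (ENNReal.sum_lt_top.2 fun k _ ↦ ?_).ne
      exact ENNReal.rpow_lt_top_of_nonneg hp.le enorm_ne_top
    · intro k hk
      rw [hc (k, n) fun h ↦ hk (Finset.mem_image_of_mem Prod.fst h)]
      simp [hp]
  refine ENNReal.rpow_ne_top_of_nonneg (by positivity) ?_
  rw [tsum_eq_sum (s := s.image Prod.snd)]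
  · refine (ENNReal.sum_lt_top.2 fun n _ ↦ ?_).ne
    exact ENNReal.rpow_lt_top_of_nonneg hqp.le (hrow n)
  · intro n hn
    have : ∀ k : ℤ, ‖c (k, n)‖ₑ ^ p = 0 := fun k ↦ by
      rw [hc (k, n) fun h ↦ hn (Finset.mem_image_of_mem Prod.snd h)]
      simp [hp]
    simp [this, hqp]

theorem stft_sub_sum (ψ : 𝓢(ℝ, ℂ)) {ι : Type*} (f : 𝓢'(ℝ, ℂ)) (c : ι → ℂ) (u : ι → 𝓢'(ℝ, ℂ))
    (s : Finset ι) (x w : ℝ) :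
    stft ψ (f - ∑ i ∈ s, c i • u i) x w = stft ψ f x w - ∑ i ∈ s, c i * stft ψ (u i) x w := by
  let E : 𝓢'(ℝ, ℂ) →+ ℂ :=
    { toFun := fun v ↦ stft ψ v x w
      map_zero' := rfl
      map_add' := fun _ _ ↦ rfl }
  change E _ = E f - _
  rw [map_sub, map_sum]
  rfl

theorem stft_smul (ψ : 𝓢(ℝ, ℂ)) (f : 𝓢'(ℝ, ℂ)) (c : ℂ) (x w : ℝ) :
    stft ψ (c • f) x w = c * stft ψ f x w := rfl

section Expansion

variable {ψ : 𝓢(ℝ, ℂ)} {p q α β : ℝ} {e d : L2} {h k : ℝ → ℂ}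

/-- By the pointwise reconstruction, the transform of the remainder is the synthesis of the
coefficients outside the finite set. The synthesis bound controls its norm by a tail in ℓ^{p,q}. -/
theorem hasExpansion (hψ : ψ ≠ 0) (hp : 1 < p) (hq : 1 ≤ q) (hα : 0 < α) (hβ : 0 < β)
    (hh : IsPiecewiseC1 h) (he : e =ᵐ[volume] h) (hk : IsPiecewiseC1 k) (hd : d =ᵐ[volume] k)
    (hdual : IsDualPair e d α β) {f : 𝓢'(ℝ, ℂ)} (hf : f ∈ modSpace ψ p q) :
    HasExpansion ψ p q (gaborSystem (𝓕 d) β α) (gaborSystem (𝓕 e) β α) f := by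
  classical
  have hp0 : 0 < p := by linarith
  have hq0 : 0 < q := by linarith
  obtain ⟨C, hC, hCb⟩ := exists_mixedNorm_le_seqNorm ψ hp hq hα hβ hh he
  obtain ⟨D, hD, hDb⟩ := exists_seqNorm_coeffs_le hp hq hα hβ hk hd (ψ := ψ)
  set c := coeffs ψ (gaborSystem (𝓕 d) β α) f with hc
  have hcfin : seqNorm p q c ≠ ∞ :=
    ne_top_of_le_ne_top (ENNReal.mul_ne_top hD (ne_of_lt hf)) (hDb f hf)
  refine ⟨integrable_pairingIntegrand hp hq hα hβ hk hd hf, fun i ↦ ?_, ?_⟩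
  -- Synthesis of a one-point sequence shows that each term of the series lies in the modulation
  -- space.
  · have h1 := hCb (Pi.single i (c i)) (fun x w ↦ c i * stft ψ (gaborSystem (𝓕 e) β α i : L2) x w)
      fun x w ↦ by
        have := hasSum_single (f := fun j ↦ (Pi.single i (c i) : ℤ × ℤ → ℂ) j *
          stft ψ (gaborSystem (𝓕 e) β α j : L2) x w) i fun j hj ↦ by simp [hj]
        simpa using this
    change modNorm ψ p q _ < ∞
    rw [modNorm_eq_mixedNorm]
    simp only [stft_smul]
    refine h1.trans_lt (ENNReal.mul_lt_top hC.lt_top (seqNorm_ne_top_of_finite hp0 hq0 _ {i}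
      fun j hj ↦ ?_).lt_top)
    have : j ≠ i := by simpa using hj
    simp [this]
  · have hbound : ∀ s : Finset (ℤ × ℤ),
        modNorm ψ p q (f - ∑ i ∈ s, c i • ((gaborSystem (𝓕 e) β α i : L2) : 𝓢'(ℝ, ℂ))) ≤
          C * seqNorm p q ((s : Set (ℤ × ℤ))ᶜ.indicator c) := fun s ↦ by
      rw [modNorm_eq_mixedNorm]
      simp only [stft_sub_sum]
      refine hCb _ (fun x w ↦ stft ψ f x w -
        ∑ i ∈ s, c i * stft ψ (gaborSystem (𝓕 e) β α i : L2) x w) fun x w ↦ ?_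
      have h1 := hasSum_coeffs_mul_stft hψ hp hq hα hβ hh he hk hd hdual hf x w
      have h2 : HasSum (fun i ↦ if i ∈ s then
          c i * stft ψ (gaborSystem (𝓕 e) β α i : L2) x w else 0)
          (∑ i ∈ s, c i * stft ψ (gaborSystem (𝓕 e) β α i : L2) x w) := by
        have := hasSum_sum_of_ne_finset_zero (L := .unconditional _) (s := s) (f := fun i ↦ if i ∈ s then
          c i * stft ψ (gaborSystem (𝓕 e) β α i : L2) x w else 0) fun i hi ↦ if_neg hi
        rwa [Finset.sum_congr rfl fun i hi ↦ if_pos hi] at this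
      refine (h1.sub h2).congr_fun fun i ↦ ?_
      by_cases hi : i ∈ s <;> simp [hi, hc]
    have h0 := ENNReal.Tendsto.const_mul (a := C) (tendsto_seqNorm_compl hp0 hq0 hcfin)
      (Or.inr hC)
    rw [mul_zero] at h0
    exact tendsto_of_tendsto_of_tendsto_of_le_of_le tendsto_const_nhds h0 (fun s ↦ zero_le)
      hbound

/-- V_ψ f is the synthesis of its own coefficients with the dual window, so the synthesis bound
becomes the lower inequality for the coefficients. -/
theorem exists_modNorm_le_seqNorm_coeffs (hψ : ψ ≠ 0) (hp : 1 < p) (hq : 1 ≤ q) (hα : 0 < α)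
    (hβ : 0 < β) (hh : IsPiecewiseC1 h) (he : e =ᵐ[volume] h) (hk : IsPiecewiseC1 k)
    (hd : d =ᵐ[volume] k) (hdual : IsDualPair e d α β) :
    ∃ C : ℝ≥0∞, C ≠ ∞ ∧ ∀ f ∈ modSpace ψ p q,
      modNorm ψ p q f ≤ C * seqNorm p q (coeffs ψ (gaborSystem (𝓕 d) β α) f) := by
  obtain ⟨C, hC, hCb⟩ := exists_mixedNorm_le_seqNorm ψ hp hq hα hβ hh he
  refine ⟨C, hC, fun f hf ↦ ?_⟩
  rw [modNorm_eq_mixedNorm]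
  exact hCb _ _ (hasSum_coeffs_mul_stft hψ hp hq hα hβ hh he hk hd hdual hf)

end Expansion

end GaborMod
end

/-! ### Frame property, expansions and norm equivalence. -/

theorem mainTheorem2 (a b α β δ : ℝ) (hab : a < b) (hα : 0 < α) (hαab : α ≤ b - a)
    (hβ : 0 < β) (habβ : b - a ≤ β⁻¹) (g : ℝ → ℂ) (hg : GaborMod.IsC1AC g a b)
    (hδ : 0 < δ) (hgδ : ∀ x ∈ Icc a b, δ ≤ ‖g x‖) :
    GaborMod.IsFrame (GaborMod.gaborSystem (GaborMod.cutoff hg) α β) ∧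
    ∃ γ : GaborMod.L2,
      (∀ γ' : GaborMod.L2,
        GaborMod.IsCanonicalDual (GaborMod.gaborSystem (GaborMod.cutoff hg) α β)
          (GaborMod.gaborSystem γ' α β) ↔ γ' = γ) ∧
      ∀ ψ : 𝓢(ℝ, ℂ), ψ ≠ 0 → ∀ p q : ℝ, 1 < p → 1 ≤ q →
        (∀ f ∈ GaborMod.modSpace ψ p q,
          GaborMod.HasExpansion ψ p q (GaborMod.gaborSystem (𝓕 γ) β α)
            (GaborMod.gaborSystem (𝓕 (GaborMod.cutoff hg)) β α) f ∧
          GaborMod.HasExpansion ψ p q (GaborMod.gaborSystem (𝓕 (GaborMod.cutoff hg)) β α)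
            (GaborMod.gaborSystem (𝓕 γ) β α) f) ∧
        ∃ A B : ℝ, 0 < A ∧ 0 < B ∧ ∀ f ∈ GaborMod.modSpace ψ p q,
          ENNReal.ofReal A * GaborMod.modNorm ψ p q f ≤
            GaborMod.seqNorm p q
              (GaborMod.coeffs ψ (GaborMod.gaborSystem (𝓕 (GaborMod.cutoff hg)) β α) f) ∧
          GaborMod.seqNorm p q
              (GaborMod.coeffs ψ (GaborMod.gaborSystem (𝓕 (GaborMod.cutoff hg)) β α) f) ≤
            ENNReal.ofReal B * GaborMod.modNorm ψ p q f := by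
  obtain ⟨C, hwin⟩ := GaborMod.isWindow_indicator hg hgδ
  have he : GaborMod.cutoff hg =ᵐ[volume] indicator (Icc a b) g := hg.memLp.coeFn_toLp
  obtain ⟨γ, hγ, hcan, hexp⟩ := hwin.exists_dual hα hαab hβ habβ hδ he
  obtain ⟨h, hh, heh⟩ := GaborMod.exists_isPiecewiseC1_cutoff hg hab
  obtain ⟨k, hk, hfk⟩ := GaborMod.exists_isPiecewiseC1_dual hg hab hα hβ hδ hgδ
  have hγk : γ =ᵐ[volume] k := hγ.trans hfk
  have hdual : GaborMod.IsDualPair γ (GaborMod.cutoff hg) α β := hexp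
  refine ⟨hwin.isFrame hα hαab hβ habβ hδ he, γ, hcan, fun ψ hψ p q hp hq ↦
    ⟨fun f hf ↦ ⟨GaborMod.hasExpansion hψ hp hq hα hβ hh heh hk hγk hdual.symm hf,
      GaborMod.hasExpansion hψ hp hq hα hβ hk hγk hh heh hdual hf⟩, ?_⟩⟩
  obtain ⟨C₁, hC₁, h₁⟩ := GaborMod.exists_modNorm_le_seqNorm_coeffs hψ hp hq hα hβ hk hγk hh heh
    hdual
  obtain ⟨C₂, hC₂, h₂⟩ := GaborMod.exists_seqNorm_coeffs_le (ψ := ψ) hp hq hα hβ hh heh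
  -- Adding 1 keeps both constants positive even if `C₁` or `C₂` is zero.
  refine ⟨(C₁.toReal + 1)⁻¹, C₂.toReal + 1, by positivity, by positivity, fun f hf ↦ ⟨?_, ?_⟩⟩
  · rw [ENNReal.ofReal_inv_of_pos (by positivity), mul_comm, ← div_eq_mul_inv]
    refine ENNReal.div_le_of_le_mul' ((h₁ f hf).trans ?_)
    gcongr
    rw [ENNReal.ofReal_add (by positivity) (by positivity), ENNReal.ofReal_toReal hC₁]
    exact le_self_add
  · refine (h₂ f hf).trans ?_
    gcongr
    rw [ENNReal.ofReal_add (by positivity) (by positivity), ENNReal.ofReal_toReal hC₂]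
    exact le_self_add
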